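/- Let $\Lambda$ be the von Mangoldt function, $\Gamma$ the Euler Gamma-function, and for $n\ge 1$ let $R_G(n)=\sum_{m_1+m_2=n}\Lambda(m_1)\Lambda(m_2)$, the sum being over positive integers $m_1,m_2$. There is an integer $N_0$ such that for every real number $k>1$ there is a constant $C_k$ depending only on $k$ with the following property. For every integer $N\ge N_0$ the two series over zeros below converge absolutely (the second one as a double series over pairs $(\rho_1,\rho_2)$), and $$ \sum_{n \le N} R_G(n)\,\frac{(1-n/N)^k}{\Gamma(k+1)} = \frac{N^2}{\Gamma(k+3)} - 2\sum_{\rho}\frac{\Gamma(\rho)}{\Gamma(\rho+k+2)}\,N^{\rho+1} + \sum_{\rho_1}\sum_{\rho_2}\frac{\Gamma(\rho_1)\Gamma(\rho_2)}{\Gamma(\rho_1+\rho_2+k+1)}\,N^{\rho_1+\rho_2} + E_k(N), \qquad |E_k(N)|\le C_k N, $$ where $\rho$, with or without subscripts, runs over the non-trivial zeros of the Riemann zeta-function $\zeta(s)$ (those with $0<\Re(s)<1$), counted with multiplicity. -/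

import Mathlib

/-- The weighted number of representations of `n` as a sum of two prime powers:
`∑_{m₁ + m₂ = n} Λ(m₁) Λ(m₂)`, where `Λ` is the von Mangoldt function (and `Λ(0) = 0`). -/
noncomputable def goldbachR (n : ℕ) : ℝ :=
  ∑ m ∈ Finset.HasAntidiagonal.antidiagonal n,
    ArithmeticFunction.vonMangoldt m.1 * ArithmeticFunction.vonMangoldt m.2

/-- The set of non-trivial zeros of the Riemann zeta-function. -/
def zetaZeros : Set ℂ := {ρ : ℂ | riemannZeta ρ = 0 ∧ 0 < ρ.re ∧ ρ.re < 1}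

/-- The multiplicity of a point as a zero of the Riemann zeta-function. -/
noncomputable def zetaMult (ρ : ℂ) : ℕ := analyticOrderNatAt riemannZeta ρ

/-- The Cesàro average `∑_{n ≤ N} R_G(n) (1 - n/N)^k / Γ(k+1)`. -/
noncomputable def goldbachCesaro (k : ℝ) (N : ℕ) : ℝ :=
  ∑ n ∈ Finset.Icc 1 N, goldbachR n * ((1 - (n : ℝ) / (N : ℝ)) ^ k / Real.Gamma (k + 1))

/-- The contribution `Γ(ρ) / Γ(ρ + k + 2) * N^(ρ + 1)` of the zero `ρ`, taken as often as
its multiplicity indicates. -/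
noncomputable def singleTerm (k : ℝ) (N : ℕ) (ρ : ℂ) : ℂ :=
  (zetaMult ρ : ℂ) *
    (Complex.Gamma ρ / Complex.Gamma (ρ + (k : ℂ) + 2) * (N : ℂ) ^ (ρ + 1))

/-- The contribution `Γ(ρ₁) Γ(ρ₂) / Γ(ρ₁ + ρ₂ + k + 1) * N^(ρ₁ + ρ₂)` of a pair of zeros, taken
as often as their multiplicities indicate. -/
noncomputable def doubleTerm (k : ℝ) (N : ℕ) (ρ₁ ρ₂ : ℂ) : ℂ :=
  (zetaMult ρ₁ : ℂ) * (zetaMult ρ₂ : ℂ) *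
    (Complex.Gamma ρ₁ * Complex.Gamma ρ₂ / Complex.Gamma (ρ₁ + ρ₂ + (k : ℂ) + 1) *
      (N : ℂ) ^ (ρ₁ + ρ₂))

/-!
Put `a = (k + 1) / 2`. By the Beta integral, the convolution square over `[0, N]` of the Riesz mean
`ψ_a(x) = ∑ n ≤ x, Λ(n) (x - n) ^ (a - 1)` is `Γ(a) ^ 2 N ^ k` times the Cesàro mean of the Goldbach
representation function. Since `a > 1`, the explicit formula
`ψ_a(x) = x ^ a / a - ∑_ρ B(ρ, a) x ^ (ρ + a - 1) + O(N ^ (a - 1))` holds uniformly for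
`0 ≤ x ≤ N`, with an absolutely convergent sum over the zeros. Multiplying out the convolution
square of this expansion gives the main term, the single and the double sum over zeros, and, as
`ψ_a(x) = O(N ^ a)` by Chebyshev's bound, the error term contributes `O(N ^ (2 a)) = O(N ^ k N)`.

The explicit formula needs no contour shift. The entire function `(s - 1) ζ(s)` has order less than
`2`, so that its logarithmic derivative is, up to a constant, the sum over its zeros `z` of
`1 / (s - z) + 1 / z`. The product of each summand with `B(s, a)` is the Mellin transform of a
multiple of `t ^ (-z) ∫_t^1 (1 - u) ^ (a - 2) u ^ z du`, `0 < t < 1`, and the formula follows from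
the injectivity of the Mellin transform.
-/

open Complex Metric Filter Topology MeasureTheory intervalIntegral

/-! ### Entire functions of order less than two -/

/-- `f` grows on `S` at most like `exp (C |z| ^ p)` for some `C`; for `S = univ` this is the growth
condition on an entire function of order `p`. The use of `1 + ‖z‖` in place of `‖z‖` makes the bound
uniform near the origin. -/
def HasExpGrowthOn (f : ℂ → ℂ) (p : ℝ) (S : Set ℂ) : Prop :=
  ∃ C : ℝ, 0 < C ∧ ∀ z ∈ S, ‖f z‖ ≤ Real.exp (C * (1 + ‖z‖) ^ p)

theorem analyticOrderAt_ne_top_of_differentiable {f : ℂ → ℂ} (hf : Differentiable ℂ f) {w : ℂ}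
    (hw : f w ≠ 0) (z : ℂ) : analyticOrderAt f z ≠ ⊤ := by
  have hA : AnalyticOnNhd ℂ f Set.univ := fun x _ => hf.analyticAt x
  refine hA.analyticOrderAt_ne_top_of_isPreconnected isPreconnected_univ (Set.mem_univ w)
    (Set.mem_univ z) ?_
  rw [(hf.analyticAt w).analyticOrderAt_eq_zero.2 hw]
  exact ENat.zero_ne_top

theorem analyticOrderNatAt_eq_zero_of_ne_zero {f : ℂ → ℂ} (hf : Differentiable ℂ f) {z : ℂ}
    (hz : f z ≠ 0) : analyticOrderNatAt f z = 0 := by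
  rw [analyticOrderNatAt, (hf.analyticAt z).analyticOrderAt_eq_zero.2 hz, ENat.toNat_zero]

theorem exists_eq_sub_pow_mul {f : ℂ → ℂ} (hf : Differentiable ℂ f) {ρ : ℂ}
    (hρ : analyticOrderAt f ρ ≠ ⊤) :
    ∃ g : ℂ → ℂ, Differentiable ℂ g ∧
      (∀ z, f z = (z - ρ) ^ analyticOrderNatAt f ρ * g z) ∧ g ρ ≠ 0 := by
  obtain ⟨P, hP⟩ := hf.analyticAt ρ
  have hP0 : P ≠ 0 := fun h => hρ (analyticOrderAt_eq_top.2 (hP.locally_zero_iff.2 h))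
  have hdiff : ∀ n : ℕ, Differentiable ℂ ((Function.swap dslope ρ)^[n] f) := by
    intro n
    induction n with
    | zero => exact hf
    | succ n ih =>
      rw [Function.iterate_succ_apply']
      exact differentiableOn_univ.1
        ((differentiableOn_dslope univ_mem).2 ih.differentiableOn)
  have hord : analyticOrderAt f ρ = P.order :=
    (hf.analyticAt ρ).analyticOrderAt_eq_natCast.2 ⟨_, (hdiff P.order).analyticAt ρ,
      hP.iterate_dslope_fslope_ne_zero hP0, .of_forall hP.eq_pow_order_mul_iterate_dslope⟩
  refine ⟨_, hdiff P.order, fun z => ?_, hP.iterate_dslope_fslope_ne_zero hP0⟩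
  rw [analyticOrderNatAt, hord, ENat.toNat_natCast]
  exact hP.eq_pow_order_mul_iterate_dslope z

theorem one_sub_div_ne_zero {z ρ : ℂ} (h : z ≠ ρ) : 1 - z / ρ ≠ 0 := by
  intro h1
  rcases eq_or_ne ρ 0 with rfl | hρ
  · simp at h1
  · exact h ((div_eq_one_iff_eq hρ).1 (sub_eq_zero.1 h1).symm)

theorem exists_eq_prod_one_sub_div_pow_mul {f : ℂ → ℂ} (hf : Differentiable ℂ f)
    (h0 : f 0 ≠ 0) (S : Finset ℂ) (hS : (0 : ℂ) ∉ S) :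
    ∃ g : ℂ → ℂ, Differentiable ℂ g ∧
      (∀ z, f z = (∏ ρ ∈ S, (1 - z / ρ) ^ analyticOrderNatAt f ρ) * g z) ∧
      ∀ ρ ∈ S, g ρ ≠ 0 := by
  classical
  induction S using Finset.induction_on with
  | empty => exact ⟨f, hf, by simp, by simp⟩
  | insert ρ S hρS ih =>
    obtain ⟨hρ, hS⟩ : ρ ≠ 0 ∧ (0 : ℂ) ∉ S := by
      simpa [eq_comm] using hS
    obtain ⟨g, hg, hfg, hgS⟩ := ih hS
    have hg0 : g 0 ≠ 0 := fun h => h0 (by rw [hfg, h, mul_zero])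
    obtain ⟨k, hk, hgk, hkρ⟩ :=
      exists_eq_sub_pow_mul hg (analyticOrderAt_ne_top_of_differentiable hg hg0 ρ)
    set P : ℂ → ℂ := fun z => ∏ ρ ∈ S, (1 - z / ρ) ^ analyticOrderNatAt f ρ
    have hPd : Differentiable ℂ P := .fun_finsetProd fun i _ => by fun_prop
    have hPρ : P ρ ≠ 0 := Finset.prod_ne_zero_iff.2 fun σ hσ =>
      pow_ne_zero _ (one_sub_div_ne_zero fun h => hρS (h ▸ hσ))
    have hord : analyticOrderNatAt g ρ = analyticOrderNatAt f ρ := by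
      rw [show f = P * g from funext hfg, analyticOrderNatAt, analyticOrderNatAt,
        analyticOrderAt_mul (hPd.analyticAt ρ) (hg.analyticAt ρ),
        (hPd.analyticAt ρ).analyticOrderAt_eq_zero.2 hPρ, zero_add]
    refine ⟨fun z => (-ρ) ^ analyticOrderNatAt f ρ * k z, hk.const_mul _, fun z => ?_,
      fun σ hσ => mul_ne_zero (pow_ne_zero _ (neg_ne_zero.2 hρ)) ?_⟩
    · have hfac : z - ρ = (1 - z / ρ) * -ρ := by field_simp; ring
      rw [Finset.prod_insert hρS, hfg z, hgk z, hord, hfac, mul_pow]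
      ring
    · rcases Finset.mem_insert.1 hσ with rfl | hσ
      · exact hkρ
      · exact fun h => hgS σ hσ (by rw [hgk, h, mul_zero])

theorem two_pow_sum_le_norm_prod_one_sub_div {S : Finset ℂ} {m : ℂ → ℕ} {w : ℂ}
    (hS0 : (0 : ℂ) ∉ S) (hS : ∀ ρ ∈ S, 3 * ‖ρ‖ ≤ ‖w‖) :
    2 ^ (∑ ρ ∈ S, m ρ) ≤ ‖∏ ρ ∈ S, (1 - w / ρ) ^ m ρ‖ := by
  rw [norm_prod, ← Finset.prod_pow_eq_pow_sum]
  refine Finset.prod_le_prod (fun _ _ => by positivity) fun ρ hρ => ?_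
  have hρpos : 0 < ‖ρ‖ := norm_pos_iff.2 fun h => hS0 (h ▸ hρ)
  have h3 : 3 ≤ ‖w / ρ‖ := by
    rw [norm_div, le_div_iff₀ hρpos]
    exact hS ρ hρ
  have htri : ‖w / ρ‖ - ‖(1 : ℂ)‖ ≤ ‖1 - w / ρ‖ := norm_sub_rev (1 : ℂ) _ ▸ norm_sub_norm_le _ _
  rw [norm_one] at htri
  rw [norm_pow]
  exact pow_le_pow_left₀ zero_le_two (by linarith) _

theorem two_pow_mul_norm_le_of_eq_prod_mul {f g : ℂ → ℂ} (hg : Differentiable ℂ g) {R M : ℝ}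
    (hR : 0 < R) {S : Finset ℂ} {m : ℂ → ℕ} (hS0 : (0 : ℂ) ∉ S) (hS : ∀ ρ ∈ S, ‖ρ‖ ≤ R)
    (hfg : ∀ z, f z = (∏ ρ ∈ S, (1 - z / ρ) ^ m ρ) * g z)
    (hM : ∀ z, ‖z‖ = 3 * R → ‖f z‖ ≤ M) {z : ℂ} (hz : ‖z‖ ≤ 3 * R) :
    2 ^ (∑ ρ ∈ S, m ρ) * ‖g z‖ ≤ M := by
  have hsphere : ∀ w ∈ frontier (ball (0 : ℂ) (3 * R)), ‖g w‖ ≤ M / 2 ^ (∑ ρ ∈ S, m ρ) := by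
    intro w hw
    have hw : ‖w‖ = 3 * R := by simpa using frontier_ball_subset_sphere hw
    rw [le_div_iff₀ (by positivity)]
    calc ‖g w‖ * 2 ^ (∑ ρ ∈ S, m ρ) ≤ ‖g w‖ * ‖∏ ρ ∈ S, (1 - w / ρ) ^ m ρ‖ := by
          gcongr
          exact two_pow_sum_le_norm_prod_one_sub_div hS0 fun ρ hρ => by linarith [hS ρ hρ]
      _ = ‖f w‖ := by rw [hfg w, norm_mul, mul_comm]
      _ ≤ M := hM w hw
  have hball := Complex.norm_le_of_forall_mem_frontier_norm_le isBounded_ball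
    hg.diffContOnCl hsphere (z := z) (by rw [closure_ball _ (by positivity)]; simpa using hz)
  rwa [le_div_iff₀' (by positivity)] at hball

theorem logDeriv_one_sub_div {w ρ : ℂ} (hρ : ρ ≠ 0) :
    logDeriv (fun z => 1 - z / ρ) w = 1 / (w - ρ) := by
  have hderiv : deriv (fun z : ℂ => 1 - z / ρ) w = -(1 / ρ) :=
    (((hasDerivAt_id w).div_const ρ).const_sub 1).deriv
  rw [logDeriv_apply, hderiv, one_sub_div hρ, ← neg_div, div_div_div_cancel_right₀ hρ,
    ← neg_sub w ρ, neg_div_neg_eq]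

theorem logDeriv_eq_sum_add_of_eq_prod_mul {f g : ℂ → ℂ} {w : ℂ} (hg : DifferentiableAt ℂ g w)
    {S : Finset ℂ} {m : ℂ → ℕ} (hS0 : (0 : ℂ) ∉ S)
    (hfg : ∀ z, f z = (∏ ρ ∈ S, (1 - z / ρ) ^ m ρ) * g z) (hw : f w ≠ 0) :
    logDeriv f w = ∑ ρ ∈ S, (m ρ : ℂ) * (1 / (w - ρ)) + logDeriv g w := by
  obtain ⟨hP, hgw⟩ := mul_ne_zero_iff.1 (hfg w ▸ hw)
  rw [show f = fun z => (∏ ρ ∈ S, (1 - z / ρ) ^ m ρ) * g z from funext hfg,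
    logDeriv_mul w hP hgw (.fun_finsetProd fun i _ => by fun_prop) hg,
    logDeriv_prod (Finset.prod_ne_zero_iff.1 hP) (fun i _ => by fun_prop)]
  congr 1
  refine Finset.sum_congr rfl fun ρ hρ => ?_
  rw [logDeriv_fun_pow (by fun_prop), logDeriv_one_sub_div fun h => hS0 (h ▸ hρ)]

theorem exists_sum_analyticOrderNatAt_le {f : ℂ → ℂ} (hf : Differentiable ℂ f) (h0 : f 0 ≠ 0)
    {p : ℝ} (hp : 0 ≤ p) (hgrowth : HasExpGrowthOn f p .univ) :
    ∃ K : ℝ, ∀ (R : ℝ), 0 ≤ R → ∀ S : Finset ℂ, (∀ ρ ∈ S, ‖ρ‖ ≤ R) →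
      ∑ ρ ∈ S, (analyticOrderNatAt f ρ : ℝ) ≤ K * (1 + R) ^ p := by
  classical
  obtain ⟨C, hC, hb⟩ := hgrowth
  refine ⟨(C * 4 ^ p + |Real.log ‖f 0‖|) / Real.log 2, fun R hR S hS => ?_⟩
  set n := ∑ ρ ∈ S.erase 0, analyticOrderNatAt f ρ with hn
  have hsum : ∑ ρ ∈ S, (analyticOrderNatAt f ρ : ℝ) = n := by
    rw [hn, Nat.cast_sum]
    exact (Finset.sum_erase _ (by simp [analyticOrderNatAt_eq_zero_of_ne_zero hf h0])).symm
  obtain ⟨g, hg, hfg, -⟩ := exists_eq_prod_one_sub_div_pow_mul hf h0 (S.erase 0) (by simp)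
  have hg0 : g 0 = f 0 := by simp [hfg 0]
  have hbound : 2 ^ n * ‖f 0‖ ≤ Real.exp (C * (1 + 3 * (1 + R)) ^ p) := hg0 ▸
    two_pow_mul_norm_le_of_eq_prod_mul hg (R := 1 + R) (by positivity) (by simp)
      (fun ρ hρ => (hS ρ (Finset.mem_of_mem_erase hρ)).trans (by linarith)) hfg
      (fun z hz => hz ▸ hb z trivial) (z := 0) (by rw [norm_zero]; positivity)
  have hpos : 0 < ‖f 0‖ := norm_pos_iff.2 h0
  have hlog := Real.log_le_log (by positivity) hbound
  rw [Real.log_mul (by positivity) hpos.ne', Real.log_pow, Real.log_exp] at hlog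
  have h4 : (1 + 3 * (1 + R)) ^ p ≤ 4 ^ p * (1 + R) ^ p := by
    rw [← Real.mul_rpow (by norm_num) (by positivity)]
    exact Real.rpow_le_rpow (by positivity) (by linarith) hp
  have h1 : (1 : ℝ) ≤ (1 + R) ^ p := Real.one_le_rpow (by linarith) hp
  rw [hsum, div_mul_eq_mul_div, le_div_iff₀ (Real.log_pos one_lt_two)]
  calc n * Real.log 2 ≤ C * (1 + 3 * (1 + R)) ^ p + |Real.log ‖f 0‖| * 1 := by
        linarith [neg_abs_le (Real.log ‖f 0‖)]
    _ ≤ C * (4 ^ p * (1 + R) ^ p) + |Real.log ‖f 0‖| * (1 + R) ^ p := by gcongr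
    _ = (C * 4 ^ p + |Real.log ‖f 0‖|) * (1 + R) ^ p := by ring

theorem summable_mul_rpow_of_sum_le {ι : Type*} {m r : ι → ℝ} (hm : ∀ i, 0 ≤ m i)
    (hr : ∀ i, 0 ≤ r i) {p q K : ℝ} (hq : 0 ≤ q) (hpq : p < q)
    (h : ∀ R : ℝ, 0 ≤ R → ∀ S : Finset ι, (∀ i ∈ S, r i ≤ R) → ∑ i ∈ S, m i ≤ K * (1 + R) ^ p) :
    Summable fun i => m i * (1 + r i) ^ (-q) := by
  classical
  have hK : 0 ≤ K := by simpa using h 0 le_rfl ∅ (by simp)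
  have hgeo : Summable fun j : ℕ => K * 2 ^ p * ((2 : ℝ) ^ (p - q)) ^ j :=
    (summable_geometric_of_lt_one (by positivity)
      (Real.rpow_lt_one_of_one_lt_of_neg one_lt_two (by linarith))).mul_left _
  choose J hJlow hJup using fun i =>
    exists_nat_pow_near (le_add_of_nonneg_right (hr i)) (one_lt_two (α := ℝ))
  have hblock : ∀ (S : Finset ι) (j : ℕ), ∑ i ∈ S with J i = j, m i * (1 + r i) ^ (-q)
      ≤ K * 2 ^ p * ((2 : ℝ) ^ (p - q)) ^ j := by
    intro S j
    calc ∑ i ∈ S with J i = j, m i * (1 + r i) ^ (-q)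
        ≤ ∑ i ∈ S with J i = j, m i * ((2 : ℝ) ^ j) ^ (-q) := by
          refine Finset.sum_le_sum fun i hi => mul_le_mul_of_nonneg_left ?_ (hm i)
          obtain ⟨-, rfl⟩ := Finset.mem_filter.1 hi
          exact Real.rpow_le_rpow_of_nonpos (by positivity) (hJlow i) (by linarith)
      _ = (∑ i ∈ S with J i = j, m i) * ((2 : ℝ) ^ j) ^ (-q) := by rw [Finset.sum_mul]
      _ ≤ K * (1 + ((2 : ℝ) ^ (j + 1) - 1)) ^ p * ((2 : ℝ) ^ j) ^ (-q) := by
          refine mul_le_mul_of_nonneg_right (h _ ?_ _ fun i hi => ?_) (by positivity)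
          · linarith [one_le_pow₀ (M₀ := ℝ) (n := j + 1) one_le_two]
          · obtain ⟨-, rfl⟩ := Finset.mem_filter.1 hi
            linarith [hJup i]
      _ = K * 2 ^ p * ((2 : ℝ) ^ (p - q)) ^ j := by
          rw [add_sub_cancel, pow_succ, Real.mul_rpow (by positivity) zero_le_two, sub_eq_add_neg,
            Real.rpow_add two_pos, mul_pow, Real.rpow_pow_comm zero_le_two,
            Real.rpow_pow_comm zero_le_two]
          ring
  refine summable_of_sum_le (c := ∑' j : ℕ, K * 2 ^ p * ((2 : ℝ) ^ (p - q)) ^ j)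
    (fun i => mul_nonneg (hm i) (Real.rpow_nonneg (by linarith [hr i]) _)) fun S => ?_
  rw [← Finset.sum_fiberwise_of_maps_to fun i hi => Finset.mem_image_of_mem J hi]
  exact (Finset.sum_le_sum fun j _ => hblock S j).trans
    (hgeo.sum_le_tsum (S.image J) fun j _ => by positivity)

theorem summable_analyticOrderNatAt_mul_rpow {f : ℂ → ℂ} (hf : Differentiable ℂ f)
    (h0 : f 0 ≠ 0) {p q : ℝ} (hp : 0 ≤ p) (hpq : p < q) (hgrowth : HasExpGrowthOn f p .univ) :
    Summable fun z : ℂ => (analyticOrderNatAt f z : ℝ) * (1 + ‖z‖) ^ (-q) := by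
  obtain ⟨K, hK⟩ := exists_sum_analyticOrderNatAt_le hf h0 hp hgrowth
  exact summable_mul_rpow_of_sum_le (fun _ => Nat.cast_nonneg _) (fun _ => norm_nonneg _)
    (hp.trans hpq.le) hpq hK

theorem exists_eq_mul_exp_of_forall_ball_ne_zero {g : ℂ → ℂ} {c : ℂ} {R : ℝ} (hR : 0 < R)
    (hg : DifferentiableOn ℂ g (ball c R)) (hne : ∀ z ∈ ball c R, g z ≠ 0) :
    ∃ L : ℂ → ℂ, L c = 0 ∧ ∀ z ∈ ball c R,
      HasDerivAt L (logDeriv g z) z ∧ g z = g c * exp (L z) := by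
  have hlog : DifferentiableOn ℂ (logDeriv g) (ball c R) := (hg.deriv isOpen_ball).div hg hne
  obtain ⟨L, hLc, hL⟩ := hlog.isExactOn_ball.with_val_at c 0
  have hderiv : ∀ z ∈ ball c R, HasDerivAt (fun z => g z * exp (-L z)) 0 z := by
    intro z hz
    refine ((hg.differentiableAt (isOpen_ball.mem_nhds hz)).hasDerivAt.mul
      (hL z hz).neg.cexp).congr_deriv ?_
    rw [logDeriv_apply]
    field_simp [hne z hz]
    ring
  refine ⟨L, hLc, fun z hz => ⟨hL z hz, ?_⟩⟩
  have hconst : g z * exp (-L z) = g c * exp (-L c) :=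
    isOpen_ball.is_const_of_deriv_eq_zero (convex_ball c R).isPreconnected
      (fun w hw => (hderiv w hw).differentiableAt.differentiableWithinAt)
      (fun w hw => (hderiv w hw).deriv) hz (mem_ball_self hR)
  rw [hLc, neg_zero, exp_zero, mul_one] at hconst
  rw [← hconst, mul_assoc, ← exp_add, neg_add_cancel, exp_zero, mul_one]

theorem norm_logDeriv_le_of_forall_ball_ne_zero {g : ℂ → ℂ} {R M : ℝ} (hR : 0 < R) (hM : 0 < M)
    (hg : DifferentiableOn ℂ g (ball 0 R)) (hne : ∀ z ∈ ball (0 : ℂ) R, g z ≠ 0)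
    (hb : ∀ z ∈ ball (0 : ℂ) R, ‖g z‖ ≤ ‖g 0‖ * Real.exp M) {z : ℂ} (hz : ‖z‖ < R / 4) :
    ‖logDeriv g z‖ ≤ 8 * M / R := by
  obtain ⟨L, hL0, hL⟩ := exists_eq_mul_exp_of_forall_ball_ne_zero hR hg hne
  have hg0 : 0 < ‖g 0‖ := norm_pos_iff.2 (hne 0 (mem_ball_self hR))
  have hLd : DifferentiableOn ℂ L (ball 0 R) :=
    fun w hw => (hL w hw).1.differentiableAt.differentiableWithinAt
  have hre : Set.MapsTo L (ball 0 R) {w | w.re ≤ M} := by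
    intro w hw
    have h := hb w hw
    rw [(hL w hw).2, norm_mul, norm_exp] at h
    exact Real.exp_le_exp.1 (le_of_mul_le_mul_left h hg0)
  have hLb : ∀ w, ‖w‖ ≤ R / 2 → ‖L w‖ ≤ 2 * M := by
    intro w hw
    refine (borelCaratheodory_zero hM hLd hre hR (by simp; linarith) hL0).trans ?_
    rw [div_le_iff₀ (by linarith)]
    nlinarith
  have hclosed : ∀ w ∈ closedBall z (R / 4), ‖w‖ ≤ R / 2 := by
    intro w hw
    linarith [norm_le_norm_add_norm_sub' w z, mem_closedBall_iff_norm.1 hw]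
  have hcauchy := Complex.norm_deriv_le_of_forall_mem_sphere_norm_le (f := L) (by linarith)
    (DifferentiableOn.diffContOnCl (hLd.mono fun w hw => ?_))
    fun w hw => hLb w (hclosed w (sphere_subset_closedBall hw))
  · rw [(hL z (by simp; linarith)).1.deriv] at hcauchy
    refine hcauchy.trans (le_of_eq ?_)
    field_simp
    ring
  · rw [closure_ball _ (by linarith)] at hw
    simpa using (hclosed w hw).trans_lt (by linarith)

theorem norm_logDeriv_sub_le_of_forall_ball_ne_zero {g : ℂ → ℂ} {R M : ℝ} (hR : 0 < R)
    (hM : 0 < M) (hg : DifferentiableOn ℂ g (ball 0 R)) (hne : ∀ z ∈ ball (0 : ℂ) R, g z ≠ 0)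
    (hb : ∀ z ∈ ball (0 : ℂ) R, ‖g z‖ ≤ ‖g 0‖ * Real.exp M) {s : ℂ} (hs : ‖s‖ < R / 4) :
    ‖logDeriv g s - logDeriv g 0‖ ≤ 64 * M / R ^ 2 * ‖s‖ := by
  have hmaps : Set.MapsTo (logDeriv g) (ball 0 (R / 4))
      (closedBall (logDeriv g 0) (16 * M / R)) := by
    intro z hz
    rw [mem_closedBall_iff_norm]
    calc ‖logDeriv g z - logDeriv g 0‖ ≤ ‖logDeriv g z‖ + ‖logDeriv g 0‖ := norm_sub_le _ _
      _ ≤ 8 * M / R + 8 * M / R := add_le_add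
          (norm_logDeriv_le_of_forall_ball_ne_zero hR hM hg hne hb (by simpa using hz))
          (norm_logDeriv_le_of_forall_ball_ne_zero hR hM hg hne hb (by simpa using hR))
      _ = 16 * M / R := by ring
  have hlog : DifferentiableOn ℂ (logDeriv g) (ball 0 (R / 4)) :=
    ((hg.deriv isOpen_ball).div hg hne).mono (ball_subset_ball (by linarith))
  have hschwarz := Complex.dist_le_div_mul_dist_of_mapsTo_ball hlog hmaps (by simpa using hs)
  rw [dist_eq_norm, dist_zero_right] at hschwarz
  refine hschwarz.trans (le_of_eq ?_)
  field_simp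
  ring

theorem analyticOrderNatAt_ne_zero_of_eq_zero {f : ℂ → ℂ} (hf : Differentiable ℂ f)
    (h0 : f 0 ≠ 0) {z : ℂ} (hz : f z = 0) : analyticOrderNatAt f z ≠ 0 := by
  rw [analyticOrderNatAt, ne_eq, ENat.toNat_eq_zero, not_or]
  exact ⟨(hf.analyticAt z).analyticOrderAt_ne_zero.2 hz,
    analyticOrderAt_ne_top_of_differentiable hf h0 z⟩

theorem finite_zeros_norm_le {f : ℂ → ℂ} (hf : Differentiable ℂ f) (h0 : f 0 ≠ 0) (R : ℝ) :
    {z : {z // f z = 0} | ‖(z : ℂ)‖ ≤ R}.Finite := by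
  have hA : AnalyticOnNhd ℂ f Set.univ := fun x _ => hf.analyticAt x
  have hcodiscrete := mem_codiscrete'.1
    (hA.preimage_zero_mem_codiscreteWithin (x := 0) h0 (Set.mem_univ _) isConnected_univ)
  rw [show (f ⁻¹' {0}ᶜ)ᶜ = {z | f z = 0} by ext; simp] at hcodiscrete
  have hcompact : IsCompact (closedBall (0 : ℂ) R ∩ {z | f z = 0}) :=
    (isCompact_closedBall 0 R).inter_right (isClosed_singleton.preimage hf.continuous)
  have hfin := hcompact.finite (hcodiscrete.2.mono Set.inter_subset_right)
  refine Set.Finite.of_finite_image (hfin.subset ?_) Subtype.val_injective.injOn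
  rintro _ ⟨z, hz, rfl⟩
  exact ⟨by simpa using hz, z.2⟩

theorem norm_one_div_sub_add_one_div_le {s z : ℂ} (h : 1 + 2 * ‖s‖ < ‖z‖) :
    ‖1 / (s - z) + 1 / z‖ ≤ 8 * ‖s‖ * (1 + ‖z‖) ^ (-2 : ℝ) := by
  have hs := norm_nonneg s
  have hsz : ‖z‖ / 2 ≤ ‖s - z‖ := by
    linarith [norm_sub_rev s z ▸ norm_sub_norm_le z s]
  have hz0 : z ≠ 0 := norm_pos_iff.1 (by linarith)
  have hsz0 : s - z ≠ 0 := norm_pos_iff.1 (by linarith)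
  have hprod : (1 + ‖z‖) ^ 2 ≤ 8 * (‖s - z‖ * ‖z‖) := by nlinarith
  have hadd : 1 / (s - z) + 1 / z = s / ((s - z) * z) := by
    field_simp
    ring
  rw [hadd, norm_div, norm_mul, Real.rpow_neg (by positivity), Real.rpow_two, ← div_eq_mul_inv,
    div_le_div_iff₀ (mul_pos (norm_pos_iff.2 hsz0) (norm_pos_iff.2 hz0)) (by positivity)]
  calc ‖s‖ * (1 + ‖z‖) ^ 2 ≤ ‖s‖ * (8 * (‖s - z‖ * ‖z‖)) := by gcongr
    _ = 8 * ‖s‖ * (‖s - z‖ * ‖z‖) := by ring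

theorem summable_analyticOrderNatAt_mul_one_div_sub {f : ℂ → ℂ} (hf : Differentiable ℂ f)
    (h0 : f 0 ≠ 0) {p : ℝ} (hp : 0 ≤ p) (hp2 : p < 2) (hgrowth : HasExpGrowthOn f p .univ) (s : ℂ) :
    Summable fun z : {z // f z = 0} => (analyticOrderNatAt f z : ℂ) * (1 / (s - z) + 1 / z) := by
  have hsum := (summable_analyticOrderNatAt_mul_rpow hf h0 hp hp2 hgrowth).comp_injective
    (Subtype.val_injective (p := fun z => f z = 0))
  refine Summable.of_norm_bounded_eventually (hsum.mul_left (8 * ‖s‖)) ?_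
  rw [Filter.eventually_cofinite]
  refine (finite_zeros_norm_le hf h0 (1 + 2 * ‖s‖)).subset fun z hz => ?_
  by_contra hlarge
  refine hz ?_
  rw [norm_mul, Complex.norm_natCast, Function.comp_apply, mul_left_comm]
  gcongr
  exact norm_one_div_sub_add_one_div_le (not_le.1 hlarge)

theorem norm_logDeriv_sub_sub_sum_le {f : ℂ → ℂ} (hf : Differentiable ℂ f) (h0 : f 0 ≠ 0)
    {R M : ℝ} (hR : 0 < R) (hM : 0 < M) (hb : ∀ z, ‖z‖ = 3 * R → ‖f z‖ ≤ Real.exp M)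
    {T : Finset ℂ} (hT : ∀ ρ, ρ ∈ T ↔ f ρ = 0 ∧ ‖ρ‖ ≤ R) {s : ℂ} (hs : ‖s‖ < R / 4)
    (hfs : f s ≠ 0) :
    ‖logDeriv f s - logDeriv f 0
        - ∑ ρ ∈ T, (analyticOrderNatAt f ρ : ℂ) * (1 / (s - ρ) + 1 / ρ)‖
      ≤ 64 * (M + |Real.log ‖f 0‖|) / R ^ 2 * ‖s‖ := by
  have hT0 : (0 : ℂ) ∉ T := fun h => h0 ((hT 0).1 h).1
  obtain ⟨g, hg, hfg, hgT⟩ := exists_eq_prod_one_sub_div_pow_mul hf h0 T hT0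
  have hg0 : g 0 = f 0 := by simp [hfg 0]
  have hlog : 1 ≤ ‖f 0‖ * Real.exp |Real.log ‖f 0‖| := by
    rw [← Real.exp_log (norm_pos_iff.2 h0), Real.log_exp, ← Real.exp_add]
    exact Real.one_le_exp (by linarith [neg_abs_le (Real.log ‖f 0‖)])
  have hgb : ∀ z ∈ ball (0 : ℂ) R, ‖g z‖ ≤ ‖g 0‖ * Real.exp (M + |Real.log ‖f 0‖|) := by
    intro z hz
    calc ‖g z‖ ≤ 2 ^ (∑ ρ ∈ T, analyticOrderNatAt f ρ) * ‖g z‖ :=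
          le_mul_of_one_le_left (norm_nonneg _) (one_le_pow₀ one_le_two)
      _ ≤ Real.exp M := two_pow_mul_norm_le_of_eq_prod_mul hg hR hT0
          (fun ρ hρ => ((hT ρ).1 hρ).2) hfg hb (by linarith [mem_ball_zero_iff.1 hz])
      _ ≤ Real.exp M * (‖f 0‖ * Real.exp |Real.log ‖f 0‖|) :=
          le_mul_of_one_le_right (Real.exp_pos _).le hlog
      _ = ‖g 0‖ * Real.exp (M + |Real.log ‖f 0‖|) := by rw [hg0, Real.exp_add]; ring
  have hgne : ∀ z ∈ ball (0 : ℂ) R, g z ≠ 0 := fun z hz h =>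
    hgT z ((hT z).2 ⟨by rw [hfg, h, mul_zero], (mem_ball_zero_iff.1 hz).le⟩) h
  have hsplit : logDeriv f s - logDeriv f 0
      - ∑ ρ ∈ T, (analyticOrderNatAt f ρ : ℂ) * (1 / (s - ρ) + 1 / ρ)
        = logDeriv g s - logDeriv g 0 := by
    rw [logDeriv_eq_sum_add_of_eq_prod_mul (hg s) hT0 hfg hfs,
      logDeriv_eq_sum_add_of_eq_prod_mul (hg 0) hT0 hfg h0]
    simp only [zero_sub, one_div_neg_eq_neg_one_div, mul_add, mul_neg, Finset.sum_add_distrib,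
      Finset.sum_neg_distrib]
    ring
  rw [hsplit]
  exact norm_logDeriv_sub_le_of_forall_ball_ne_zero hR (by positivity) hg.differentiableOn hgne
    hgb hs

theorem tendsto_growth_div_sq {C c p : ℝ} (hC : 0 ≤ C) (hc : 0 ≤ c) (hp : 0 ≤ p) (hp2 : p < 2) :
    Tendsto (fun R : ℝ => (C * (1 + 3 * R) ^ p + c) / R ^ 2) atTop (𝓝 0) := by
  have hlim : Tendsto (fun R : ℝ => (C * 4 ^ p + c) * R ^ (-(2 - p))) atTop (𝓝 0) := by
    simpa using (tendsto_rpow_neg_atTop (by linarith : 0 < 2 - p)).const_mul (C * 4 ^ p + c)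
  refine squeeze_zero' ?_ ?_ hlim
  · filter_upwards [eventually_ge_atTop 0] with R hR
    positivity
  · filter_upwards [eventually_ge_atTop 1] with R hR
    have hR0 : 0 < R := by linarith
    have h4 : (1 + 3 * R) ^ p ≤ 4 ^ p * R ^ p := by
      rw [← Real.mul_rpow (by norm_num) hR0.le]
      exact Real.rpow_le_rpow (by positivity) (by linarith) hp
    calc (C * (1 + 3 * R) ^ p + c) / R ^ 2 ≤ (C * (4 ^ p * R ^ p) + c * R ^ p) / R ^ 2 := by
          gcongr
          exact le_mul_of_one_le_right hc (Real.one_le_rpow hR hp)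
      _ = (C * 4 ^ p + c) * R ^ (-(2 - p)) := by
          rw [neg_sub, Real.rpow_sub hR0, Real.rpow_two]
          ring

theorem hasSum_logDeriv_sub {f : ℂ → ℂ} (hf : Differentiable ℂ f) (h0 : f 0 ≠ 0) {p : ℝ}
    (hp : 0 ≤ p) (hp2 : p < 2) (hgrowth : HasExpGrowthOn f p .univ) {s : ℂ} (hs : f s ≠ 0) :
    HasSum (fun z : {z // f z = 0} => (analyticOrderNatAt f z : ℂ) * (1 / (s - z) + 1 / z))
      (logDeriv f s - logDeriv f 0) := by
  obtain ⟨C, hC, hb⟩ := id hgrowth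
  have hsum := summable_analyticOrderNatAt_mul_one_div_sub hf h0 hp hp2 hgrowth s
  set S : ℕ → Finset {z // f z = 0} := fun n => (finite_zeros_norm_le hf h0 n).toFinset with hS
  have hS_tendsto : Tendsto S atTop atTop := by
    refine tendsto_atTop_finset_of_monotone (fun m n hmn z hz => ?_) fun z => ?_
    · simp only [hS, Set.Finite.mem_toFinset, Set.mem_ofPred_eq] at hz ⊢
      exact hz.trans (by exact_mod_cast hmn)
    · obtain ⟨n, hn⟩ := exists_nat_ge ‖(z : ℂ)‖
      exact ⟨n, by simpa [hS] using hn⟩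
  suffices hlim : Tendsto (fun n => ∑ z ∈ S n, (analyticOrderNatAt f z : ℂ) *
      (1 / (s - z) + 1 / z)) atTop (𝓝 (logDeriv f s - logDeriv f 0)) by
    rw [← tendsto_nhds_unique (hsum.hasSum.comp hS_tendsto) hlim]
    exact hsum.hasSum
  set c := |Real.log ‖f 0‖|
  have hbound : Tendsto (fun n : ℕ => (C * (1 + 3 * (n : ℝ)) ^ p + c) / (n : ℝ) ^ 2 * (64 * ‖s‖))
      atTop (𝓝 0) := by
    simpa using ((tendsto_growth_div_sq hC.le (abs_nonneg _) hp hp2).comp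
      tendsto_natCast_atTop_atTop).mul_const (64 * ‖s‖)
  rw [tendsto_iff_norm_sub_tendsto_zero]
  refine squeeze_zero' (.of_forall fun _ => norm_nonneg _) ?_ hbound
  filter_upwards [eventually_gt_atTop 0, eventually_gt_atTop ⌈4 * ‖s‖⌉₊] with n hn hns
  have hsn : ‖s‖ < n / 4 := by linarith [Nat.lt_of_ceil_lt hns]
  have hquot := norm_logDeriv_sub_sub_sum_le hf h0 (T := (S n).map (.subtype _))
    (M := C * (1 + 3 * (n : ℝ)) ^ p) (by exact_mod_cast hn) (by positivity)
    (fun z hz => hz ▸ hb z trivial) (fun ρ => by simp [hS, and_comm]) hsn hs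
  rw [Finset.sum_map] at hquot
  rw [norm_sub_rev]
  exact hquot.trans (le_of_eq (by ring))

/-! ### Growth of the zeta function -/

theorem norm_sub_sub_smul_le_of_norm_hasDerivAt_le {E : Type*} [NormedAddCommGroup E]
    [NormedSpace ℝ E] {f f' f'' : ℝ → E} {a b K : ℝ} (hab : a ≤ b)
    (hf : ∀ x ∈ Set.Icc a b, HasDerivAt f (f' x) x)
    (hf' : ∀ x ∈ Set.Icc a b, HasDerivAt f' (f'' x) x) (hK : ∀ x ∈ Set.Icc a b, ‖f'' x‖ ≤ K) :
    ‖f b - f a - (b - a) • f' a‖ ≤ K * (b - a) * (b - a) := by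
  have ha : a ∈ Set.Icc a b := Set.left_mem_Icc.2 hab
  have hb : b ∈ Set.Icc a b := Set.right_mem_Icc.2 hab
  have hK0 : 0 ≤ K := (norm_nonneg _).trans (hK a ha)
  have hf'_sub : ∀ x ∈ Set.Icc a b, ‖f' x - (1 : ℝ) • f' a‖ ≤ K * (b - a) := fun x hx => by
    have hle := (convex_Icc a b).norm_image_sub_le_of_norm_hasDerivWithin_le
      (fun y hy => (hf' y hy).hasDerivWithinAt) hK ha hx
    rw [one_smul]
    refine hle.trans (mul_le_mul_of_nonneg_left ?_ hK0)
    rw [Real.norm_eq_abs, abs_of_nonneg (sub_nonneg.2 hx.1)]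
    linarith [hx.2]
  have hle := (convex_Icc a b).norm_image_sub_le_of_norm_hasDerivWithin_le
    (fun x hx => ((hf x hx).sub ((hasDerivAt_id x).smul_const (f' a))).hasDerivWithinAt)
    hf'_sub ha hb
  rw [Real.norm_eq_abs, abs_of_nonneg (sub_nonneg.2 hab)] at hle
  refine (le_of_eq (congrArg norm ?_)).trans hle
  simp only [Pi.sub_apply, id_eq, sub_smul]
  abel

theorem summable_nat_add_one_rpow {p : ℝ} (hp : p < -1) :
    Summable fun n : ℕ => ((n : ℝ) + 1) ^ p := by
  simpa using (summable_nat_add_iff 1).2 (Real.summable_nat_rpow.2 hp)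

/-- The `n`-th term of the Euler–Maclaurin series of `(s - 1) ζ(s) - 1`: the terms are differences
between `(s - 1) (n + 1) ^ (-s)` and the integral of `(s - 1) x ^ (-s)` over `[n + 1, n + 2]`, so
that the series converges for `0 < re s`. -/
noncomputable def zetaTerm (n : ℕ) (s : ℂ) : ℂ :=
  (s - 1) * ((n : ℂ) + 1) ^ (-s) + (((n : ℂ) + 2) ^ (1 - s) - ((n : ℂ) + 1) ^ (1 - s))

theorem norm_zetaTerm_le (n : ℕ) {s : ℂ} (hs : 0 < s.re) :
    ‖zetaTerm n s‖ ≤ ‖s‖ * ‖s - 1‖ * ((n : ℝ) + 1) ^ (-s.re - 1) := by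
  have hn : (0 : ℝ) < (n : ℝ) + 1 := by positivity
  have hs0 : -s ≠ 0 := neg_ne_zero.2 (ne_zero_of_re_pos hs)
  have hderiv : ∀ x ∈ Set.Icc ((n : ℝ) + 1) (n + 2),
      HasDerivAt (fun x : ℝ => (x : ℂ) ^ (1 - s)) ((1 - s) * (x : ℂ) ^ (-s)) x := by
    intro x hx
    rcases eq_or_ne (1 - s) 0 with h | h
    · simpa only [h, cpow_zero, zero_mul] using hasDerivAt_const x (1 : ℂ)
    · simpa only [sub_sub_cancel_left] using
        hasDerivAt_ofReal_cpow_const (hn.trans_le hx.1).ne' h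
  have hderiv2 : ∀ x ∈ Set.Icc ((n : ℝ) + 1) (n + 2), HasDerivAt
      (fun x : ℝ => (1 - s) * (x : ℂ) ^ (-s)) ((1 - s) * (-s * (x : ℂ) ^ (-s - 1))) x :=
    fun x hx => (hasDerivAt_ofReal_cpow_const (hn.trans_le hx.1).ne' hs0).const_mul (1 - s)
  have hbound : ∀ x ∈ Set.Icc ((n : ℝ) + 1) (n + 2), ‖(1 - s) * (-s * (x : ℂ) ^ (-s - 1))‖ ≤
      ‖s‖ * ‖s - 1‖ * ((n : ℝ) + 1) ^ (-s.re - 1) := by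
    intro x hx
    rw [norm_mul, norm_mul, norm_neg, norm_cpow_eq_rpow_re_of_pos (hn.trans_le hx.1),
      norm_sub_rev, mul_left_comm, ← mul_assoc, sub_re, neg_re, one_re]
    exact mul_le_mul_of_nonneg_left (Real.rpow_le_rpow_of_nonpos hn hx.1 (by linarith))
      (by positivity)
  have hle := norm_sub_sub_smul_le_of_norm_hasDerivAt_le (by linarith) hderiv hderiv2 hbound
  rw [show (n : ℝ) + 2 - (n + 1) = 1 by ring, mul_one, mul_one] at hle
  refine (le_of_eq (congrArg norm ?_)).trans hle
  rw [zetaTerm, one_smul]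
  push_cast
  ring

theorem differentiable_zetaTerm (n : ℕ) : Differentiable ℂ (zetaTerm n) := by
  have h1 : (n : ℂ) + 1 ≠ 0 := by exact_mod_cast n.succ_ne_zero
  have h2 : (n : ℂ) + 2 ≠ 0 := by exact_mod_cast (n + 1).succ_ne_zero
  exact fun s => ((differentiableAt_id.sub_const _).mul
    (differentiableAt_id.neg.const_cpow (.inl h1))).add
    (((differentiableAt_id.const_sub _).const_cpow (.inl h2)).sub
      ((differentiableAt_id.const_sub _).const_cpow (.inl h1)))

theorem summable_zetaTerm {s : ℂ} (hs : 0 < s.re) : Summable fun n => zetaTerm n s :=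
  .of_norm_bounded ((summable_nat_add_one_rpow (by linarith)).mul_left _) fun n =>
    norm_zetaTerm_le n hs

theorem tendsto_natCast_add_one_cpow {s : ℂ} (hs : s.re < 0) :
    Tendsto (fun n : ℕ => ((n : ℂ) + 1) ^ s) atTop (𝓝 0) := by
  rw [tendsto_zero_iff_norm_tendsto_zero]
  have hlim := (tendsto_rpow_neg_atTop (neg_pos.2 hs)).comp
    (tendsto_natCast_atTop_atTop.comp (tendsto_add_atTop_nat 1))
  refine hlim.congr fun n => ?_
  have hcast : ((n : ℂ) + 1) = ((n + 1 : ℕ) : ℂ) := by push_cast; rfl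
  rw [hcast, norm_natCast_cpow_of_pos n.succ_pos]
  simp

theorem hasSum_zetaTerm_of_one_lt_re {s : ℂ} (hs : 1 < s.re) :
    HasSum (fun n => zetaTerm n s) (riemannZeta₁ s - 1) := by
  have hs1 : s ≠ 1 := by rintro rfl; simp at hs
  have hzeta : HasSum (fun n : ℕ => (s - 1) * ((n : ℂ) + 1) ^ (-s)) (riemannZeta₁ s) := by
    have hsum := ((summable_nat_add_iff 1).2 (summable_one_div_nat_cpow.2 hs)).hasSum
    rw [← mul_inv_cancel_left₀ (sub_ne_zero.2 hs1) (riemannZeta₁ s),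
      ← riemannZeta_eq_inv_sub_mul hs1, zeta_eq_tsum_one_div_nat_add_one_cpow hs]
    simpa [cpow_neg] using hsum.mul_left (s - 1)
  have htel : HasSum (fun n : ℕ => ((n : ℂ) + 2) ^ (1 - s) - ((n : ℂ) + 1) ^ (1 - s)) (0 - 1) := by
    have hsum : Summable fun n : ℕ => ((n : ℂ) + 2) ^ (1 - s) - ((n : ℂ) + 1) ^ (1 - s) :=
      ((summable_zetaTerm (by linarith)).sub hzeta.summable).congr fun n => by rw [zetaTerm]; ring
    refine (hsum.hasSum_iff_tendsto_nat).2 (((tendsto_natCast_add_one_cpow (s := 1 - s)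
      (by simpa using hs)).sub_const 1).congr fun N => ?_)
    have := Finset.sum_range_sub (fun n : ℕ => ((n : ℂ) + 1) ^ (1 - s)) N
    simp only [Nat.cast_zero, zero_add, one_cpow] at this
    rw [← this]
    refine Finset.sum_congr rfl fun n _ => ?_
    push_cast
    ring_nf
  rw [sub_eq_add_neg, ← zero_sub]
  exact hzeta.add htel

theorem hasSum_zetaTerm {s : ℂ} (hs : 0 < s.re) :
    HasSum (fun n => zetaTerm n s) (riemannZeta₁ s - 1) := by
  set R := ‖s‖ + 3
  set U : Set ℂ := {z | s.re / 2 < z.re} ∩ ball 0 R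
  have hUo : IsOpen U := (isOpen_lt continuous_const continuous_re).inter isOpen_ball
  have hUc : IsPreconnected U :=
    ((convex_halfSpace_re_gt _).inter (convex_ball _ _)).isPreconnected
  have hle : ∀ (n : ℕ) (w : ℂ), w ∈ U →
      ‖zetaTerm n w‖ ≤ R * (R + 1) * ((n : ℝ) + 1) ^ (-(s.re / 2) - 1) := by
    rintro n w ⟨hw : s.re / 2 < w.re, hwR⟩
    have hwR : ‖w‖ < R := by simpa using hwR
    have hw1 : ‖w - 1‖ ≤ R + 1 := (norm_sub_le _ _).trans (by rw [norm_one]; linarith)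
    refine (norm_zetaTerm_le n (by linarith)).trans ?_
    gcongr
    linarith [n.cast_nonneg (α := ℝ)]
  have hlhs : AnalyticOnNhd ℂ (fun w => ∑' n, zetaTerm n w) U :=
    (differentiableOn_tsum_of_summable_norm
      ((summable_nat_add_one_rpow (by linarith)).mul_left (R * (R + 1)))
      (fun n => (differentiable_zetaTerm n).differentiableOn) hUo hle).analyticOnNhd hUo
  have hrhs : AnalyticOnNhd ℂ (fun z => riemannZeta₁ z - 1) U := fun z _ =>
    (differentiable_riemannZeta₁.sub_const 1).analyticAt z
  have hbase : ((2 + s.re : ℝ) : ℂ) ∈ U := by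
    refine ⟨by simp only [Set.mem_ofPred_eq, ofReal_re]; linarith, ?_⟩
    rw [mem_ball_zero_iff, norm_real, Real.norm_of_nonneg (by linarith)]
    linarith [re_le_norm s]
  have hsU : s ∈ U := ⟨half_lt_self hs, by simp [R]⟩
  have heq := hlhs.eqOn_of_preconnected_of_eventuallyEq hrhs hUc hbase (by
    filter_upwards [(isOpen_lt continuous_const continuous_re).mem_nhds
      (show 1 < ((2 + s.re : ℝ) : ℂ).re by rw [ofReal_re]; linarith)] with z hz
    exact (hasSum_zetaTerm_of_one_lt_re hz).tsum_eq)
  exact (summable_zetaTerm hs).hasSum_iff.2 (heq hsU)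

theorem exists_norm_riemannZeta₁_le {δ : ℝ} (hδ : 0 < δ) : ∃ A : ℝ, 0 ≤ A ∧
    ∀ s : ℂ, δ ≤ s.re → ‖riemannZeta₁ s‖ ≤ 1 + A * (‖s‖ * ‖s - 1‖) := by
  have hsum : Summable fun n : ℕ => ((n : ℝ) + 1) ^ (-δ - 1) :=
    summable_nat_add_one_rpow (by linarith)
  refine ⟨∑' n : ℕ, ((n : ℝ) + 1) ^ (-δ - 1), tsum_nonneg fun n => by positivity,
    fun s hs => ?_⟩
  have hle : ‖∑' n, zetaTerm n s‖ ≤ ∑' n : ℕ, ‖s‖ * ‖s - 1‖ * ((n : ℝ) + 1) ^ (-δ - 1) :=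
    tsum_of_norm_bounded (hsum.mul_left _).hasSum fun n => by
      refine (norm_zetaTerm_le n (by linarith)).trans ?_
      gcongr
      linarith [n.cast_nonneg (α := ℝ)]
  rw [(hasSum_zetaTerm (hδ.trans_le hs)).tsum_eq, tsum_mul_left, mul_comm] at hle
  calc ‖riemannZeta₁ s‖ = ‖1 + (riemannZeta₁ s - 1)‖ := by rw [add_sub_cancel]
    _ ≤ 1 + ‖riemannZeta₁ s - 1‖ := (norm_add_le _ _).trans_eq (by rw [norm_one])
    _ ≤ _ := by gcongr

theorem norm_Gamma_le_Gamma_re {s : ℂ} (hs : 0 < s.re) : ‖Gamma s‖ ≤ Real.Gamma s.re := by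
  rw [Gamma_eq_integral hs, Real.Gamma_eq_integral hs, GammaIntegral]
  refine (MeasureTheory.norm_integral_le_integral_norm _).trans_eq
    (setIntegral_congr_fun measurableSet_Ioi fun x hx => ?_)
  simp only [norm_mul]
  rw [norm_cpow_eq_rpow_re_of_pos hx, norm_real, Real.norm_of_nonneg (Real.exp_pos _).le]
  simp

theorem factorial_ceil_add_one_le {x : ℝ} (hx : 0 ≤ x) :
    ((⌈x⌉₊ + 1).factorial : ℝ) ≤ Real.exp ((x + 2) * Real.log (x + 2)) := by
  have hceil : ((⌈x⌉₊ + 1 : ℕ) : ℝ) ≤ x + 2 := by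
    push_cast
    linarith [Nat.ceil_lt_add_one hx]
  calc ((⌈x⌉₊ + 1).factorial : ℝ) ≤ ((⌈x⌉₊ + 1 : ℕ) : ℝ) ^ (⌈x⌉₊ + 1) := by
        exact_mod_cast Nat.factorial_le_pow _
    _ ≤ (x + 2) ^ (⌈x⌉₊ + 1) := by gcongr
    _ = (x + 2) ^ ((⌈x⌉₊ + 1 : ℕ) : ℝ) := (Real.rpow_natCast _ _).symm
    _ ≤ (x + 2) ^ (x + 2) := Real.rpow_le_rpow_of_exponent_le (by linarith) hceil
    _ = Real.exp ((x + 2) * Real.log (x + 2)) := by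
        rw [Real.rpow_def_of_pos (by linarith), mul_comm]

theorem Gamma_le_exp_mul_log {x : ℝ} (hx : 1 / 2 ≤ x) :
    Real.Gamma x ≤ 4 / 3 * Real.exp ((x + 2) * Real.log (x + 2)) := by
  have hx0 : 0 < x := by linarith
  have hrec : Real.Gamma (x + 2) = (x + 1) * (x * Real.Gamma x) := by
    rw [← Real.Gamma_add_one hx0.ne', ← Real.Gamma_add_one (by linarith)]
    ring_nf
  have hmono : Real.Gamma (x + 2) ≤ Real.Gamma ((⌈x⌉₊ + 1 : ℕ) + 1) := by
    refine Real.Gamma_strictMonoOn_Ici.monotoneOn (Set.mem_Ici.2 (by linarith))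
      (Set.mem_Ici.2 ?_) ?_ <;> push_cast <;> linarith [Nat.le_ceil x]
  rw [Real.Gamma_nat_eq_factorial, hrec] at hmono
  have hquad : 3 / 4 ≤ (x + 1) * x := by nlinarith
  have hlower : 3 / 4 * Real.Gamma x ≤ (x + 1) * (x * Real.Gamma x) := by
    rw [← mul_assoc]
    exact mul_le_mul_of_nonneg_right hquad (Real.Gamma_pos_of_pos hx0).le
  linarith [factorial_ceil_add_one_le hx0.le]

theorem norm_cos_le_exp_norm (z : ℂ) : ‖cos z‖ ≤ Real.exp ‖z‖ := by
  have h₁ : ‖exp (z * I)‖ ≤ Real.exp ‖z‖ := by simpa using norm_exp_le_exp_norm (z * I)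
  have h₂ : ‖exp (-z * I)‖ ≤ Real.exp ‖z‖ := by simpa using norm_exp_le_exp_norm (-z * I)
  rw [cos, norm_div, Complex.norm_ofNat]
  linarith [norm_add_le (exp (z * I)) (exp (-z * I))]

theorem HasExpGrowthOn.of_norm_le_exp_mul {f : ℂ → ℂ} {p C : ℝ} {S : Set ℂ} (hp : 1 ≤ p)
    (h : ∀ z ∈ S, ‖f z‖ ≤ Real.exp (C * (1 + ‖z‖))) : HasExpGrowthOn f p S := by
  refine ⟨|C| + 1, by positivity, fun z hz => (h z hz).trans (Real.exp_le_exp.2 ?_)⟩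
  have hz1 : 1 + ‖z‖ ≤ (1 + ‖z‖) ^ p :=
    Real.self_le_rpow_of_one_le (by linarith [norm_nonneg z]) hp
  exact mul_le_mul (by linarith [le_abs_self C]) hz1 (by positivity) (by positivity)

theorem HasExpGrowthOn.of_isCompact {f : ℂ → ℂ} {p : ℝ} {S : Set ℂ} (hp : 1 ≤ p)
    (hS : IsCompact S) (hf : ContinuousOn f S) : HasExpGrowthOn f p S := by
  obtain ⟨B, hB⟩ := hS.exists_bound_of_continuousOn hf
  refine .of_norm_le_exp_mul (C := |B|) hp fun z hz => (hB z hz).trans ?_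
  calc B ≤ |B| * (1 + ‖z‖) := by nlinarith [le_abs_self B, abs_nonneg B, norm_nonneg z]
    _ ≤ Real.exp (|B| * (1 + ‖z‖)) := by linarith [Real.add_one_le_exp (|B| * (1 + ‖z‖))]

theorem HasExpGrowthOn.mono {f : ℂ → ℂ} {p : ℝ} {S T : Set ℂ} (hf : HasExpGrowthOn f p T)
    (hST : S ⊆ T) : HasExpGrowthOn f p S :=
  hf.imp fun _ h => ⟨h.1, fun z hz => h.2 z (hST hz)⟩

theorem HasExpGrowthOn.mul {f g : ℂ → ℂ} {p : ℝ} {S : Set ℂ} (hf : HasExpGrowthOn f p S)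
    (hg : HasExpGrowthOn g p S) : HasExpGrowthOn (fun z => f z * g z) p S := by
  obtain ⟨C, hC, hfC⟩ := hf
  obtain ⟨D, hD, hgD⟩ := hg
  refine ⟨C + D, by positivity, fun z hz => ?_⟩
  rw [norm_mul, add_mul, Real.exp_add]
  exact mul_le_mul (hfC z hz) (hgD z hz) (norm_nonneg _) (Real.exp_pos _).le

theorem HasExpGrowthOn.union {f : ℂ → ℂ} {p : ℝ} {S T : Set ℂ} (hS : HasExpGrowthOn f p S)
    (hT : HasExpGrowthOn f p T) : HasExpGrowthOn f p (S ∪ T) := by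
  obtain ⟨C, hC, hSC⟩ := hS
  obtain ⟨D, hD, hTD⟩ := hT
  refine ⟨C + D, by positivity, ?_⟩
  rintro z (hz | hz)
  · exact (hSC z hz).trans (Real.exp_le_exp.2 (by gcongr; linarith))
  · exact (hTD z hz).trans (Real.exp_le_exp.2 (by gcongr; linarith))

theorem HasExpGrowthOn.of_norm_one_sub_le {f g : ℂ → ℂ} {p : ℝ} {S : Set ℂ} (hp : 0 ≤ p)
    (hg : HasExpGrowthOn g p S) (h : ∀ z ∈ S, ‖f (1 - z)‖ ≤ ‖g z‖) :
    HasExpGrowthOn f p {z | 1 - z ∈ S} := by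
  obtain ⟨C, hC, hgC⟩ := hg
  refine ⟨C * 2 ^ p, by positivity, fun z hz => ?_⟩
  have hnorm : 1 + ‖1 - z‖ ≤ 2 * (1 + ‖z‖) := by
    have := norm_sub_le 1 z
    rw [norm_one] at this
    linarith [norm_nonneg z]
  calc ‖f z‖ ≤ ‖g (1 - z)‖ := by simpa only [sub_sub_cancel] using h (1 - z) hz
    _ ≤ Real.exp (C * (1 + ‖1 - z‖) ^ p) := hgC _ hz
    _ ≤ Real.exp (C * (2 * (1 + ‖z‖)) ^ p) := by gcongr
    _ = Real.exp (C * 2 ^ p * (1 + ‖z‖) ^ p) := by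
        rw [Real.mul_rpow (by norm_num) (by positivity), mul_assoc]

theorem hasExpGrowthOn_Gamma {p : ℝ} (hp : 1 < p) :
    HasExpGrowthOn Gamma p {s | 1 / 2 ≤ s.re} := by
  have hp0 : 0 < p - 1 := sub_pos.2 hp
  refine ⟨1 + 3 ^ p / (p - 1), by positivity, fun s hs => ?_⟩
  have hs : 1 / 2 ≤ s.re := hs
  set r := 1 + ‖s‖
  have hre : s.re ≤ ‖s‖ := re_le_norm s
  have hr1 : 1 ≤ r ^ p := Real.one_le_rpow (by simp [r]) (by linarith)
  have hr3 : s.re + 2 ≤ 3 * r := by linarith [norm_nonneg s]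
  have hlog : (s.re + 2) * Real.log (s.re + 2) ≤ 3 ^ p / (p - 1) * r ^ p := by
    calc (s.re + 2) * Real.log (s.re + 2)
        ≤ (s.re + 2) * ((s.re + 2) ^ (p - 1) / (p - 1)) := by
          gcongr
          exact Real.log_le_rpow_div (by linarith) hp0
      _ = (s.re + 2) ^ p / (p - 1) := by
          rw [Real.rpow_sub_one (by linarith)]
          field_simp
      _ ≤ (3 * r) ^ p / (p - 1) := by gcongr
      _ = 3 ^ p / (p - 1) * r ^ p := by
          rw [Real.mul_rpow (by norm_num) (by positivity)]
          ring
  calc ‖Gamma s‖ ≤ 4 / 3 * Real.exp ((s.re + 2) * Real.log (s.re + 2)) :=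
        (norm_Gamma_le_Gamma_re (by linarith)).trans (Gamma_le_exp_mul_log hs)
    _ ≤ Real.exp (r ^ p) * Real.exp (3 ^ p / (p - 1) * r ^ p) := by
        gcongr
        linarith [Real.add_one_le_exp (r ^ p)]
    _ = Real.exp ((1 + 3 ^ p / (p - 1)) * r ^ p) := by rw [← Real.exp_add, add_mul, one_mul]

theorem hasExpGrowthOn_riemannZeta₁_of_re {p : ℝ} (hp : 1 ≤ p) :
    HasExpGrowthOn riemannZeta₁ p {s | 1 / 2 ≤ s.re} := by
  obtain ⟨A, hA0, hA⟩ := exists_norm_riemannZeta₁_le one_half_pos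
  refine .of_norm_le_exp_mul (C := A + 3) hp fun s hs => (hA s hs).trans ?_
  set r := 1 + ‖s‖
  have hr1 : 1 ≤ r := by linarith [norm_nonneg s]
  have hs1 : ‖s - 1‖ ≤ r := (norm_sub_le _ _).trans_eq (by rw [norm_one, add_comm])
  have hexp : ∀ x : ℝ, x ≤ Real.exp x := fun x => by linarith [Real.add_one_le_exp x]
  calc 1 + A * (‖s‖ * ‖s - 1‖) ≤ 1 + A * (r * r) := by gcongr; linarith
    _ ≤ (A + 1) * r * r * r := by nlinarith [mul_nonneg hA0 (by linarith : 0 ≤ r - 1)]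
    _ ≤ Real.exp ((A + 1) * r) * Real.exp r * Real.exp r := by gcongr <;> exact hexp _
    _ = Real.exp ((A + 3) * r) := by rw [← Real.exp_add, ← Real.exp_add]; ring_nf

theorem riemannZeta₁_eq_mul {s : ℂ} (hs : s ≠ 1) : riemannZeta₁ s = (s - 1) * riemannZeta s := by
  rw [riemannZeta_eq_inv_sub_mul hs, mul_inv_cancel_left₀ (sub_ne_zero.2 hs)]

theorem norm_riemannZeta₁_one_sub_le {w : ℂ} (hw : 0 < w.re) (hw1 : 1 ≤ ‖w - 1‖) :
    ‖riemannZeta₁ (1 - w)‖ ≤ ‖Gamma w * (2 * w * cos (Real.pi * w / 2)) * riemannZeta₁ w‖ := by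
  have hw_ne : w ≠ 1 := by rintro rfl; norm_num at hw1
  have hw_neg : ∀ n : ℕ, w ≠ -n := by
    rintro n rfl
    simpa using hw.trans_le (neg_nonpos.2 n.cast_nonneg)
  have hpi : ‖(2 * Real.pi : ℂ) ^ (-w)‖ ≤ 1 := by
    rw [← ofReal_ofNat, ← ofReal_mul, norm_cpow_eq_rpow_re_of_pos (by positivity)]
    exact Real.rpow_le_one_of_one_le_of_nonpos (by linarith [Real.two_le_pi]) (by simpa using hw.le)
  have hinv : ‖(w - 1)⁻¹‖ ≤ 1 := by rw [norm_inv]; exact inv_le_one_of_one_le₀ hw1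
  have hFE : riemannZeta₁ (1 - w) = -((2 * Real.pi : ℂ) ^ (-w) * (w - 1)⁻¹ *
      (Gamma w * (2 * w * cos (Real.pi * w / 2)) * riemannZeta₁ w)) := by
    rw [riemannZeta₁_eq_mul (by simpa using ne_zero_of_re_pos hw),
      riemannZeta_one_sub hw_neg hw_ne, riemannZeta_eq_inv_sub_mul hw_ne]
    ring
  rw [hFE, norm_neg, norm_mul]
  refine mul_le_of_le_one_left (norm_nonneg _) ?_
  rw [norm_mul]
  exact mul_le_one₀ hpi (norm_nonneg _) hinv

theorem hasExpGrowthOn_riemannZeta₁ {p : ℝ} (hp : 1 < p) :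
    HasExpGrowthOn riemannZeta₁ p .univ := by
  have hcos : HasExpGrowthOn (fun w => 2 * w * cos (Real.pi * w / 2)) p {s | 1 / 2 ≤ s.re} := by
    refine .of_norm_le_exp_mul (C := 4) hp.le fun w _ => ?_
    have hcos : ‖cos (Real.pi * w / 2)‖ ≤ Real.exp (2 * ‖w‖) := by
      refine (norm_cos_le_exp_norm _).trans (Real.exp_le_exp.2 ?_)
      rw [norm_div, norm_mul, norm_real, Real.norm_of_nonneg Real.pi_pos.le, Complex.norm_ofNat]
      nlinarith [Real.pi_le_four, norm_nonneg w]
    calc ‖2 * w * cos (Real.pi * w / 2)‖ = 2 * ‖w‖ * ‖cos (Real.pi * w / 2)‖ := by simp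
      _ ≤ Real.exp (2 * ‖w‖) * Real.exp (2 * ‖w‖) := by
          gcongr
          linarith [Real.add_one_le_exp (2 * ‖w‖)]
      _ ≤ Real.exp (4 * (1 + ‖w‖)) := by
          rw [← Real.exp_add]
          exact Real.exp_le_exp.2 (by linarith)
  have hleft : HasExpGrowthOn riemannZeta₁ p {s | 1 - s ∈ {w : ℂ | 1 / 2 ≤ w.re ∧ 1 ≤ ‖w - 1‖}} :=
    .of_norm_one_sub_le (by linarith)
      ((((hasExpGrowthOn_Gamma hp).mul hcos).mul (hasExpGrowthOn_riemannZeta₁_of_re hp.le)).mono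
        fun _ hw => hw.1)
      fun w hw => norm_riemannZeta₁_one_sub_le (by linarith [hw.1]) hw.2
  have hball : HasExpGrowthOn riemannZeta₁ p (closedBall 0 1) :=
    .of_isCompact hp.le (isCompact_closedBall _ _)
      differentiable_riemannZeta₁.continuous.continuousOn
  refine ((hasExpGrowthOn_riemannZeta₁_of_re hp.le).union (hball.union hleft)).mono fun s _ => ?_
  by_cases hs : 1 / 2 ≤ s.re
  · exact .inl hs
  by_cases hs1 : ‖s‖ ≤ 1
  · exact .inr (.inl (mem_closedBall_zero_iff.2 hs1))
  · refine .inr (.inr ⟨?_, ?_⟩)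
    · rw [sub_re, one_re]; linarith
    · simpa using (not_le.1 hs1).le

/-! ### Partial fractions over the zeros of the zeta function -/

theorem riemannZeta₁_zero_ne_zero : riemannZeta₁ 0 ≠ 0 := by
  simp [riemannZeta₁_eq_mul zero_ne_one, riemannZeta_zero]

theorem riemannZeta₁_ne_zero_of_one_le_re {s : ℂ} (hs : 1 ≤ s.re) : riemannZeta₁ s ≠ 0 := by
  rcases eq_or_ne s 1 with rfl | hs1
  · simp
  · rw [riemannZeta₁_eq_mul hs1]
    exact mul_ne_zero (sub_ne_zero.2 hs1) (riemannZeta_ne_zero_of_one_le_re hs)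

theorem analyticOrderNatAt_riemannZeta₁ {ρ : ℂ} (hρ : ρ ≠ 1) :
    analyticOrderNatAt riemannZeta₁ ρ = zetaMult ρ := by
  have hmul : riemannZeta₁ =ᶠ[𝓝 ρ] (fun s => s - 1) * riemannZeta := by
    filter_upwards [isOpen_ne.mem_nhds hρ] with s hs using riemannZeta₁_eq_mul hs
  have hsub : AnalyticAt ℂ (fun s : ℂ => s - 1) ρ := by fun_prop
  rw [zetaMult, analyticOrderNatAt, analyticOrderNatAt, analyticOrderAt_congr hmul,
    analyticOrderAt_mul hsub (analyticOn_riemannZeta ρ hρ),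
    hsub.analyticOrderAt_eq_zero.2 (sub_ne_zero.2 hρ), zero_add]

theorem exists_eq_neg_two_mul_of_riemannZeta_eq_zero {s : ℂ} (hs : riemannZeta s = 0)
    (hre : s.re ≤ 0) : ∃ n : ℕ, s = -(2 * (n + 1)) := by
  have hs0 : s ≠ 0 := by rintro rfl; norm_num [riemannZeta_zero] at hs
  have hre1 : 1 ≤ (1 - s).re := by rw [sub_re, one_re]; linarith
  have hcompleted : completedRiemannZeta s ≠ 0 := by
    rw [← completedRiemannZeta_one_sub]
    intro h
    refine riemannZeta_ne_zero_of_one_le_re hre1 ?_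
    rw [riemannZeta_def_of_ne_zero (ne_zero_of_re_pos (by linarith)), h, zero_div]
  rw [riemannZeta_def_of_ne_zero hs0, div_eq_zero_iff, or_iff_right hcompleted,
    Gammaℝ_eq_zero_iff] at hs
  obtain ⟨_ | n, rfl⟩ := hs
  · simp at hs0
  · exact ⟨n, by push_cast; rfl⟩

theorem mem_zetaZeros_or_of_riemannZeta₁_eq_zero {z : ℂ} (hz : riemannZeta₁ z = 0) :
    z ∈ zetaZeros ∨ (z.im = 0 ∧ z.re ≤ -2) := by
  have hz1 : z ≠ 1 := by rintro rfl; simp at hz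
  have hζ : riemannZeta z = 0 := by rw [riemannZeta_eq_inv_sub_mul hz1, hz, mul_zero]
  by_cases hpos : 0 < z.re
  · exact .inl ⟨hζ, hpos, not_le.1 fun h => riemannZeta_ne_zero_of_one_le_re h hζ⟩
  · obtain ⟨n, rfl⟩ := exists_eq_neg_two_mul_of_riemannZeta_eq_zero hζ (not_lt.1 hpos)
    exact .inr ⟨by simp, by simp⟩

theorem summable_riemannZeta₁_zeros {q : ℝ} (hq : 1 < q) :
    Summable fun z : ℂ => (analyticOrderNatAt riemannZeta₁ z : ℝ) * (1 + ‖z‖) ^ (-q) :=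
  summable_analyticOrderNatAt_mul_rpow differentiable_riemannZeta₁ riemannZeta₁_zero_ne_zero
    (p := (1 + q) / 2) (by linarith) (by linarith) (hasExpGrowthOn_riemannZeta₁ (by linarith))

theorem countable_riemannZeta₁_zeros : Countable {z // riemannZeta₁ z = 0} := by
  refine ((summable_riemannZeta₁_zeros one_lt_two).countable_support.mono
    (s₁ := {z | riemannZeta₁ z = 0}) fun z hz => mul_ne_zero ?_ (by positivity)).to_subtype
  exact_mod_cast analyticOrderNatAt_ne_zero_of_eq_zero differentiable_riemannZeta₁
    riemannZeta₁_zero_ne_zero hz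

theorem LSeries_vonMangoldt_eq_sub_logDeriv_riemannZeta₁ {s : ℂ} (hs : 1 < s.re) :
    LSeries (fun n => (ArithmeticFunction.vonMangoldt n : ℂ)) s =
      1 / (s - 1) - logDeriv riemannZeta₁ s := by
  have hs1 : s ≠ 1 := by rintro rfl; simp at hs
  have hs0 : riemannZeta₁ s ≠ 0 := riemannZeta₁_ne_zero_of_one_le_re hs.le
  have hsub := sub_ne_zero.2 hs1
  rw [ArithmeticFunction.LSeries_vonMangoldt_eq_deriv_riemannZeta_div hs,
    deriv_riemannZeta_eq_neg_inv_sub_sq_mul_add hs1, riemannZeta_eq_inv_sub_mul hs1, logDeriv_apply]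
  field_simp
  ring

theorem hasSum_LSeries_vonMangoldt {s : ℂ} (hs : 1 < s.re) :
    HasSum (fun z : {z // riemannZeta₁ z = 0} =>
        (analyticOrderNatAt riemannZeta₁ z : ℂ) / z * (s / (s - z)))
      (1 / (s - 1) - logDeriv riemannZeta₁ 0
        - LSeries (fun n => (ArithmeticFunction.vonMangoldt n : ℂ)) s) := by
  have hs0 : riemannZeta₁ s ≠ 0 := riemannZeta₁_ne_zero_of_one_le_re hs.le
  have hsum := hasSum_logDeriv_sub differentiable_riemannZeta₁ riemannZeta₁_zero_ne_zero
    (p := 3 / 2) (by norm_num) (by norm_num) (hasExpGrowthOn_riemannZeta₁ (by norm_num)) hs0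
  rw [LSeries_vonMangoldt_eq_sub_logDeriv_riemannZeta₁ hs]
  convert! hsum using 1
  · ext z
    have hz0 : (z : ℂ) ≠ 0 := fun h => riemannZeta₁_zero_ne_zero (by simpa only [h] using z.2)
    have hzs : s - (z : ℂ) ≠ 0 := fun h => hs0 (by rw [sub_eq_zero.1 h]; exact z.2)
    field_simp
    ring
  · ring

/-! ### Incomplete Beta integrals -/

theorem intervalIntegrable_ofReal {f : ℝ → ℝ} {p q : ℝ} (hf : IntervalIntegrable f volume p q) :
    IntervalIntegrable (fun u => (f u : ℂ)) volume p q :=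
  ⟨hf.1.ofReal, hf.2.ofReal⟩

theorem integral_abs_deriv_le_of_sign {w w' : ℝ → ℝ} {p q W : ℝ} (hpq : p ≤ q)
    (hw : ∀ u ∈ Set.Icc p q, HasDerivAt w (w' u) u) (hw' : IntervalIntegrable w' volume p q)
    (hsign : (∀ u ∈ Set.Icc p q, 0 ≤ w' u) ∨ ∀ u ∈ Set.Icc p q, w' u ≤ 0)
    (hW : ∀ u ∈ Set.Icc p q, |w u| ≤ W) : ∫ u in p..q, |w' u| ≤ 2 * W := by
  rw [← Set.uIcc_of_le hpq] at hw hsign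
  have hftc : ∫ u in p..q, w' u = w q - w p := integral_eq_sub_of_hasDerivAt hw hw'
  have hp := abs_le.1 (hW p (Set.left_mem_Icc.2 hpq))
  have hq := abs_le.1 (hW q (Set.right_mem_Icc.2 hpq))
  rcases hsign with h | h
  · rw [integral_congr fun u hu => abs_of_nonneg (h u hu), hftc]
    linarith
  · rw [integral_congr fun u hu => abs_of_nonpos (h u hu), intervalIntegral.integral_neg, hftc]
    linarith

theorem norm_integral_mul_le_of_hasDerivAt {w w' : ℝ → ℝ} {f F : ℝ → ℂ} {p q W V : ℝ} (hpq : p ≤ q)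
    (hw : ∀ u ∈ Set.Icc p q, HasDerivAt w (w' u) u) (hw' : ContinuousOn w' (Set.Icc p q))
    (hsign : (∀ u ∈ Set.Icc p q, 0 ≤ w' u) ∨ ∀ u ∈ Set.Icc p q, w' u ≤ 0)
    (hF : ContinuousOn F (Set.Icc p q)) (hFf : ∀ u ∈ Set.Ioo p q, HasDerivAt F (f u) u)
    (hf : IntervalIntegrable f volume p q) (hW : ∀ u ∈ Set.Icc p q, |w u| ≤ W)
    (hV : ∀ u ∈ Set.Icc p q, ‖F u‖ ≤ V) :
    ‖∫ u in p..q, (w u : ℂ) * f u‖ ≤ 4 * W * V := by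
  have hI : Set.uIcc p q = Set.Icc p q := Set.uIcc_of_le hpq
  have hpm := Set.left_mem_Icc.2 hpq
  have hqm := Set.right_mem_Icc.2 hpq
  have hW0 : 0 ≤ W := (abs_nonneg _).trans (hW p hpm)
  have hV0 : 0 ≤ V := (norm_nonneg _).trans (hV p hpm)
  have hw'i : IntervalIntegrable w' volume p q := (hI ▸ hw').intervalIntegrable
  have hend : ∀ u ∈ Set.Icc p q, ‖(w u : ℂ) * F u‖ ≤ W * V := fun u hu => by
    rw [norm_mul, norm_real, Real.norm_eq_abs]
    exact mul_le_mul (hW u hu) (hV u hu) (norm_nonneg _) hW0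
  have hparts : ∫ u in p..q, (w u : ℂ) * f u =
      (w q : ℂ) * F q - (w p : ℂ) * F p - ∫ u in p..q, (w' u : ℂ) * F u :=
    integral_mul_deriv_eq_deriv_mul_of_hasDerivAt
      (hI ▸ fun u hu => (hw u hu).ofReal_comp.continuousAt.continuousWithinAt) (hI ▸ hF)
      (fun u hu => by
        rw [min_eq_left hpq, max_eq_right hpq] at hu
        exact (hw u (Set.Ioo_subset_Icc_self hu)).ofReal_comp)
      (by rwa [min_eq_left hpq, max_eq_right hpq]) (intervalIntegrable_ofReal hw'i) hf
  have hint : ‖∫ u in p..q, (w' u : ℂ) * F u‖ ≤ 2 * W * V := by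
    calc ‖∫ u in p..q, (w' u : ℂ) * F u‖ ≤ ∫ u in p..q, |w' u| * V := by
          refine intervalIntegral.norm_integral_le_of_norm_le hpq (ae_of_all _ fun u hu => ?_)
            (hw'i.abs.mul_const _)
          rw [norm_mul, norm_real, Real.norm_eq_abs]
          exact mul_le_mul_of_nonneg_left (hV u (Set.Ioc_subset_Icc_self hu)) (abs_nonneg _)
      _ = (∫ u in p..q, |w' u|) * V := intervalIntegral.integral_mul_const _ _
      _ ≤ 2 * W * V := mul_le_mul_of_nonneg_right
          (integral_abs_deriv_le_of_sign hpq hw hw'i hsign hW) hV0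
  rw [hparts]
  linarith [norm_sub_le ((w q : ℂ) * F q - (w p : ℂ) * F p) (∫ u in p..q, (w' u : ℂ) * F u),
    norm_sub_le ((w q : ℂ) * F q) ((w p : ℂ) * F p), hend p hpm, hend q hqm]

theorem intervalIntegrable_ofReal_cpow {z : ℂ} {p q : ℝ} (hp : 0 ≤ p) (hpq : p ≤ q)
    (hz : 0 < p ∨ -1 < z.re) : IntervalIntegrable (fun u : ℝ => (u : ℂ) ^ z) volume p q := by
  rcases hz with hz | hz
  · exact intervalIntegrable_cpow (.inr fun h =>
      hz.not_ge (by simpa [Set.uIcc_of_le hpq, hp.trans hpq] using h))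
  · exact intervalIntegrable_cpow' hz

theorem norm_integral_one_sub_rpow_mul_cpow_le {c η p q V : ℝ} (hη : 0 < η) {z : ℂ} (hp : 0 ≤ p)
    (hpq : p ≤ q) (hq : q ≤ 1 - η) (hz : 0 < p ∨ -1 < z.re) (hz1 : z + 1 ≠ 0)
    (hV : ∀ u ∈ Set.Icc p q, ‖(u : ℂ) ^ (z + 1)‖ ≤ V) :
    ‖∫ u in p..q, (((1 - u) ^ (c - 1) : ℝ) : ℂ) * (u : ℂ) ^ z‖
      ≤ 4 * max 1 (η ^ (c - 1)) * (V / ‖z + 1‖) := by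
  have hpos : ∀ u ∈ Set.Icc p q, 0 < 1 - u := fun u hu => by linarith [hu.2]
  refine norm_integral_mul_le_of_hasDerivAt (w' := fun u => -((c - 1) * (1 - u) ^ (c - 1 - 1)))
    (F := fun u : ℝ => (u : ℂ) ^ (z + 1) / (z + 1)) hpq (fun u hu => ?_) (fun u hu => ?_) ?_
    (fun u hu => ?_) (fun u hu => ?_) (intervalIntegrable_ofReal_cpow hp hpq hz) (fun u hu => ?_)
    fun u hu => ?_
  · refine (((hasDerivAt_id u).const_sub 1).rpow_const
      (p := c - 1) (.inl (hpos u hu).ne')).congr_deriv ?_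
    simp only [id]
    ring
  · exact ((((continuous_const.sub continuous_id).continuousAt).rpow_const
      (.inl (hpos u hu).ne')).const_mul _).neg.continuousWithinAt
  · rcases le_total c 1 with h | h
    · exact .inl fun u hu => neg_nonneg.2 (mul_nonpos_of_nonpos_of_nonneg (sub_nonpos.2 h)
        (Real.rpow_nonneg (hpos u hu).le _))
    · exact .inr fun u hu => neg_nonpos.2 (mul_nonneg (sub_nonneg.2 h)
        (Real.rpow_nonneg (hpos u hu).le _))
  · refine ((continuousAt_ofReal_cpow_const _ _ ?_).div_const _).continuousWithinAt
    exact hz.symm.imp (fun h => by rw [add_re, one_re]; linarith) fun h => (h.trans_le hu.1).ne'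
  · have := (hasDerivAt_ofReal_cpow_const (hp.trans_lt hu.1).ne' hz1).div_const (z + 1)
    rwa [add_sub_cancel_right, mul_div_cancel_left₀ _ hz1] at this
  · rw [abs_of_nonneg (Real.rpow_nonneg (hpos u hu).le _)]
    rcases le_total c 1 with h | h
    · exact le_max_of_le_right
        (Real.rpow_le_rpow_of_nonpos hη (by linarith [hu.2]) (by linarith))
    · exact le_max_of_le_left
        (Real.rpow_le_one (hpos u hu).le (by linarith [hu.1]) (by linarith))
  · rw [norm_div]
    exact div_le_div_of_nonneg_right (hV u hu) (norm_nonneg _)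

/-- The upper incomplete Beta integral `∫_t^1 (1 - u)^(c - 1) u^z du`, through which a zero `z` of
the zeta function contributes to a Riesz mean. -/
noncomputable def incBeta (c : ℝ) (z : ℂ) (t : ℝ) : ℂ :=
  ∫ u in t..1, (((1 - u) ^ (c - 1) : ℝ) : ℂ) * (u : ℂ) ^ z

theorem intervalIntegrable_one_sub_rpow {c : ℝ} (hc : 0 < c) (p q : ℝ) :
    IntervalIntegrable (fun u : ℝ => (1 - u) ^ (c - 1)) volume p q := by
  simpa using (intervalIntegrable_rpow' (a := 1 - p) (b := 1 - q)
    (by linarith : -1 < c - 1)).comp_sub_left 1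

theorem one_sub_rpow_mul_cpow_eq {c u : ℝ} (hu : u ≤ 1) (z : ℂ) :
    (((1 - u) ^ (c - 1) : ℝ) : ℂ) * (u : ℂ) ^ z =
      (u : ℂ) ^ (z + 1 - 1) * (1 - (u : ℂ)) ^ ((c : ℂ) - 1) := by
  rw [ofReal_cpow (by linarith), add_sub_cancel_right, mul_comm]
  push_cast
  rfl

theorem intervalIntegrable_incBeta {c : ℝ} (hc : 0 < c) {z : ℂ} {p q : ℝ} (hp : 0 ≤ p)
    (hpq : p ≤ q) (hq : q ≤ 1) (hz : 0 < p ∨ -1 < z.re) :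
    IntervalIntegrable (fun u : ℝ => (((1 - u) ^ (c - 1) : ℝ) : ℂ) * (u : ℂ) ^ z) volume p q := by
  have hIcc : Set.uIcc p q ⊆ Set.uIcc 0 1 := by
    rw [Set.uIcc_of_le hpq, Set.uIcc_of_le zero_le_one]
    exact Set.Icc_subset_Icc hp hq
  rcases hz with hp0 | hz
  · refine (intervalIntegrable_ofReal (intervalIntegrable_one_sub_rpow hc p q)).mul_continuousOn ?_
    rw [Set.uIcc_of_le hpq]
    exact fun u hu => (continuousAt_ofReal_cpow_const _ _
      (.inr (hp0.trans_le hu.1).ne')).continuousWithinAt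
  · refine ((betaIntegral_convergent (u := z + 1) (v := c) (by simpa using neg_lt_iff_pos_add.1 hz)
      (by simpa using hc)).congr fun u hu => ?_).mono_set hIcc
    rw [Set.uIoc_of_le zero_le_one] at hu
    exact (one_sub_rpow_mul_cpow_eq hu.2 z).symm

theorem incBeta_zero {c : ℝ} {z : ℂ} : incBeta c z 0 = betaIntegral (z + 1) c := by
  refine integral_congr fun u hu => one_sub_rpow_mul_cpow_eq ?_ z
  rw [Set.uIcc_of_le zero_le_one] at hu
  exact hu.2

theorem integral_one_sub_rpow {c : ℝ} (hc : 0 < c) (x : ℝ) :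
    ∫ u in x..1, (1 - u) ^ (c - 1) = (1 - x) ^ c / c := by
  rw [intervalIntegral.integral_comp_sub_left (fun u => u ^ (c - 1)) 1,
    integral_rpow (.inl (by linarith))]
  simp [Real.zero_rpow hc.ne']

theorem norm_incBeta_le_one_sub_rpow {c : ℝ} (hc : 0 < c) {z : ℂ} {t V : ℝ} (ht1 : t ≤ 1)
    (hV : ∀ u ∈ Set.Icc t 1, ‖(u : ℂ) ^ z‖ ≤ V) : ‖incBeta c z t‖ ≤ (1 - t) ^ c / c * V := by
  rw [← integral_one_sub_rpow hc, ← intervalIntegral.integral_mul_const]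
  refine intervalIntegral.norm_integral_le_of_norm_le ht1 (ae_of_all _ fun u hu => ?_)
    ((intervalIntegrable_one_sub_rpow hc t 1).mul_const V)
  have hu1 : 0 ≤ (1 - u) ^ (c - 1) := Real.rpow_nonneg (by linarith [hu.2]) _
  rw [norm_mul, norm_real, Real.norm_of_nonneg hu1]
  exact mul_le_mul_of_nonneg_left (hV u (Set.Ioc_subset_Icc_self hu)) hu1

theorem inv_rpow_le_rpow_neg_min {c n : ℝ} (hn : 1 ≤ n) : n⁻¹ ^ c ≤ n ^ (-min 1 c) := by
  rw [Real.inv_rpow (by linarith), ← Real.rpow_neg (by linarith)]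
  exact Real.rpow_le_rpow_of_exponent_le hn (neg_le_neg (min_le_right _ _))

theorem max_one_inv_rpow_sub_one_div_le {c n : ℝ} (hn : 1 ≤ n) :
    max 1 (n⁻¹ ^ (c - 1)) / n ≤ n ^ (-min 1 c) := by
  have hn0 : 0 < n := by linarith
  rw [← max_div_div_right hn0.le]
  refine max_le ?_ ((le_of_eq ?_).trans (inv_rpow_le_rpow_neg_min hn))
  · rw [one_div, ← Real.rpow_neg_one]
    exact Real.rpow_le_rpow_of_exponent_le hn (neg_le_neg (min_le_left _ _))
  · rw [Real.rpow_sub_one (inv_ne_zero hn0.ne')]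
    field_simp

theorem norm_ofReal_cpow_add_one_le {z : ℂ} {u : ℝ} (hu0 : 0 ≤ u) (hu1 : u ≤ 1)
    (hz : z + 1 ≠ 0) : ‖(u : ℂ) ^ (z + 1)‖ ≤ ‖(u : ℂ) ^ z‖ := by
  rcases hu0.eq_or_lt with rfl | hu
  · simp [zero_cpow hz]
  · rw [cpow_add _ _ (ofReal_ne_zero.2 hu.ne'), cpow_one, norm_mul, norm_real,
      Real.norm_of_nonneg hu0]
    exact mul_le_of_le_one_right (norm_nonneg _) hu1

theorem incBeta_eq_integral_add {c : ℝ} (hc : 0 < c) {z : ℂ} {s t : ℝ} (hs : 0 ≤ s) (hst : s ≤ t)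
    (ht : t ≤ 1) (hz : 0 < s ∨ -1 < z.re) : incBeta c z s =
      (∫ u in s..t, (((1 - u) ^ (c - 1) : ℝ) : ℂ) * (u : ℂ) ^ z) + incBeta c z t :=
  (integral_add_adjacent_intervals (intervalIntegrable_incBeta hc hs hst ht hz)
    (intervalIntegrable_incBeta hc (hs.trans hst) ht le_rfl (hz.imp_left hst.trans_lt'))).symm

-- Split the integral at distance `1 / ‖z + 1‖` from the endpoint: beyond this point the trivial
-- bound is sharp, before it integration by parts gains a factor `1 / ‖z + 1‖`.
theorem norm_incBeta_le {c : ℝ} (hc : 0 < c) {z : ℂ} {t V : ℝ} (ht : 0 ≤ t) (ht1 : t ≤ 1)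
    (hz : 0 < t ∨ -1 < z.re) (hz1 : 1 ≤ ‖z + 1‖)
    (hV : ∀ u ∈ Set.Icc t 1, ‖(u : ℂ) ^ z‖ ≤ V) :
    ‖incBeta c z t‖ ≤ (4 + 1 / c) * V * ‖z + 1‖ ^ (-min 1 c) := by
  set n := ‖z + 1‖
  have hn0 : 0 < n := by linarith
  have hzne : z + 1 ≠ 0 := norm_pos_iff.1 hn0
  have hV0 : 0 ≤ V := (norm_nonneg _).trans (hV 1 ⟨ht1, le_rfl⟩)
  have htail : ∀ x, t ≤ x → x ≤ 1 → 1 - x ≤ n⁻¹ →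
      ‖incBeta c z x‖ ≤ 1 / c * V * n ^ (-min 1 c) := by
    intro x htx hx1 hxn
    calc ‖incBeta c z x‖ ≤ (1 - x) ^ c / c * V :=
          norm_incBeta_le_one_sub_rpow hc hx1 fun u hu => hV u ⟨htx.trans hu.1, hu.2⟩
      _ ≤ n ^ (-min 1 c) / c * V := by
          gcongr
          exact (Real.rpow_le_rpow (by linarith) hxn hc.le).trans (inv_rpow_le_rpow_neg_min hz1)
      _ = 1 / c * V * n ^ (-min 1 c) := by ring
  have hninv : 0 < n⁻¹ := inv_pos.2 hn0
  rcases le_total (1 - n⁻¹) t with h | h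
  · refine (htail t le_rfl ht1 (by linarith)).trans ?_
    gcongr
    linarith
  · have hhead := norm_integral_one_sub_rpow_mul_cpow_le (c := c) hninv ht h le_rfl hz hzne
      fun u hu => (norm_ofReal_cpow_add_one_le (ht.trans hu.1) (by linarith [hu.2]) hzne).trans
        (hV u ⟨hu.1, by linarith [hu.2]⟩)
    calc ‖incBeta c z t‖ ≤ 4 * max 1 (n⁻¹ ^ (c - 1)) * (V / n) + 1 / c * V * n ^ (-min 1 c) := by
          rw [incBeta_eq_integral_add hc ht h (by linarith) hz]
          exact (norm_add_le _ _).trans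
            (add_le_add hhead (htail _ h (by linarith) (by linarith)))
      _ = 4 * V * (max 1 (n⁻¹ ^ (c - 1)) / n) + 1 / c * V * n ^ (-min 1 c) := by ring
      _ ≤ 4 * V * n ^ (-min 1 c) + 1 / c * V * n ^ (-min 1 c) := by
          gcongr
          exact max_one_inv_rpow_sub_one_div_le hz1
      _ = (4 + 1 / c) * V * n ^ (-min 1 c) := by ring

theorem norm_cpow_mul_incBeta_sub_le {c : ℝ} (hc : 0 < c) {z : ℂ} (hz : 0 ≤ z.re) {t : ℝ}
    (ht : 0 < t) (ht2 : t ≤ 1 / 2) :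
    ‖(t : ℂ) ^ (-z) * (incBeta c z 0 - incBeta c z t)‖
      ≤ 4 * max 1 ((1 / 2) ^ (c - 1)) / ‖z + 1‖ := by
  have hzne : z + 1 ≠ 0 := ne_zero_of_re_pos (by rw [add_re, one_re]; linarith)
  have hV : ∀ u ∈ Set.Icc 0 t, ‖(u : ℂ) ^ (z + 1)‖ ≤ t ^ (z.re + 1) := by
    rintro u ⟨hu0, hut⟩
    rcases hu0.eq_or_lt with rfl | hu
    · rw [ofReal_zero, zero_cpow hzne, norm_zero]
      positivity
    · rw [norm_cpow_eq_rpow_re_of_pos hu, add_re, one_re]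
      exact Real.rpow_le_rpow hu0 hut (by linarith)
  have hle := norm_integral_one_sub_rpow_mul_cpow_le (c := c) (η := 1 / 2) (z := z)
    (by norm_num) le_rfl ht.le (by linarith) (.inr (by linarith)) hzne hV
  rw [incBeta_eq_integral_add hc le_rfl ht.le (by linarith) (.inr (by linarith)),
    add_sub_cancel_right, norm_mul, norm_cpow_eq_rpow_re_of_pos ht, neg_re]
  calc _ ≤ t ^ (-z.re) * (4 * max 1 ((1 / 2) ^ (c - 1)) * (t ^ (z.re + 1) / ‖z + 1‖)) := by gcongr
    _ = (t ^ (-z.re) * t ^ (z.re + 1)) * (4 * max 1 ((1 / 2) ^ (c - 1)) / ‖z + 1‖) := by ring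
    _ = t * (4 * max 1 ((1 / 2) ^ (c - 1)) / ‖z + 1‖) := by
        rw [← Real.rpow_add ht, neg_add_cancel_left, Real.rpow_one]
    _ ≤ _ := mul_le_of_le_one_left (by positivity) (by linarith)

/-! ### Mellin transforms -/

section Mellin

variable {E ι : Type*} [NormedAddCommGroup E] {F : ι → ℝ → E} {u : ι → ℝ} {r : ℝ}

theorem nonneg_of_forall_norm_le_mul_rpow (hb : ∀ i t, 0 < t → ‖F i t‖ ≤ u i * t ^ (-r)) (i : ι) :
    0 ≤ u i := by
  simpa using (norm_nonneg _).trans (hb i 1 one_pos)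

theorem continuousOn_tsum_of_norm_le_rpow [CompleteSpace E] (hu : Summable u) (hr : 0 ≤ r)
    (hF : ∀ i, ContinuousOn (F i) (Set.Ioi 0))
    (hb : ∀ i t, 0 < t → ‖F i t‖ ≤ u i * t ^ (-r)) :
    ContinuousOn (fun t => ∑' i, F i t) (Set.Ioi 0) := by
  intro t ht
  have ht2 : 0 < t / 2 := half_pos ht
  refine ((continuousOn_tsum (s := Set.Ioi (t / 2)) (fun i => (hF i).mono
    (Set.Ioi_subset_Ioi ht2.le)) (hu.mul_right ((t / 2) ^ (-r))) fun i x hx => ?_).continuousAt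
    (Ioi_mem_nhds (half_lt_self ht))).continuousWithinAt
  exact (hb i x (ht2.trans hx)).trans (mul_le_mul_of_nonneg_left
    (Real.rpow_le_rpow_of_nonpos ht2 (le_of_lt hx) (neg_nonpos.2 hr))
    (nonneg_of_forall_norm_le_mul_rpow hb i))

variable [NormedSpace ℂ E]

theorem mellin_eq_intervalIntegral {f : ℝ → E} (h0 : ∀ t, 1 ≤ t → f t = 0) (s : ℂ) :
    mellin f s = ∫ t in (0 : ℝ)..1, (t : ℂ) ^ (s - 1) • f t := by
  rw [mellin, intervalIntegral.integral_of_le zero_le_one]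
  refine setIntegral_eq_of_subset_of_forall_sdiff_eq_zero measurableSet_Ioi
    Set.Ioc_subset_Ioi_self fun t ht => ?_
  rw [h0 t (not_le.1 fun h => ht.2 ⟨ht.1, h⟩).le, smul_zero]

theorem mellinConvergent_of_norm_le_rpow {f : ℝ → E} {A r : ℝ} (hf : ContinuousOn f (Set.Ioi 0))
    (h0 : ∀ t, 1 ≤ t → f t = 0) (hb : ∀ t, 0 < t → ‖f t‖ ≤ A * t ^ (-r)) {s : ℂ}
    (hs : r < s.re) : MellinConvergent f s := by
  refine mellinConvergent_of_isBigO_rpow (hf.locallyIntegrableOn measurableSet_Ioi)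
    (a := s.re + 1) ?_ (lt_add_one _) (.of_bound A ?_) hs
  · refine Asymptotics.IsBigO.of_bound 1 ?_
    filter_upwards [eventually_ge_atTop 1] with t ht
    simp [h0 t ht]
  · filter_upwards [self_mem_nhdsWithin] with t ht
    rw [Real.norm_of_nonneg (Real.rpow_nonneg (le_of_lt ht) _)]
    exact hb t ht

theorem integral_norm_cpow_smul_le {f : ℝ → E} {A r : ℝ} (hf : ContinuousOn f (Set.Ioi 0))
    (h0 : ∀ t, 1 ≤ t → f t = 0) (hb : ∀ t, 0 < t → ‖f t‖ ≤ A * t ^ (-r)) {s : ℂ}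
    (hs : r < s.re) :
    ∫ t in Set.Ioi (0 : ℝ), ‖(t : ℂ) ^ (s - 1) • f t‖ ≤ A / (s.re - r) := by
  have hint : IntegrableOn (fun t : ℝ => ‖(t : ℂ) ^ (s - 1) • f t‖) (Set.Ioc 0 1) :=
    ((mellinConvergent_of_norm_le_rpow hf h0 hb hs).mono_set Set.Ioc_subset_Ioi_self).norm
  rw [setIntegral_eq_of_subset_of_forall_sdiff_eq_zero measurableSet_Ioi
    (Set.Ioc_subset_Ioi_self : Set.Ioc (0 : ℝ) 1 ⊆ _) fun t ht => by
      rw [h0 t (not_le.1 fun h => ht.2 ⟨ht.1, h⟩).le, smul_zero, norm_zero]]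
  calc ∫ t in Set.Ioc (0 : ℝ) 1, ‖(t : ℂ) ^ (s - 1) • f t‖
      ≤ ∫ t in Set.Ioc (0 : ℝ) 1, A * t ^ (s.re - r - 1) := by
        refine setIntegral_mono_on hint ?_ measurableSet_Ioc fun t ht => ?_
        · exact ((intervalIntegrable_iff_integrableOn_Ioc_of_le zero_le_one).1
            (intervalIntegrable_rpow' (by linarith))).const_mul A
        · rw [norm_smul, norm_cpow_eq_rpow_re_of_pos ht.1, sub_re, one_re]
          calc t ^ (s.re - 1) * ‖f t‖ ≤ t ^ (s.re - 1) * (A * t ^ (-r)) :=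
                mul_le_mul_of_nonneg_left (hb t ht.1) (Real.rpow_nonneg ht.1.le _)
            _ = A * t ^ (s.re - r - 1) := by
                rw [mul_left_comm, ← Real.rpow_add ht.1]
                ring_nf
    _ = A / (s.re - r) := by
        rw [← intervalIntegral.integral_of_le zero_le_one, intervalIntegral.integral_const_mul,
          integral_rpow (.inl (by linarith)), sub_add_cancel, Real.one_rpow,
          Real.zero_rpow (by linarith), sub_zero, mul_one_div]

theorem hasMellin_tsum [Countable ι] [CompleteSpace E] (hu : Summable u) (hr : 0 ≤ r)
    (hF : ∀ i, ContinuousOn (F i) (Set.Ioi 0)) (h0 : ∀ i t, 1 ≤ t → F i t = 0)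
    (hb : ∀ i t, 0 < t → ‖F i t‖ ≤ u i * t ^ (-r)) {s : ℂ} (hs : r < s.re) :
    HasMellin (fun t => ∑' i, F i t) s (∑' i, mellin (F i) s) := by
  refine ⟨mellinConvergent_of_norm_le_rpow (continuousOn_tsum_of_norm_le_rpow hu hr hF hb)
    (fun t ht => ?_) (fun t ht => tsum_of_norm_bounded (hu.hasSum.mul_right _)
      fun i => hb i t ht) hs, ?_⟩
  · simp only [h0 _ t ht, tsum_zero]
  · have hsum : Summable fun i => ∫ t in Set.Ioi (0 : ℝ), ‖(t : ℂ) ^ (s - 1) • F i t‖ :=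
      .of_nonneg_of_le (fun i => integral_nonneg fun t => norm_nonneg _)
        (fun i => integral_norm_cpow_smul_le (hF i) (h0 i) (hb i) hs) (hu.div_const _)
    simp only [mellin, ← tsum_const_smul'']
    exact (hasSum_integral_of_summable_integral_norm
      (fun i => mellinConvergent_of_norm_le_rpow (hF i) (h0 i) (hb i) hs) hsum).tsum_eq.symm

end Mellin

theorem eq_zero_of_hasMellin_zero {E : Type*} [NormedAddCommGroup E] [NormedSpace ℂ E]
    [CompleteSpace E] {f : ℝ → E} {σ t : ℝ} (hf : ∀ s : ℂ, s.re = σ → HasMellin f s 0)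
    (ht : 0 < t) (hft : ContinuousAt f t) : f t = 0 := by
  have hline : ∀ y : ℝ, mellin f (σ + y * I) = 0 := fun y => (hf _ (by simp)).2
  rw [← mellinInv_mellin_eq σ f ht (hf σ (ofReal_re σ)).1
    (by simp only [VerticalIntegrable, hline]; exact integrable_zero _ _ _) hft]
  simp only [mellinInv, hline, smul_zero, MeasureTheory.integral_zero]

/-- The kernel `(1 - t)_+ ^ (a - 1)` of the Riesz mean of order `a - 1`. -/
noncomputable def cesaroKernel (a t : ℝ) : ℝ := (max (1 - t) 0) ^ (a - 1)

theorem continuous_cesaroKernel {a : ℝ} (ha : 1 ≤ a) : Continuous (cesaroKernel a) :=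
  ((continuous_const.sub continuous_id).max continuous_const).rpow_const
    fun _ => .inr (sub_nonneg.2 ha)

theorem cesaroKernel_of_one_le {a : ℝ} (ha : a ≠ 1) {t : ℝ} (ht : 1 ≤ t) :
    cesaroKernel a t = 0 := by
  rw [cesaroKernel, max_eq_right (by linarith), Real.zero_rpow (sub_ne_zero.2 ha)]

theorem cesaroKernel_of_le_one {a t : ℝ} (ht : t ≤ 1) :
    cesaroKernel a t = (1 - t) ^ (a - 1) := by
  rw [cesaroKernel, max_eq_left (by linarith)]

theorem cesaroKernel_nonneg (a t : ℝ) : 0 ≤ cesaroKernel a t :=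
  Real.rpow_nonneg (le_max_right _ _) _

theorem cesaroKernel_le_one {a : ℝ} (ha : 1 ≤ a) {t : ℝ} (ht : 0 ≤ t) : cesaroKernel a t ≤ 1 :=
  Real.rpow_le_one (le_max_right _ _) (max_le (by linarith) zero_le_one) (by linarith)

theorem hasMellin_cesaroKernel {a : ℝ} (ha : 1 < a) {s : ℂ} (hs : 0 < s.re) :
    HasMellin (fun t => (cesaroKernel a t : ℂ)) s (betaIntegral s a) := by
  have h0 : ∀ t, 1 ≤ t → (cesaroKernel a t : ℂ) = 0 := fun t ht => by
    rw [cesaroKernel_of_one_le ha.ne' ht, ofReal_zero]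
  refine ⟨mellinConvergent_of_norm_le_rpow (A := 1) (r := 0)
    (continuous_ofReal.comp (continuous_cesaroKernel ha.le)).continuousOn h0 (fun t ht => ?_) hs,
    ?_⟩
  · rw [neg_zero, Real.rpow_zero, mul_one, Function.comp_apply, norm_real,
      Real.norm_of_nonneg (cesaroKernel_nonneg _ _)]
    exact cesaroKernel_le_one ha.le ht.le
  · rw [mellin_eq_intervalIntegral h0, betaIntegral]
    refine integral_congr fun t ht => ?_
    rw [Set.uIcc_of_le zero_le_one] at ht
    simp only [smul_eq_mul]
    rw [cesaroKernel_of_le_one ht.2, ofReal_cpow (by linarith [ht.2])]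
    push_cast
    rfl

/-- The function whose Mellin transform at `s` is `B(s + 1, c) / (s - z)`; up to a scalar, the
contribution of a zero `z` of `riemannZeta₁` to a Riesz mean of the von Mangoldt function. -/
noncomputable def zeroKernel (c : ℝ) (z : ℂ) (t : ℝ) : ℂ :=
  (t : ℂ) ^ (-z) * incBeta c z (min t 1)

theorem zeroKernel_of_le_one {c t : ℝ} {z : ℂ} (ht : t ≤ 1) :
    zeroKernel c z t = (t : ℂ) ^ (-z) * incBeta c z t := by
  rw [zeroKernel, min_eq_left ht]

theorem zeroKernel_of_one_le {c t : ℝ} {z : ℂ} (ht : 1 ≤ t) : zeroKernel c z t = 0 := by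
  rw [zeroKernel, min_eq_right ht, incBeta, integral_same, mul_zero]

theorem continuousOn_incBeta {c : ℝ} (hc : 0 < c) (z : ℂ) :
    ContinuousOn (incBeta c z) (Set.Ioc 0 1) := by
  intro t ht
  have hle : t / 2 ≤ 1 := by linarith [ht.1, ht.2]
  have hcont := continuousOn_primitive_interval_left
    (((intervalIntegrable_iff').1 (intervalIntegrable_incBeta hc (z := z) (half_pos ht.1).le hle
      le_rfl (.inl (half_pos ht.1)))))
  rw [Set.uIcc_of_le hle] at hcont
  refine (hcont t ⟨by linarith [ht.1], ht.2⟩).mono_of_mem_nhdsWithin ?_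
  filter_upwards [self_mem_nhdsWithin,
    mem_nhdsWithin_of_mem_nhds (Ioi_mem_nhds (half_lt_self ht.1))] with x hx hx2
  exact ⟨le_of_lt hx2, hx.2⟩

theorem continuousOn_zeroKernel {c : ℝ} (hc : 0 < c) (z : ℂ) :
    ContinuousOn (zeroKernel c z) (Set.Ioi 0) :=
  ContinuousOn.mul (fun _ ht => (continuousAt_ofReal_cpow_const _ _
    (.inr (ne_of_gt ht))).continuousWithinAt) ((continuousOn_incBeta hc z).comp
    (continuous_id.min continuous_const).continuousOn fun _ ht => ⟨lt_min ht one_pos,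
      min_le_right _ _⟩)

theorem norm_zeroKernel_le {c σ : ℝ} (hc : 0 < c) (hσ : 0 ≤ σ) {z : ℂ} (hz : z.re ≤ σ)
    (hz1 : 1 ≤ ‖z + 1‖) {t : ℝ} (ht : 0 < t) :
    ‖zeroKernel c z t‖ ≤ (4 + 1 / c) * ‖z + 1‖ ^ (-min 1 c) * t ^ (-σ) := by
  rcases le_total 1 t with ht1 | ht1
  · rw [zeroKernel_of_one_le ht1, norm_zero]
    positivity
  have hV : ∀ u ∈ Set.Icc t 1, ‖(u : ℂ) ^ z‖ ≤ t ^ (z.re - σ) := by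
    intro u hu
    have hu0 : 0 < u := ht.trans_le hu.1
    rw [norm_cpow_eq_rpow_re_of_pos hu0]
    exact (Real.rpow_le_rpow_of_exponent_ge hu0 hu.2 (by linarith)).trans
      (Real.rpow_le_rpow_of_nonpos ht hu.1 (by linarith))
  rw [zeroKernel_of_le_one ht1, norm_mul, norm_cpow_eq_rpow_re_of_pos ht, neg_re]
  calc t ^ (-z.re) * ‖incBeta c z t‖
      ≤ t ^ (-z.re) * ((4 + 1 / c) * t ^ (z.re - σ) * ‖z + 1‖ ^ (-min 1 c)) := by
        gcongr
        exact norm_incBeta_le hc ht.le ht1 (.inl ht) hz1 hV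
    _ = (4 + 1 / c) * ‖z + 1‖ ^ (-min 1 c) * (t ^ (-z.re) * t ^ (z.re - σ)) := by ring
    _ = (4 + 1 / c) * ‖z + 1‖ ^ (-min 1 c) * t ^ (-σ) := by
        rw [← Real.rpow_add ht]
        ring_nf

theorem hasDerivAt_incBeta {c : ℝ} (hc : 0 < c) (z : ℂ) {t : ℝ} (ht : t ∈ Set.Ioo (0 : ℝ) 1) :
    HasDerivAt (incBeta c z) (-((((1 - t) ^ (c - 1) : ℝ) : ℂ) * (t : ℂ) ^ z)) t := by
  have hcont : ContinuousOn (fun u : ℝ => (((1 - u) ^ (c - 1) : ℝ) : ℂ) * (u : ℂ) ^ z)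
      (Set.Ioo 0 1) := fun u hu =>
    ((continuous_ofReal.continuousAt.comp (((continuous_const.sub continuous_id).continuousAt
      ).rpow_const (.inl (sub_pos.2 hu.2).ne'))).mul
      (continuousAt_ofReal_cpow_const _ _ (.inr hu.1.ne'))).continuousWithinAt
  exact integral_hasDerivAt_left (intervalIntegrable_incBeta hc ht.1.le ht.2.le le_rfl (.inl ht.1))
    (hcont.stronglyMeasurableAtFilter isOpen_Ioo t ht)
    (hcont.continuousAt (isOpen_Ioo.mem_nhds ht))

theorem hasDerivAt_cpow_mul_zeroKernel {c : ℝ} (hc : 0 < c) {s z : ℂ} (hsz : s ≠ z) {t : ℝ}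
    (ht : t ∈ Set.Ioo (0 : ℝ) 1) :
    HasDerivAt (fun t : ℝ => (t : ℂ) ^ s * zeroKernel c z t)
      ((s - z) * ((t : ℂ) ^ (s - 1) * zeroKernel c z t)
        - (((1 - t) ^ (c - 1) : ℝ) : ℂ) * (t : ℂ) ^ s) t := by
  have ht0 : (t : ℂ) ≠ 0 := ofReal_ne_zero.2 ht.1.ne'
  have hderiv : HasDerivAt (fun t : ℝ => (t : ℂ) ^ (s - z) * incBeta c z t) _ t :=
    (hasDerivAt_ofReal_cpow_const ht.1.ne' (sub_ne_zero.2 hsz)).mul (hasDerivAt_incBeta hc z ht)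
  refine (hderiv.congr_deriv ?_).congr_of_eventuallyEq ?_
  · have hpow : (t : ℂ) ^ (s - z - 1) = (t : ℂ) ^ (s - 1) * (t : ℂ) ^ (-z) := by
      rw [← cpow_add _ _ ht0]
      ring_nf
    have hpow' : (t : ℂ) ^ (s - z) * (t : ℂ) ^ z = (t : ℂ) ^ s := by
      rw [← cpow_add _ _ ht0, sub_add_cancel]
    rw [zeroKernel_of_le_one ht.2.le, hpow, ← hpow']
    ring
  · filter_upwards [isOpen_Ioo.mem_nhds ht] with x hx
    rw [zeroKernel_of_le_one hx.2.le, sub_eq_add_neg, cpow_add _ _ (ofReal_ne_zero.2 hx.1.ne'),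
      mul_assoc]

theorem tendsto_cpow_mul_zeroKernel_zero {c σ : ℝ} (hc : 0 < c) (hσ : 0 ≤ σ) {z : ℂ}
    (hz : z.re ≤ σ) (hz1 : 1 ≤ ‖z + 1‖) {s : ℂ} (hs : σ < s.re) :
    Tendsto (fun t : ℝ => (t : ℂ) ^ s * zeroKernel c z t) (𝓝[>] 0) (𝓝 0) := by
  set A := (4 + 1 / c) * ‖z + 1‖ ^ (-min 1 c)
  have hlim : Tendsto (fun t : ℝ => A * t ^ (s.re - σ)) (𝓝[>] 0) (𝓝 0) := by
    have h := ((Real.continuousAt_rpow_const 0 (s.re - σ) (.inr (by linarith))).const_mul A).tendsto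
    rw [Real.zero_rpow (by linarith), mul_zero] at h
    exact h.mono_left nhdsWithin_le_nhds
  refine squeeze_zero_norm' ?_ hlim
  filter_upwards [self_mem_nhdsWithin] with t ht
  have ht : 0 < t := ht
  rw [norm_mul, norm_cpow_eq_rpow_re_of_pos ht]
  calc t ^ s.re * ‖zeroKernel c z t‖ ≤ t ^ s.re * (A * t ^ (-σ)) := by
        gcongr
        exact norm_zeroKernel_le hc hσ hz hz1 ht
    _ = A * t ^ (s.re - σ) := by
        rw [mul_left_comm, ← Real.rpow_add ht, sub_eq_add_neg]

theorem hasMellin_zeroKernel {c σ : ℝ} (hc : 0 < c) (hσ : 0 ≤ σ) {z : ℂ} (hz : z.re ≤ σ)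
    (hz1 : 1 ≤ ‖z + 1‖) {s : ℂ} (hs : σ < s.re) :
    HasMellin (zeroKernel c z) s (betaIntegral (s + 1) c / (s - z)) := by
  have hsz : s ≠ z := by
    rintro rfl
    linarith
  have hconv : MellinConvergent (zeroKernel c z) s :=
    mellinConvergent_of_norm_le_rpow (continuousOn_zeroKernel hc z)
      (fun t ht => zeroKernel_of_one_le ht) (fun t ht => norm_zeroKernel_le hc hσ hz hz1 ht) hs
  refine ⟨hconv, ?_⟩
  have hint : IntervalIntegrable (fun t : ℝ => (s - z) * ((t : ℂ) ^ (s - 1) * zeroKernel c z t))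
      volume 0 1 := by
    rw [intervalIntegrable_iff_integrableOn_Ioc_of_le zero_le_one]
    exact (hconv.mono_set Set.Ioc_subset_Ioi_self).const_mul _
  have hint' := intervalIntegrable_incBeta hc (z := s) le_rfl zero_le_one le_rfl
    (.inr (by linarith))
  have hlim : Tendsto (fun t : ℝ => (t : ℂ) ^ s * zeroKernel c z t) (𝓝[<] 1) (𝓝 0) := by
    have h : ContinuousAt (fun t : ℝ => (t : ℂ) ^ s * zeroKernel c z t) 1 :=
      (continuousAt_ofReal_cpow_const _ _ (.inr one_ne_zero)).mul
        ((continuousOn_zeroKernel hc z).continuousAt (Ioi_mem_nhds one_pos))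
    have h := h.tendsto
    rw [zeroKernel_of_one_le le_rfl, mul_zero] at h
    exact h.mono_left nhdsWithin_le_nhds
  have hftc := integral_eq_sub_of_hasDerivAt_of_tendsto one_pos
    (fun t ht => hasDerivAt_cpow_mul_zeroKernel hc hsz ht) (hint.sub hint')
    (tendsto_cpow_mul_zeroKernel_zero hc hσ hz hz1 hs) hlim
  rw [intervalIntegral.integral_sub hint hint', sub_zero, sub_eq_zero,
    intervalIntegral.integral_const_mul] at hftc
  rw [mellin_eq_intervalIntegral fun t ht => zeroKernel_of_one_le ht,
    eq_div_iff (sub_ne_zero.2 hsz), ← incBeta_zero, incBeta, ← hftc, mul_comm]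
  rfl

/-! ### The explicit formula -/

theorem re_lt_one_of_riemannZeta₁_eq_zero {z : ℂ} (hz : riemannZeta₁ z = 0) : z.re < 1 := by
  contrapose! hz
  exact riemannZeta₁_ne_zero_of_one_le_re hz

theorem one_le_norm_add_one_of_riemannZeta₁_eq_zero {z : ℂ} (hz : riemannZeta₁ z = 0) :
    1 ≤ ‖z + 1‖ := by
  refine le_trans ?_ (abs_re_le_norm (z + 1))
  rw [add_re, one_re, le_abs]
  rcases mem_zetaZeros_or_of_riemannZeta₁_eq_zero hz with h | h
  · exact .inl (by linarith [h.2.1])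
  · exact .inr (by linarith [h.2])

/-- The size of the contribution of a zero `z` of `riemannZeta₁` to a Riesz mean of the von
Mangoldt function, where `δ` is the minimum of `1` and the order of the mean. It vanishes when `z`
is not a zero. -/
noncomputable def zeroWeight (δ : ℝ) (z : ℂ) : ℝ :=
  ‖(analyticOrderNatAt riemannZeta₁ z : ℂ) / z‖ * ‖z + 1‖ ^ (-δ)

theorem exists_inv_norm_le_of_riemannZeta₁_eq_zero :
    ∃ K : ℝ, 0 ≤ K ∧ ∀ z, riemannZeta₁ z = 0 → ‖z‖⁻¹ ≤ K * (1 + ‖z‖)⁻¹ := by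
  obtain ⟨ε, hε, hball⟩ := Metric.eventually_nhds_iff.1
    (differentiable_riemannZeta₁.continuous.continuousAt.eventually_ne riemannZeta₁_zero_ne_zero)
  refine ⟨1 + ε⁻¹, by positivity, fun z hz => ?_⟩
  have hzε : ε ≤ ‖z‖ := by
    by_contra! h
    exact hball (by simpa using h) hz
  have hz0 : 0 < ‖z‖ := hε.trans_le hzε
  rw [inv_eq_one_div, ← div_eq_mul_inv, div_le_div_iff₀ hz0 (by linarith)]
  have : 1 ≤ ε⁻¹ * ‖z‖ := by rwa [inv_mul_eq_div, one_le_div hε]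
  linarith

theorem norm_add_one_rpow_neg_le {z : ℂ} (hz : 1 ≤ ‖z + 1‖) {δ : ℝ} (hδ : 0 ≤ δ) :
    ‖z + 1‖ ^ (-δ) ≤ 3 ^ δ * (1 + ‖z‖) ^ (-δ) := by
  have hle : (1 + ‖z‖) / 3 ≤ ‖z + 1‖ := by
    have : ‖z‖ ≤ ‖z + 1‖ + 1 := by simpa using norm_sub_le (z + 1) 1
    linarith
  calc ‖z + 1‖ ^ (-δ) ≤ ((1 + ‖z‖) / 3) ^ (-δ) :=
        Real.rpow_le_rpow_of_nonpos (by positivity) hle (neg_nonpos.2 hδ)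
    _ = 3 ^ δ * (1 + ‖z‖) ^ (-δ) := by
        rw [Real.div_rpow (by positivity) (by norm_num), Real.rpow_neg (by norm_num : (0 : ℝ) ≤ 3),
          div_inv_eq_mul, mul_comm]

theorem summable_zeroWeight {δ : ℝ} (hδ : 0 < δ) : Summable (zeroWeight δ) := by
  obtain ⟨K, hK0, hK⟩ := exists_inv_norm_le_of_riemannZeta₁_eq_zero
  refine .of_nonneg_of_le (fun z => by unfold zeroWeight; positivity) (fun z => ?_)
    ((summable_riemannZeta₁_zeros (q := 1 + δ) (by linarith)).mul_left (K * 3 ^ δ))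
  by_cases hz : riemannZeta₁ z = 0
  · rw [zeroWeight, norm_div, norm_natCast, div_eq_mul_inv]
    calc (analyticOrderNatAt riemannZeta₁ z : ℝ) * ‖z‖⁻¹ * ‖z + 1‖ ^ (-δ)
        ≤ analyticOrderNatAt riemannZeta₁ z * (K * (1 + ‖z‖)⁻¹)
          * (3 ^ δ * (1 + ‖z‖) ^ (-δ)) := by
          gcongr
          · exact hK z hz
          · exact norm_add_one_rpow_neg_le (one_le_norm_add_one_of_riemannZeta₁_eq_zero hz) hδ.le
      _ = K * 3 ^ δ * (analyticOrderNatAt riemannZeta₁ z * (1 + ‖z‖) ^ (-(1 + δ))) := by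
          rw [neg_add, Real.rpow_add (by positivity), Real.rpow_neg_one]
          ring
  · simp [zeroWeight, analyticOrderNatAt_eq_zero_of_ne_zero differentiable_riemannZeta₁ hz]

/-- The Riesz mean `∑ₙ Λ(n) (1 - n t)_+ ^ (a - 1)` of the von Mangoldt function. -/
noncomputable def vonMangoldtMean (a t : ℝ) : ℂ :=
  ∑' n : ℕ, ((ArithmeticFunction.vonMangoldt n * cesaroKernel a (n * t) : ℝ) : ℂ)

theorem summable_vonMangoldt_mul_rpow {σ : ℝ} (hσ : 1 < σ) :
    Summable fun n : ℕ => ArithmeticFunction.vonMangoldt n * (n : ℝ) ^ (-σ) := by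
  refine (ArithmeticFunction.LSeriesSummable_vonMangoldt (s := σ) hσ).norm.congr fun n => ?_
  rcases eq_or_ne n 0 with rfl | hn
  · simp
  · rw [LSeries.term_of_ne_zero hn, norm_div, norm_real,
      norm_natCast_cpow_of_pos (Nat.pos_of_ne_zero hn),
      Real.norm_of_nonneg ArithmeticFunction.vonMangoldt_nonneg, Real.rpow_neg n.cast_nonneg,
      div_eq_mul_inv, ofReal_re]

theorem vonMangoldt_mul_cesaroKernel_of_one_le {a : ℝ} (ha : a ≠ 1) (n : ℕ) {t : ℝ} (ht : 1 ≤ t) :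
    ArithmeticFunction.vonMangoldt n * cesaroKernel a (n * t) = 0 := by
  rcases eq_or_ne n 0 with rfl | hn
  · simp
  · have hn1 : (1 : ℝ) ≤ n := by exact_mod_cast Nat.one_le_iff_ne_zero.2 hn
    rw [cesaroKernel_of_one_le ha (one_le_mul_of_one_le_of_one_le hn1 ht), mul_zero]

theorem norm_vonMangoldt_mul_cesaroKernel_le {a σ : ℝ} (ha : 1 < a) (hσ : 0 ≤ σ) (n : ℕ) {t : ℝ}
    (ht : 0 < t) : ‖((ArithmeticFunction.vonMangoldt n * cesaroKernel a (n * t) : ℝ) : ℂ)‖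
      ≤ ArithmeticFunction.vonMangoldt n * (n : ℝ) ^ (-σ) * t ^ (-σ) := by
  rw [norm_real, Real.norm_of_nonneg (mul_nonneg ArithmeticFunction.vonMangoldt_nonneg
    (cesaroKernel_nonneg _ _)), mul_assoc, ← Real.mul_rpow n.cast_nonneg ht.le]
  rcases eq_or_ne n 0 with rfl | hn
  · simp
  have hnt : 0 < n * t := by positivity
  refine mul_le_mul_of_nonneg_left ?_ ArithmeticFunction.vonMangoldt_nonneg
  rcases le_total 1 (n * t) with h | h
  · rw [cesaroKernel_of_one_le ha.ne' h]
    positivity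
  · exact (cesaroKernel_le_one ha.le hnt.le).trans
      (Real.one_le_rpow_of_pos_of_le_one_of_nonpos hnt h (neg_nonpos.2 hσ))

theorem continuous_vonMangoldt_mul_cesaroKernel {a : ℝ} (ha : 1 ≤ a) (n : ℕ) :
    Continuous fun t : ℝ =>
      ((ArithmeticFunction.vonMangoldt n * cesaroKernel a (n * t) : ℝ) : ℂ) :=
  continuous_ofReal.comp (((continuous_cesaroKernel ha).comp
    (continuous_const.mul continuous_id)).const_mul _)

theorem continuousOn_vonMangoldtMean {a : ℝ} (ha : 1 < a) :
    ContinuousOn (vonMangoldtMean a) (Set.Ioi 0) :=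
  continuousOn_tsum_of_norm_le_rpow (summable_vonMangoldt_mul_rpow one_lt_two) zero_le_two
    (fun n => (continuous_vonMangoldt_mul_cesaroKernel ha.le n).continuousOn)
    fun n _ ht => norm_vonMangoldt_mul_cesaroKernel_le ha zero_le_two n ht

theorem mellin_vonMangoldt_mul_cesaroKernel {a : ℝ} (ha : 1 < a) (n : ℕ) {s : ℂ} (hs : 0 < s.re) :
    mellin (fun t : ℝ => ((ArithmeticFunction.vonMangoldt n * cesaroKernel a (n * t) : ℝ) : ℂ)) s
      = LSeries.term (fun n => (ArithmeticFunction.vonMangoldt n : ℂ)) s n * betaIntegral s a := by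
  rcases eq_or_ne n 0 with rfl | hn
  · simp [mellin]
  · have hsmul : (fun t : ℝ =>
        ((ArithmeticFunction.vonMangoldt n * cesaroKernel a (n * t) : ℝ) : ℂ)) = fun t : ℝ =>
          (ArithmeticFunction.vonMangoldt n : ℂ) • (cesaroKernel a (n * t) : ℂ) := by
      simp
    rw [hsmul, mellin_const_smul, mellin_comp_mul_left (fun t => (cesaroKernel a t : ℂ)) s
      (by positivity), (hasMellin_cesaroKernel ha hs).2, LSeries.term_of_ne_zero hn, cpow_neg,
      smul_eq_mul, smul_eq_mul, ofReal_natCast, div_eq_mul_inv, mul_assoc]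

theorem hasMellin_vonMangoldtMean {a : ℝ} (ha : 1 < a) {s : ℂ} (hs : 1 < s.re) :
    HasMellin (vonMangoldtMean a) s
      (LSeries (fun n => (ArithmeticFunction.vonMangoldt n : ℂ)) s * betaIntegral s a) := by
  obtain ⟨r, hr1, hrs⟩ := exists_between hs
  rw [LSeries, ← tsum_mul_right]
  simp only [← mellin_vonMangoldt_mul_cesaroKernel ha _ (one_pos.trans hs)]
  have hr : 0 ≤ r := by linarith
  exact hasMellin_tsum (summable_vonMangoldt_mul_rpow hr1) hr
    (fun n => (continuous_vonMangoldt_mul_cesaroKernel ha.le n).continuousOn)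
    (fun n t ht => by rw [vonMangoldt_mul_cesaroKernel_of_one_le ha.ne' n ht, ofReal_zero])
    (fun n _ ht => norm_vonMangoldt_mul_cesaroKernel_le ha hr n ht) hrs

/-- The total contribution of the zeros of `riemannZeta₁` to the Riesz mean of order `c` of the von
Mangoldt function, up to the factor `-c`. -/
noncomputable def zeroMean (c t : ℝ) : ℂ :=
  ∑' z : {z // riemannZeta₁ z = 0}, (analyticOrderNatAt riemannZeta₁ z : ℂ) / z * zeroKernel c z t

theorem norm_div_mul_zeroKernel_le {c σ : ℝ} (hc : 0 < c) (hσ : 0 ≤ σ) {z : ℂ}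
    (hz : riemannZeta₁ z = 0) (hzσ : z.re ≤ σ) {t : ℝ} (ht : 0 < t) :
    ‖(analyticOrderNatAt riemannZeta₁ z : ℂ) / z * zeroKernel c z t‖
      ≤ (4 + 1 / c) * zeroWeight (min 1 c) z * t ^ (-σ) := by
  rw [norm_mul, zeroWeight]
  calc _ ≤ ‖(analyticOrderNatAt riemannZeta₁ z : ℂ) / z‖
        * ((4 + 1 / c) * ‖z + 1‖ ^ (-min 1 c) * t ^ (-σ)) := by
        gcongr
        exact norm_zeroKernel_le hc hσ hzσ (one_le_norm_add_one_of_riemannZeta₁_eq_zero hz) ht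
    _ = _ := by ring

theorem summable_subtype_zeroWeight {c : ℝ} (hc : 0 < c) (p : ℂ → Prop) :
    Summable fun z : {z // p z} => zeroWeight (min 1 c) z :=
  (summable_zeroWeight (lt_min one_pos hc)).subtype p

theorem continuousOn_zeroMean {c : ℝ} (hc : 0 < c) : ContinuousOn (zeroMean c) (Set.Ioi 0) :=
  continuousOn_tsum_of_norm_le_rpow
    ((summable_subtype_zeroWeight hc (riemannZeta₁ · = 0)).mul_left _) zero_le_one
    (fun z => (continuousOn_zeroKernel hc z).const_mul _)
    fun z _ ht => norm_div_mul_zeroKernel_le hc zero_le_one z.2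
      (re_lt_one_of_riemannZeta₁_eq_zero z.2).le ht

theorem hasMellin_zeroMean {c : ℝ} (hc : 0 < c) {s : ℂ} (hs : 1 < s.re) :
    HasMellin (zeroMean c) s (betaIntegral (s + 1) c / s * (1 / (s - 1) - logDeriv riemannZeta₁ 0
      - LSeries (fun n => (ArithmeticFunction.vonMangoldt n : ℂ)) s)) := by
  have := countable_riemannZeta₁_zeros
  have hs0 : s ≠ 0 := ne_zero_of_one_lt_re hs
  have hre : ∀ z : {z // riemannZeta₁ z = 0}, (z : ℂ).re ≤ 1 := fun z =>
    (re_lt_one_of_riemannZeta₁_eq_zero z.2).le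
  rw [← (hasSum_LSeries_vonMangoldt hs).tsum_eq, ← tsum_mul_left]
  refine (hasMellin_tsum ((summable_subtype_zeroWeight hc (riemannZeta₁ · = 0)).mul_left _)
    zero_le_one (fun z => (continuousOn_zeroKernel hc z).const_mul _)
    (fun z t ht => by rw [zeroKernel_of_one_le ht, mul_zero])
    (fun z _ ht => norm_div_mul_zeroKernel_le hc zero_le_one z.2 (hre z) ht) hs).imp_right
    fun h => h.trans (tsum_congr fun z => ?_)
  have hz := one_le_norm_add_one_of_riemannZeta₁_eq_zero z.2
  simp_rw [← smul_eq_mul (_ / _) (zeroKernel _ _ _)]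
  rw [mellin_const_smul, (hasMellin_zeroKernel hc zero_le_one (hre z) hz hs).2, smul_eq_mul]
  field_simp

theorem betaIntegral_sub_one_div {s : ℂ} (hs : 1 < s.re) {a : ℝ} (ha : 0 < a) :
    betaIntegral (s - 1) (a + 1) / a = betaIntegral s a / (s - 1) := by
  have hre : 0 < (s - 1).re := by rw [sub_re, one_re]; linarith
  have hs1 : s - 1 ≠ 0 := ne_zero_of_re_pos hre
  have hrec := betaIntegral_recurrence (v := a) hre ha
  rw [sub_add_cancel] at hrec
  rw [div_eq_div_iff (ofReal_ne_zero.2 ha.ne') hs1]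
  linear_combination hrec

theorem sub_one_mul_betaIntegral_add_one {s : ℂ} (hs : 0 < s.re) {a : ℝ} (ha : 1 < a) :
    ((a : ℂ) - 1) * betaIntegral (s + 1) (a - 1 : ℝ) = s * betaIntegral s a := by
  have hrec := betaIntegral_recurrence (v := (a : ℂ) - 1) hs (by simpa using ha)
  rw [sub_add_cancel] at hrec
  push_cast
  linear_combination -hrec

theorem hasMellin_cpow_mul_cesaroKernel {a : ℝ} (ha : 0 < a) {s : ℂ} (hs : 1 < s.re) :
    HasMellin (fun t : ℝ => (t : ℂ) ^ (-1 : ℂ) • ((cesaroKernel (a + 1) t : ℂ) / a)) s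
      (betaIntegral s a / (s - 1)) := by
  have h := hasMellin_cesaroKernel (a := a + 1) (s := s + -1) (by linarith)
    (by rw [add_re, neg_re, one_re]; linarith)
  refine ⟨MellinConvergent.cpow_smul.2 (h.1.div_const _), ?_⟩
  rw [mellin_cpow_smul, mellin_div_const, h.2, ← betaIntegral_sub_one_div hs ha, ← sub_eq_add_neg]
  push_cast
  rfl

/-- The difference of the two sides of the explicit formula for `vonMangoldtMean`; it is shown to
vanish by computing its Mellin transform. -/
noncomputable def explicitFormulaDefect (a t : ℝ) : ℂ :=
  vonMangoldtMean a t - (t : ℂ) ^ (-1 : ℂ) • ((cesaroKernel (a + 1) t : ℂ) / a)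
    + logDeriv riemannZeta₁ 0 • (cesaroKernel a t : ℂ) + ((a : ℂ) - 1) • zeroMean (a - 1) t

theorem hasMellin_explicitFormulaDefect {a : ℝ} (ha : 1 < a) {s : ℂ} (hs : 1 < s.re) :
    HasMellin (explicitFormulaDefect a) s 0 := by
  have hs0 : 0 < s.re := one_pos.trans hs
  have hΛ := hasMellin_vonMangoldtMean ha hs
  have hpole := hasMellin_cpow_mul_cesaroKernel (one_pos.trans ha) hs
  have hconst := hasMellin_cesaroKernel ha hs0
  have hzero := hasMellin_zeroMean (sub_pos.2 ha) hs
  have h₁ := hasMellin_sub hΛ.1 hpole.1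
  have h₂ := hasMellin_add h₁.1 (hconst.1.const_smul (logDeriv riemannZeta₁ 0))
  have h₃ := hasMellin_add h₂.1 (hzero.1.const_smul ((a : ℂ) - 1))
  refine ⟨h₃.1, h₃.2.trans ?_⟩
  rw [h₂.2, h₁.2, mellin_const_smul, mellin_const_smul, hΛ.2, hpole.2, hconst.2, hzero.2,
    smul_eq_mul, smul_eq_mul, ← mul_assoc, ← mul_div_assoc,
    sub_one_mul_betaIntegral_add_one hs0 ha, mul_div_cancel_left₀ _ (ne_zero_of_re_pos hs0)]
  ring

theorem continuousOn_explicitFormulaDefect {a : ℝ} (ha : 1 < a) :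
    ContinuousOn (explicitFormulaDefect a) (Set.Ioi 0) := by
  have hpow : ContinuousOn (fun t : ℝ => (t : ℂ) ^ (-1 : ℂ)) (Set.Ioi 0) := fun t ht =>
    (continuousAt_ofReal_cpow_const _ _ (.inr (ne_of_gt ht))).continuousWithinAt
  have hker : ∀ {b : ℝ}, 1 ≤ b → ContinuousOn (fun t => (cesaroKernel b t : ℂ)) (Set.Ioi 0) :=
    fun hb => (continuous_ofReal.comp (continuous_cesaroKernel hb)).continuousOn
  exact (((continuousOn_vonMangoldtMean ha).sub
    (hpow.smul ((hker (by linarith)).div_const _))).add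
    ((hker ha.le).const_smul (logDeriv riemannZeta₁ 0))).add
    ((continuousOn_zeroMean (sub_pos.2 ha)).const_smul ((a : ℂ) - 1))

theorem vonMangoldtMean_eq {a : ℝ} (ha : 1 < a) {t : ℝ} (ht : 0 < t) :
    vonMangoldtMean a t = (t : ℂ) ^ (-1 : ℂ) * (cesaroKernel (a + 1) t / a)
      - logDeriv riemannZeta₁ 0 * cesaroKernel a t - ((a : ℂ) - 1) * zeroMean (a - 1) t := by
  have hdefect : explicitFormulaDefect a t = 0 := eq_zero_of_hasMellin_zero (σ := 2)
    (fun s hs => hasMellin_explicitFormulaDefect ha (by linarith)) ht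
    ((continuousOn_explicitFormulaDefect ha).continuousAt (Ioi_mem_nhds ht))
  simp only [explicitFormulaDefect, smul_eq_mul] at hdefect
  linear_combination hdefect

theorem ne_one_of_mem_zetaZeros {ρ : ℂ} (hρ : ρ ∈ zetaZeros) : ρ ≠ 1 := by
  rintro rfl
  exact hρ.2.2.ne one_re

theorem riemannZeta₁_eq_zero_of_mem_zetaZeros {ρ : ℂ} (hρ : ρ ∈ zetaZeros) :
    riemannZeta₁ ρ = 0 := by
  rw [riemannZeta₁_eq_mul (ne_one_of_mem_zetaZeros hρ), hρ.1, mul_zero]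

theorem countable_zetaZeros : Countable zetaZeros :=
  have : Countable {z | riemannZeta₁ z = 0} := countable_riemannZeta₁_zeros
  (Set.inclusion_injective (s := zetaZeros) (t := {z | riemannZeta₁ z = 0})
    fun _ => riemannZeta₁_eq_zero_of_mem_zetaZeros).countable

theorem norm_ofReal_sub_one {a : ℝ} (ha : 1 ≤ a) : ‖(a : ℂ) - 1‖ = a - 1 := by
  rw [← ofReal_one, ← ofReal_sub, norm_real, Real.norm_of_nonneg (sub_nonneg.2 ha)]

/-- The coefficient of `t ^ (-ρ)` in the explicit formula for `vonMangoldtMean a t`. -/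
noncomputable def zeroCoeff (a : ℝ) (ρ : ℂ) : ℂ :=
  zetaMult ρ * betaIntegral ρ a

theorem zeroCoeff_eq_incBeta {a : ℝ} (ha : 1 < a) {ρ : ℂ} (hρ : ρ ∈ zetaZeros) :
    zeroCoeff a ρ = ((a : ℂ) - 1) *
      ((analyticOrderNatAt riemannZeta₁ ρ : ℂ) / ρ * incBeta (a - 1) ρ 0) := by
  have hρ0 : ρ ≠ 0 := ne_zero_of_re_pos hρ.2.1
  rw [zeroCoeff, ← analyticOrderNatAt_riemannZeta₁ (ne_one_of_mem_zetaZeros hρ),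
    incBeta_zero, mul_left_comm, sub_one_mul_betaIntegral_add_one hρ.2.1 ha]
  field_simp

theorem norm_zeroCoeff_le {a : ℝ} (ha : 1 < a) {ρ : ℂ} (hρ : ρ ∈ zetaZeros) :
    ‖zeroCoeff a ρ‖ ≤ (a - 1) * (4 + 1 / (a - 1)) * zeroWeight (min 1 (a - 1)) ρ := by
  have hc : 0 < a - 1 := sub_pos.2 ha
  have hre : 0 < ρ.re := hρ.2.1
  have hunit : ∀ u ∈ Set.Icc (0 : ℝ) 1, ‖(u : ℂ) ^ ρ‖ ≤ 1 := fun u hu => by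
    rw [norm_cpow_eq_rpow_re_of_nonneg hu.1 hre.ne']
    exact Real.rpow_le_one hu.1 hu.2 hre.le
  have hbeta := norm_incBeta_le hc le_rfl zero_le_one (.inr (by linarith))
    (one_le_norm_add_one_of_riemannZeta₁_eq_zero (riemannZeta₁_eq_zero_of_mem_zetaZeros hρ)) hunit
  rw [zeroCoeff_eq_incBeta ha hρ, norm_mul, norm_mul, norm_ofReal_sub_one ha.le, zeroWeight,
    mul_assoc]
  refine mul_le_mul_of_nonneg_left ?_ hc.le
  rw [mul_left_comm]
  gcongr
  rwa [mul_one] at hbeta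

theorem summable_norm_zeroCoeff {a : ℝ} (ha : 1 < a) :
    Summable fun ρ : zetaZeros => ‖zeroCoeff a ρ‖ :=
  .of_nonneg_of_le (fun _ => norm_nonneg _) (fun ρ => norm_zeroCoeff_le ha ρ.2)
    ((summable_subtype_zeroWeight (sub_pos.2 ha) (· ∈ zetaZeros)).mul_left _)

theorem norm_ofReal_cpow_neg_le_max {ρ : ℂ} (hρ : 0 ≤ ρ.re) (hρ1 : ρ.re ≤ 1) {t : ℝ}
    (ht : 0 < t) : ‖(t : ℂ) ^ (-ρ)‖ ≤ max 1 t⁻¹ := by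
  rw [norm_cpow_eq_rpow_re_of_pos ht, neg_re]
  rcases le_total 1 t with h | h
  · exact (Real.rpow_le_one_of_one_le_of_nonpos h (neg_nonpos.2 hρ)).trans (le_max_left _ _)
  · refine le_trans ?_ (le_max_right _ _)
    rw [← Real.rpow_neg_one]
    exact Real.rpow_le_rpow_of_exponent_ge ht h (neg_le_neg hρ1)

theorem norm_zeroCoeff_mul_cpow_neg_le {a t : ℝ} (ht : 0 < t) (ρ : zetaZeros) :
    ‖zeroCoeff a ρ * (t : ℂ) ^ (-(ρ : ℂ))‖ ≤ ‖zeroCoeff a ρ‖ * max 1 t⁻¹ := by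
  rw [norm_mul]
  exact mul_le_mul_of_nonneg_left
    (norm_ofReal_cpow_neg_le_max ρ.2.2.1.le ρ.2.2.2.le ht) (norm_nonneg _)

theorem vonMangoldtMean_of_half_le {a : ℝ} (ha : a ≠ 1) {t : ℝ} (ht : 1 / 2 ≤ t) :
    vonMangoldtMean a t = 0 := by
  refine (tsum_congr fun n => ?_).trans tsum_zero
  rcases lt_or_ge n 2 with hn | hn
  · interval_cases n <;> simp
  · have hn : (2 : ℝ) ≤ n := by exact_mod_cast hn
    rw [cesaroKernel_of_one_le ha (by nlinarith), mul_zero, ofReal_zero]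

theorem exists_norm_vonMangoldtMean_sub_le_of_half_le {a : ℝ} (ha : 1 < a) :
    ∃ C : ℝ, 0 ≤ C ∧ ∀ t : ℝ, 1 / 2 ≤ t → ‖vonMangoldtMean a t - ((t⁻¹ / a : ℝ) : ℂ)
      + ∑' ρ : zetaZeros, zeroCoeff a ρ * (t : ℂ) ^ (-(ρ : ℂ))‖ ≤ C := by
  have : 0 < a := one_pos.trans ha
  refine ⟨2 / a + (∑' ρ : zetaZeros, ‖zeroCoeff a ρ‖) * 2,
    add_nonneg (by positivity) (mul_nonneg (tsum_nonneg fun _ => norm_nonneg _) zero_le_two),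
    fun t ht => ?_⟩
  have ht0 : 0 < t := by linarith
  have ht2 : t⁻¹ ≤ 2 := by
    rw [inv_le_comm₀ ht0 two_pos]
    linarith
  rw [vonMangoldtMean_of_half_le ha.ne' ht, zero_sub]
  refine (norm_add_le _ _).trans (add_le_add ?_ ?_)
  · rw [norm_neg, norm_real, Real.norm_of_nonneg (by positivity)]
    gcongr
  · refine tsum_of_norm_bounded ((summable_norm_zeroCoeff ha).hasSum.mul_right 2) fun ρ => ?_
    exact (norm_zeroCoeff_mul_cpow_neg_le ht0 ρ).trans (mul_le_mul_of_nonneg_left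
      (max_le one_le_two ht2) (norm_nonneg _))

theorem abs_inv_div_mul_cesaroKernel_sub_one_le_one {a : ℝ} (ha : 1 ≤ a) {t : ℝ} (ht : 0 < t)
    (ht1 : t ≤ 1) : |t⁻¹ / a * (cesaroKernel (a + 1) t - 1)| ≤ 1 := by
  have ha0 : 0 < a := one_pos.trans_le ha
  have hbernoulli : 1 - a * t ≤ (1 - t) ^ a := by
    simpa [sub_eq_add_neg] using one_add_mul_self_le_rpow_one_add (s := -t) (by linarith) ha
  have hle : (1 - t) ^ a ≤ 1 := Real.rpow_le_one (by linarith) (by linarith) ha0.le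
  rw [cesaroKernel_of_le_one ht1, add_sub_cancel_right, abs_mul, abs_of_pos (by positivity),
    abs_of_nonpos (by linarith)]
  calc t⁻¹ / a * -((1 - t) ^ a - 1) ≤ t⁻¹ / a * (a * t) := by
        gcongr
        linarith
    _ = 1 := by field_simp

theorem norm_zeroCoeff_mul_sub_zeroKernel_le {a : ℝ} (ha : 1 < a) {ρ : ℂ} (hρ : ρ ∈ zetaZeros)
    {t : ℝ} (ht : 0 < t) (ht2 : t ≤ 1 / 2) :
    ‖zeroCoeff a ρ * (t : ℂ) ^ (-ρ) - ((a : ℂ) - 1) *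
        ((analyticOrderNatAt riemannZeta₁ ρ : ℂ) / ρ * zeroKernel (a - 1) ρ t)‖
      ≤ (a - 1) * (4 * max 1 ((1 / 2) ^ (a - 1 - 1))) * zeroWeight (min 1 (a - 1)) ρ := by
  have hc : 0 < a - 1 := sub_pos.2 ha
  have h1 : 1 ≤ ‖ρ + 1‖ :=
    one_le_norm_add_one_of_riemannZeta₁_eq_zero (riemannZeta₁_eq_zero_of_mem_zetaZeros hρ)
  have heq : zeroCoeff a ρ * (t : ℂ) ^ (-ρ) - ((a : ℂ) - 1) *
      ((analyticOrderNatAt riemannZeta₁ ρ : ℂ) / ρ * zeroKernel (a - 1) ρ t) =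
      ((a : ℂ) - 1) * ((analyticOrderNatAt riemannZeta₁ ρ : ℂ) / ρ *
        ((t : ℂ) ^ (-ρ) * (incBeta (a - 1) ρ 0 - incBeta (a - 1) ρ t))) := by
    rw [zeroCoeff_eq_incBeta ha hρ, zeroKernel_of_le_one (by linarith)]
    ring
  have hpow : ‖ρ + 1‖⁻¹ ≤ ‖ρ + 1‖ ^ (-min 1 (a - 1)) := by
    rw [← Real.rpow_neg_one]
    exact Real.rpow_le_rpow_of_exponent_le h1 (neg_le_neg (min_le_left _ _))
  rw [heq, norm_mul, norm_mul, norm_ofReal_sub_one ha.le, zeroWeight, mul_assoc (a - 1)]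
  refine mul_le_mul_of_nonneg_left ?_ hc.le
  rw [mul_left_comm]
  gcongr
  refine (norm_cpow_mul_incBeta_sub_le hc hρ.2.1.le ht ht2).trans ?_
  rw [div_eq_mul_inv]
  gcongr

theorem norm_indicator_zetaZeros_sub_zeroKernel_le {a : ℝ} (ha : 1 < a) {z : ℂ}
    (hz : riemannZeta₁ z = 0) {t : ℝ} (ht : 0 < t) (ht2 : t ≤ 1 / 2) :
    ‖zetaZeros.indicator (fun ρ => zeroCoeff a ρ * (t : ℂ) ^ (-ρ)) z - ((a : ℂ) - 1) *
        ((analyticOrderNatAt riemannZeta₁ z : ℂ) / z * zeroKernel (a - 1) z t)‖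
      ≤ (a - 1) * max (4 * max 1 ((1 / 2) ^ (a - 1 - 1))) (4 + 1 / (a - 1))
        * zeroWeight (min 1 (a - 1)) z := by
  have hc : 0 < a - 1 := sub_pos.2 ha
  have hw : 0 ≤ zeroWeight (min 1 (a - 1)) z := by unfold zeroWeight; positivity
  by_cases hmem : z ∈ zetaZeros
  · rw [Set.indicator_of_mem hmem]
    refine (norm_zeroCoeff_mul_sub_zeroKernel_le ha hmem ht ht2).trans ?_
    gcongr
    exact le_max_left _ _
  · have hre : z.re ≤ 0 := by
      linarith [((mem_zetaZeros_or_of_riemannZeta₁_eq_zero hz).resolve_left hmem).2]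
    have hle := norm_div_mul_zeroKernel_le hc le_rfl hz hre ht
    rw [neg_zero, Real.rpow_zero, mul_one] at hle
    rw [Set.indicator_of_notMem hmem, zero_sub, norm_neg, norm_mul, norm_ofReal_sub_one ha.le,
      mul_assoc]
    refine mul_le_mul_of_nonneg_left (hle.trans ?_) hc.le
    gcongr
    exact le_max_right _ _

theorem hasSum_indicator_zetaZeros {a : ℝ} (ha : 1 < a) {t : ℝ} (ht : 0 < t) :
    HasSum (fun z : {z // riemannZeta₁ z = 0} =>
        zetaZeros.indicator (fun ρ => zeroCoeff a ρ * (t : ℂ) ^ (-ρ)) z)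
      (∑' ρ : zetaZeros, zeroCoeff a ρ * (t : ℂ) ^ (-(ρ : ℂ))) := by
  have hsum : Summable fun ρ : zetaZeros => zeroCoeff a ρ * (t : ℂ) ^ (-(ρ : ℂ)) :=
    .of_norm_bounded ((summable_norm_zeroCoeff ha).mul_right _)
      fun ρ => norm_zeroCoeff_mul_cpow_neg_le ht ρ
  exact (hasSum_subtype_iff_of_support_subset (s := {z | riemannZeta₁ z = 0})
    (Set.support_indicator_subset.trans fun _ => riemannZeta₁_eq_zero_of_mem_zetaZeros)).2
    ((hasSum_subtype_iff_indicator (s := zetaZeros)).1 hsum.hasSum)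

theorem exists_norm_zeroSum_sub_zeroMean_le {a : ℝ} (ha : 1 < a) :
    ∃ C : ℝ, ∀ t : ℝ, 0 < t → t ≤ 1 / 2 →
      ‖∑' ρ : zetaZeros, zeroCoeff a ρ * (t : ℂ) ^ (-(ρ : ℂ))
        - ((a : ℂ) - 1) * zeroMean (a - 1) t‖ ≤ C := by
  have hc : 0 < a - 1 := sub_pos.2 ha
  have hweight := summable_subtype_zeroWeight hc (riemannZeta₁ · = 0)
  refine ⟨(a - 1) * max (4 * max 1 ((1 / 2) ^ (a - 1 - 1))) (4 + 1 / (a - 1))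
    * ∑' z : {z // riemannZeta₁ z = 0}, zeroWeight (min 1 (a - 1)) z, fun t ht ht2 => ?_⟩
  have hker : Summable fun z : {z // riemannZeta₁ z = 0} =>
      (analyticOrderNatAt riemannZeta₁ z : ℂ) / z * zeroKernel (a - 1) z t :=
    .of_norm_bounded ((hweight.mul_left _).mul_right _) fun z =>
      norm_div_mul_zeroKernel_le hc zero_le_one z.2 (re_lt_one_of_riemannZeta₁_eq_zero z.2).le ht
  exact ((hasSum_indicator_zetaZeros ha ht).sub (hker.hasSum.mul_left _)).norm_le_of_bounded
    (hweight.hasSum.mul_left _)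
    fun z => norm_indicator_zetaZeros_sub_zeroKernel_le ha z.2 ht ht2

theorem exists_norm_vonMangoldtMean_sub_le {a : ℝ} (ha : 1 < a) :
    ∃ C : ℝ, 0 ≤ C ∧ ∀ t : ℝ, 0 < t → ‖vonMangoldtMean a t - ((t⁻¹ / a : ℝ) : ℂ)
      + ∑' ρ : zetaZeros, zeroCoeff a ρ * (t : ℂ) ^ (-(ρ : ℂ))‖ ≤ C := by
  obtain ⟨C₁, hC₁0, hC₁⟩ := exists_norm_vonMangoldtMean_sub_le_of_half_le ha
  obtain ⟨C₂, hC₂⟩ := exists_norm_zeroSum_sub_zeroMean_le ha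
  refine ⟨max C₁ (1 + ‖logDeriv riemannZeta₁ 0‖ + C₂), le_max_of_le_left hC₁0, fun t ht => ?_⟩
  rcases le_total (1 / 2) t with h2 | h2
  · exact (hC₁ t h2).trans (le_max_left _ _)
  refine le_trans ?_ (le_max_right _ _)
  set S := ∑' ρ : zetaZeros, zeroCoeff a ρ * (t : ℂ) ^ (-(ρ : ℂ))
  have hsplit : vonMangoldtMean a t - ((t⁻¹ / a : ℝ) : ℂ) + S
      = ((t⁻¹ / a * (cesaroKernel (a + 1) t - 1) : ℝ) : ℂ)
        - logDeriv riemannZeta₁ 0 * cesaroKernel a t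
        + (S - ((a : ℂ) - 1) * zeroMean (a - 1) t) := by
    rw [vonMangoldtMean_eq ha ht, cpow_neg_one]
    push_cast
    ring
  have hpole : ‖((t⁻¹ / a * (cesaroKernel (a + 1) t - 1) : ℝ) : ℂ)‖ ≤ 1 := by
    rw [norm_real, Real.norm_eq_abs]
    exact abs_inv_div_mul_cesaroKernel_sub_one_le_one ha.le ht (by linarith)
  have hconst : ‖logDeriv riemannZeta₁ 0 * (cesaroKernel a t : ℂ)‖
      ≤ ‖logDeriv riemannZeta₁ 0‖ := by
    rw [norm_mul, norm_real, Real.norm_of_nonneg (cesaroKernel_nonneg _ _)]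
    exact mul_le_of_le_one_right (norm_nonneg _) (cesaroKernel_le_one ha.le ht.le)
  rw [hsplit]
  exact (norm_add_le _ _).trans (add_le_add ((norm_sub_le _ _).trans
    (add_le_add hpole hconst)) (hC₂ t ht h2))

/-! ### Convolutions of power sums and Riesz means -/

/-- The sum `∑ i, g i * x ^ w i` of complex powers of a real variable; the main term and the
contribution of the zeros in the explicit formula are both of this form. -/
noncomputable def powSum {ι : Type*} (g w : ι → ℂ) (x : ℝ) : ℂ := ∑' i, g i * (x : ℂ) ^ w i

theorem norm_ofReal_cpow_le {x X A : ℝ} {w : ℂ} (hx : x ∈ Set.Icc 0 X) (hX : 1 ≤ X)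
    (hw : 0 < w.re) (hwA : w.re ≤ A) : ‖(x : ℂ) ^ w‖ ≤ X ^ A := by
  rw [norm_cpow_eq_rpow_re_of_nonneg hx.1 hw.ne']
  exact (Real.rpow_le_rpow hx.1 hx.2 hw.le).trans (Real.rpow_le_rpow_of_exponent_le hX hwA)

theorem integral_cpow_mul_sub_cpow (u v : ℂ) {X : ℝ} (hX : 0 < X) :
    ∫ x in (0 : ℝ)..X, (x : ℂ) ^ u * ((X - x : ℝ) : ℂ) ^ v
      = (X : ℂ) ^ (u + v + 1) * betaIntegral (u + 1) (v + 1) := by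
  have h := betaIntegral_scaled (u + 1) (v + 1) hX
  rw [show u + 1 + (v + 1) - 1 = u + v + 1 by ring] at h
  simpa only [add_sub_cancel_right, ofReal_sub] using h

theorem sub_mem_Icc_zero {x X : ℝ} (hx : x ∈ Set.Icc 0 X) : X - x ∈ Set.Icc 0 X :=
  ⟨sub_nonneg.2 hx.2, sub_le_self _ hx.1⟩

section PowSum

variable {ι κ : Type*} {g w : ι → ℂ} {h v : κ → ℂ} {X A : ℝ}

theorem norm_mul_ofReal_cpow_le (hw : ∀ i, 0 < (w i).re) (hwA : ∀ i, (w i).re ≤ A)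
    (hX : 1 ≤ X) {x : ℝ} (hx : x ∈ Set.Icc 0 X) (i : ι) :
    ‖g i * (x : ℂ) ^ w i‖ ≤ ‖g i‖ * X ^ A := by
  rw [norm_mul]
  exact mul_le_mul_of_nonneg_left (norm_ofReal_cpow_le hx hX (hw i) (hwA i)) (norm_nonneg _)

theorem summable_norm_mul_ofReal_cpow (hg : Summable fun i => ‖g i‖) (hw : ∀ i, 0 < (w i).re)
    (hwA : ∀ i, (w i).re ≤ A) (hX : 1 ≤ X) {x : ℝ} (hx : x ∈ Set.Icc 0 X) :
    Summable fun i => ‖g i * (x : ℂ) ^ w i‖ :=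
  .of_nonneg_of_le (fun _ => norm_nonneg _) (norm_mul_ofReal_cpow_le hw hwA hX hx)
    (hg.mul_right _)

theorem continuousOn_powSum (hg : Summable fun i => ‖g i‖) (hw : ∀ i, 0 < (w i).re)
    (hwA : ∀ i, (w i).re ≤ A) (hX : 1 ≤ X) : ContinuousOn (powSum g w) (Set.Icc 0 X) :=
  continuousOn_tsum
    (fun i => (continuous_const.mul (continuous_ofReal_cpow_const (hw i))).continuousOn)
    (hg.mul_right (X ^ A)) fun i _ hx => norm_mul_ofReal_cpow_le hw hwA hX hx i

theorem powSum_zero (hw : ∀ i, 0 < (w i).re) : powSum g w 0 = 0 := by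
  simp [powSum, zero_cpow (ne_zero_of_re_pos (hw _))]

theorem hasSum_convolution_powSum [Countable ι] [Countable κ] (hg : Summable fun i => ‖g i‖)
    (hw : ∀ i, 0 < (w i).re) (hwA : ∀ i, (w i).re ≤ A) (hh : Summable fun j => ‖h j‖)
    (hv : ∀ j, 0 < (v j).re) (hvA : ∀ j, (v j).re ≤ A) (hX : 1 ≤ X) :
    HasSum (fun p : ι × κ => g p.1 * h p.2 *
        ((X : ℂ) ^ (w p.1 + v p.2 + 1) * betaIntegral (w p.1 + 1) (v p.2 + 1)))
      (∫ x in (0 : ℝ)..X, powSum g w x * powSum h v (X - x)) := by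
  have hX0 : 0 < X := one_pos.trans_le hX
  have hmem : ∀ x ∈ Set.uIoc 0 X, x ∈ Set.Icc 0 X := fun x hx =>
    Set.Ioc_subset_Icc_self (Set.uIoc_of_le hX0.le ▸ hx)
  have hsum := hasSum_integral_of_dominated_convergence (μ := volume) (a := 0) (b := X)
    (F := fun (p : ι × κ) (x : ℝ) =>
      (g p.1 * (x : ℂ) ^ w p.1) * (h p.2 * ((X - x : ℝ) : ℂ) ^ v p.2))
    (f := fun x => powSum g w x * powSum h v (X - x))
    (fun p _ => (‖g p.1‖ * X ^ A) * (‖h p.2‖ * X ^ A)) ?_ ?_ ?_ intervalIntegrable_const ?_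
  · refine hsum.congr_fun fun p => ?_
    simp_rw [mul_mul_mul_comm (g p.1)]
    rw [intervalIntegral.integral_const_mul, integral_cpow_mul_sub_cpow _ _ hX0]
  · intro p
    exact ((continuous_const.mul (continuous_ofReal_cpow_const (hw _))).mul
      (continuous_const.mul ((continuous_ofReal_cpow_const (hv _)).comp
        (continuous_const.sub continuous_id)))).aestronglyMeasurable
  · refine fun p => ae_of_all _ fun x hx => ?_
    rw [norm_mul]
    exact mul_le_mul (norm_mul_ofReal_cpow_le hw hwA hX (hmem x hx) _)
      (norm_mul_ofReal_cpow_le hv hvA hX (sub_mem_Icc_zero (hmem x hx)) _) (norm_nonneg _)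
      (by positivity)
  · exact ae_of_all _ fun x _ => (hg.mul_right _).mul_of_nonneg (hh.mul_right _)
      (fun _ => by positivity) (fun _ => by positivity)
  · refine ae_of_all _ fun x hx => ?_
    have hgx := summable_norm_mul_ofReal_cpow (g := g) hg hw hwA hX (hmem x hx)
    have hhx := summable_norm_mul_ofReal_cpow (g := h) hh hv hvA hX (sub_mem_Icc_zero (hmem x hx))
    have hprod := summable_mul_of_summable_norm (f := fun i => g i * (x : ℂ) ^ w i)
      (g := fun j => h j * ((X - x : ℝ) : ℂ) ^ v j) hgx hhx
    exact HasSum.mul (f := fun i => g i * (x : ℂ) ^ w i)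
      (g := fun j => h j * ((X - x : ℝ) : ℂ) ^ v j) hgx.of_norm.hasSum hhx.of_norm.hasSum hprod

end PowSum

/-- The truncated power `x ↦ x₊ ^ c`. -/
noncomputable def truncPow (c x : ℝ) : ℝ := max x 0 ^ c

theorem continuous_truncPow {c : ℝ} (hc : 0 ≤ c) : Continuous (truncPow c) :=
  (continuous_id.max continuous_const).rpow_const fun _ => .inr hc

theorem truncPow_of_nonneg (c : ℝ) {x : ℝ} (hx : 0 ≤ x) : truncPow c x = x ^ c := by
  rw [truncPow, max_eq_left hx]

theorem truncPow_of_nonpos {c x : ℝ} (hc : c ≠ 0) (hx : x ≤ 0) : truncPow c x = 0 := by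
  rw [truncPow, max_eq_right hx, Real.zero_rpow hc]

theorem truncPow_nonneg (c x : ℝ) : 0 ≤ truncPow c x :=
  Real.rpow_nonneg (le_max_right _ _) _

theorem support_truncPow_mul_truncPow_subset {c : ℝ} (hc : c ≠ 0) (p q X : ℝ) :
    Function.support (fun x => ((truncPow c (x - p) * truncPow c (X - x - q) : ℝ) : ℂ))
      ⊆ Set.Ioo p (X - q) := by
  intro x hx
  constructor <;> by_contra! h <;> apply hx
  · simp [truncPow_of_nonpos hc (show x - p ≤ 0 by linarith)]
  · simp [truncPow_of_nonpos hc (show X - x - q ≤ 0 by linarith)]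

theorem integral_truncPow_mul_truncPow {a : ℝ} (ha : 1 < a) {p q X : ℝ} (hp : 0 ≤ p)
    (hq : 0 ≤ q) :
    ∫ x in (0 : ℝ)..X, ((truncPow (a - 1) (x - p) * truncPow (a - 1) (X - x - q) : ℝ) : ℂ)
      = truncPow (2 * a - 1) (X - p - q) * betaIntegral a a := by
  have hsupp := support_truncPow_mul_truncPow_subset (sub_pos.2 ha).ne' p q X
  rcases le_or_gt (X - p - q) 0 with hL | hL
  · rw [Set.Ioo_eq_empty (by linarith), Set.subset_empty_iff, Function.support_eq_empty_iff]
      at hsupp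
    rw [hsupp, truncPow_of_nonpos (by linarith) hL, ofReal_zero, zero_mul]
    exact intervalIntegral.integral_zero
  have hIoc := hsupp.trans Set.Ioo_subset_Ioc_self
  rw [integral_eq_integral_of_support_subset
      (hIoc.trans (Set.Ioc_subset_Ioc hp (sub_le_self _ hq))),
    ← integral_eq_integral_of_support_subset hIoc]
  have hshift := integral_comp_add_right (a := 0) (b := X - p - q)
    (fun x => ((truncPow (a - 1) (x - p) * truncPow (a - 1) (X - x - q) : ℝ) : ℂ)) p
  rw [zero_add, show X - p - q + p = X - q by ring] at hshift
  have hbeta := integral_cpow_mul_sub_cpow ((a : ℂ) - 1) ((a : ℂ) - 1) hL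
  rw [← hshift, truncPow_of_nonneg _ hL.le, ofReal_cpow hL.le,
    show ((2 * a - 1 : ℝ) : ℂ) = (a : ℂ) - 1 + (a - 1) + 1 by push_cast; ring]
  rw [sub_add_cancel (a : ℂ) 1] at hbeta
  rw [← hbeta]
  refine integral_congr fun x hx => ?_
  rw [Set.uIcc_of_le hL.le] at hx
  have hx' := sub_mem_Icc_zero hx
  simp only [add_sub_cancel_right]
  rw [show X - (x + p) - q = X - p - q - x by ring, truncPow_of_nonneg _ hx.1,
    truncPow_of_nonneg _ hx'.1, ofReal_mul, ofReal_cpow hx.1, ofReal_cpow hx'.1, ofReal_sub,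
    ofReal_one]

/-- The Riesz mean `∑ n ≤ x, Λ n * (x - n) ^ (a - 1)` of the von Mangoldt function, for `x ≤ N`;
the range of summation is fixed to make it a finite sum of continuous functions of `x`. -/
noncomputable def rieszSum (a : ℝ) (N : ℕ) (x : ℝ) : ℝ :=
  ∑ n ∈ Finset.range (N + 1), ArithmeticFunction.vonMangoldt n * truncPow (a - 1) (x - n)

section RieszSum

variable {a : ℝ}

theorem continuous_rieszSum (ha : 1 ≤ a) (N : ℕ) : Continuous (rieszSum a N) :=
  continuous_finsetSum _ fun _ _ => continuous_const.mul
    ((continuous_truncPow (sub_nonneg.2 ha)).comp (continuous_id.sub continuous_const))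

theorem rieszSum_zero (ha : a ≠ 1) (N : ℕ) : rieszSum a N 0 = 0 :=
  Finset.sum_eq_zero fun n _ => by
    rw [truncPow_of_nonpos (sub_ne_zero.2 ha) (by simp), mul_zero]

theorem norm_rieszSum_le (ha : 1 ≤ a) {N : ℕ} {x : ℝ} (hx : x ≤ N) :
    ‖(rieszSum a N x : ℂ)‖ ≤ (Real.log 4 + 4) * N * (N : ℝ) ^ (a - 1) := by
  have hN : (0 : ℝ) ≤ N := N.cast_nonneg
  rw [norm_real, rieszSum, Real.norm_of_nonneg (Finset.sum_nonneg fun _ _ =>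
    mul_nonneg ArithmeticFunction.vonMangoldt_nonneg (truncPow_nonneg _ _))]
  calc ∑ n ∈ Finset.range (N + 1), ArithmeticFunction.vonMangoldt n * truncPow (a - 1) (x - n)
      ≤ ∑ n ∈ Finset.range (N + 1), ArithmeticFunction.vonMangoldt n * (N : ℝ) ^ (a - 1) := by
        refine Finset.sum_le_sum fun n _ => mul_le_mul_of_nonneg_left ?_
          ArithmeticFunction.vonMangoldt_nonneg
        have hxn : x - n ≤ N := (sub_le_self _ n.cast_nonneg).trans hx
        exact Real.rpow_le_rpow (le_max_right _ _) (max_le hxn hN) (sub_nonneg.2 ha)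
    _ = Chebyshev.psi N * (N : ℝ) ^ (a - 1) := by
        rw [Chebyshev.psi_eq_sum_Icc, Nat.floor_natCast, ← Finset.sum_mul,
          Nat.range_succ_eq_Icc_zero]
    _ ≤ _ := mul_le_mul_of_nonneg_right (Chebyshev.psi_le_const_mul_self hN) (by positivity)

theorem rieszSum_eq_vonMangoldtMean (ha : a ≠ 1) {N : ℕ} {x : ℝ} (hx : 0 < x) (hxN : x ≤ N) :
    (rieszSum a N x : ℂ) = ((x ^ (a - 1) : ℝ) : ℂ) * vonMangoldtMean a x⁻¹ := by
  rw [vonMangoldtMean, ← ofReal_tsum, ← ofReal_mul, tsum_eq_sum (s := Finset.range (N + 1)),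
    rieszSum, Finset.mul_sum]
  · congr 1
    refine Finset.sum_congr rfl fun n _ => ?_
    rw [cesaroKernel, mul_left_comm, ← Real.mul_rpow hx.le (le_max_right _ _),
      mul_max_of_nonneg _ _ hx.le, mul_zero, mul_sub, mul_one, mul_left_comm,
      mul_inv_cancel₀ hx.ne', mul_one, truncPow]
  · intro n hn
    have hnN : (N : ℝ) ≤ n := by
      exact_mod_cast (not_lt.1 (Finset.mem_range.not.1 hn)).trans' (Nat.le_succ N)
    rw [cesaroKernel_of_one_le ha, mul_zero]
    rw [← div_eq_mul_inv, one_le_div₀ hx]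
    exact hxN.trans hnN

theorem sum_range_vonMangoldt_mul_truncPow {c : ℝ} (hc : c ≠ 0) (N : ℕ) :
    ∑ p ∈ Finset.range (N + 1) ×ˢ Finset.range (N + 1), ArithmeticFunction.vonMangoldt p.1 *
        ArithmeticFunction.vonMangoldt p.2 * truncPow c (N - p.1 - p.2)
      = ∑ n ∈ Finset.Icc 1 N, goldbachR n * ((N : ℝ) - n) ^ c := by
  have hfiber : ∀ n ∈ Finset.range (N + 1),
      ((Finset.range (N + 1) ×ˢ Finset.range (N + 1)).filter fun p => p.1 + p.2 = n)
        = Finset.HasAntidiagonal.antidiagonal n := fun n hn => by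
    ext p
    simp only [Finset.mem_filter, Finset.mem_product, Finset.mem_range,
      Finset.HasAntidiagonal.mem_antidiagonal] at hn ⊢
    omega
  rw [← Finset.sum_filter_of_ne (p := fun p => p.1 + p.2 ∈ Finset.range (N + 1)),
    ← Finset.sum_fiberwise_eq_sum_filter, Finset.range_eq_Ico, Finset.sum_eq_sum_Ico_succ_bot
      N.succ_pos, ← Finset.range_eq_Ico]
  · rw [hfiber 0 (by simp)]
    simp only [Finset.Nat.antidiagonal_zero, Finset.sum_singleton, ArithmeticFunction.map_zero,
      zero_mul, zero_add]
    refine Finset.sum_congr (by ext; simp) fun n hn => ?_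
    have hnN : n ≤ N := (Finset.mem_Icc.1 hn).2
    rw [hfiber n (Finset.mem_range_succ_iff.2 hnN), goldbachR, Finset.sum_mul]
    refine Finset.sum_congr rfl fun p hp => ?_
    rw [← Finset.HasAntidiagonal.mem_antidiagonal.1 hp] at hnN ⊢
    rw [sub_sub, ← Nat.cast_add, truncPow_of_nonneg _ (sub_nonneg.2 (Nat.cast_le.2 hnN))]
  · intro p _ hp
    by_contra hlt
    refine hp ?_
    have hle : (N : ℝ) ≤ p.1 + p.2 := by
      exact_mod_cast (not_lt.1 (Finset.mem_range.not.1 hlt)).trans' N.le_succ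
    rw [truncPow_of_nonpos hc (by linarith), mul_zero]

theorem integral_rieszSum_mul_rieszSum (ha : 1 < a) (N : ℕ) :
    ∫ x in (0 : ℝ)..N, (rieszSum a N x : ℂ) * (rieszSum a N (N - x) : ℂ)
      = ((∑ n ∈ Finset.Icc 1 N, goldbachR n * ((N : ℝ) - n) ^ (2 * a - 1) : ℝ) : ℂ)
        * betaIntegral a a := by
  have hcont := continuous_truncPow (sub_pos.2 ha).le
  have hexpand : ∀ x : ℝ, (rieszSum a N x : ℂ) * (rieszSum a N (N - x) : ℂ)
      = ∑ p ∈ Finset.range (N + 1) ×ˢ Finset.range (N + 1),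
        ((ArithmeticFunction.vonMangoldt p.1 * ArithmeticFunction.vonMangoldt p.2 : ℝ) : ℂ) *
        ((truncPow (a - 1) (x - p.1) * truncPow (a - 1) (N - x - p.2) : ℝ) : ℂ) := fun x => by
    rw [← ofReal_mul, rieszSum, rieszSum, Finset.sum_mul_sum, ← Finset.sum_product', ofReal_sum]
    exact Finset.sum_congr rfl fun p _ => by rw [← ofReal_mul, mul_mul_mul_comm]
  simp only [hexpand]
  rw [intervalIntegral.integral_finsetSum, ← sum_range_vonMangoldt_mul_truncPow (by linarith),
    ofReal_sum, Finset.sum_mul]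
  · refine Finset.sum_congr rfl fun p _ => ?_
    rw [intervalIntegral.integral_const_mul,
      integral_truncPow_mul_truncPow ha (Nat.cast_nonneg _) (Nat.cast_nonneg _), ← mul_assoc,
      ← ofReal_mul]
  · exact fun p _ => (continuous_const.mul (continuous_ofReal.comp
      ((hcont.comp (continuous_id.sub continuous_const)).mul (hcont.comp
        ((continuous_const.sub continuous_id).sub continuous_const))))).intervalIntegrable _ _

end RieszSum

/-! ### Expansion of the Goldbach means -/

theorem betaIntegral_eq_Gamma_div {s t : ℂ} (hs : 0 < s.re) (ht : 0 < t.re) :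
    betaIntegral s t = Gamma s * Gamma t / Gamma (s + t) := by
  rw [Gamma_mul_Gamma_eq_betaIntegral hs ht,
    mul_div_cancel_left₀ _ (Gamma_ne_zero_of_re_pos (by rw [add_re]; positivity))]

/-- The main term `x ^ a / a` of `rieszSum a N x`. -/
noncomputable def mainPart (a : ℝ) : ℝ → ℂ :=
  powSum (fun _ : Unit => 1 / (a : ℂ)) (fun _ => (a : ℂ))

/-- The contribution of the non-trivial zeros to `rieszSum a N x`, up to sign. -/
noncomputable def zeroPart (a : ℝ) : ℝ → ℂ :=
  powSum (fun ρ : zetaZeros => zeroCoeff a ρ) (fun ρ => (ρ : ℂ) + a - 1)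

/-- The explicit formula for `rieszSum a N x` without its error term. -/
noncomputable def rieszExpansion (a x : ℝ) : ℂ := mainPart a x - zeroPart a x

/-- The expansion of `goldbachCesaro k N` without its error term. -/
noncomputable def goldbachExpansion (k : ℝ) (N : ℕ) : ℂ :=
  (N : ℂ) ^ 2 / Gamma ((k : ℂ) + 3) - 2 * ∑' ρ : zetaZeros, singleTerm k N ρ
    + ∑' ρ₁ : zetaZeros, ∑' ρ₂ : zetaZeros, doubleTerm k N ρ₁ ρ₂

section RieszExpansion

variable {a : ℝ}

theorem re_zero_exponent_pos (ha : 1 ≤ a) (ρ : zetaZeros) : 0 < ((ρ : ℂ) + a - 1).re := by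
  have := ρ.2.2.1
  simp only [sub_re, add_re, ofReal_re, one_re]
  linarith

theorem re_zero_exponent_le (ρ : zetaZeros) : ((ρ : ℂ) + a - 1).re ≤ a := by
  have := ρ.2.2.2
  simp only [sub_re, add_re, ofReal_re, one_re]
  linarith

theorem rieszExpansion_zero (ha : 1 ≤ a) : rieszExpansion a 0 = 0 := by
  rw [rieszExpansion, mainPart, zeroPart, powSum_zero fun _ => one_pos.trans_le ha,
    powSum_zero (re_zero_exponent_pos ha), sub_zero]

theorem mainPart_eq {x : ℝ} (hx : 0 < x) :
    mainPart a x = ((x ^ (a - 1) : ℝ) : ℂ) * (((x⁻¹)⁻¹ / a : ℝ) : ℂ) := by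
  rw [mainPart, powSum, tsum_fintype, Finset.univ_unique, Finset.sum_singleton, inv_inv,
    ← ofReal_cpow hx.le, Real.rpow_sub_one hx.ne']
  have hxc : (x : ℂ) ≠ 0 := ofReal_ne_zero.2 hx.ne'
  push_cast
  field_simp

theorem zeroPart_eq {x : ℝ} (hx : 0 < x) :
    zeroPart a x = ((x ^ (a - 1) : ℝ) : ℂ) *
      ∑' ρ : zetaZeros, zeroCoeff a ρ * ((x⁻¹ : ℝ) : ℂ) ^ (-(ρ : ℂ)) := by
  rw [zeroPart, powSum, ← tsum_mul_left]
  refine tsum_congr fun ρ => ?_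
  rw [ofReal_inv, inv_cpow _ _ (by rw [arg_ofReal_of_nonneg hx.le]; exact Real.pi_ne_zero.symm),
    cpow_neg, inv_inv, ofReal_cpow hx.le, add_sub_assoc, cpow_add _ _ (ofReal_ne_zero.2 hx.ne')]
  push_cast
  ring

theorem exists_norm_rieszSum_sub_rieszExpansion_le (ha : 1 < a) :
    ∃ C : ℝ, ∀ N : ℕ, ∀ x ∈ Set.Icc (0 : ℝ) N,
      ‖(rieszSum a N x : ℂ) - rieszExpansion a x‖ ≤ C * (N : ℝ) ^ (a - 1) := by
  obtain ⟨C, hC0, hC⟩ := exists_norm_vonMangoldtMean_sub_le ha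
  refine ⟨C, fun N x hx => ?_⟩
  rcases hx.1.eq_or_lt with rfl | hx0
  · rw [rieszSum_zero ha.ne', rieszExpansion_zero ha.le, ofReal_zero, sub_zero, norm_zero]
    positivity
  rw [rieszSum_eq_vonMangoldtMean ha.ne' hx0 hx.2, rieszExpansion, mainPart_eq hx0,
    zeroPart_eq hx0, ← mul_sub, ← mul_sub, ← sub_add, norm_mul, norm_real,
    Real.norm_of_nonneg (by positivity), mul_comm C]
  exact mul_le_mul (Real.rpow_le_rpow hx0.le hx.2 (sub_pos.2 ha).le) (hC _ (inv_pos.2 hx0))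
    (norm_nonneg _) (by positivity)

theorem natCast_cpow_add_ofReal {N : ℕ} (hN : 1 ≤ N) (s : ℂ) (k : ℝ) :
    (N : ℂ) ^ (s + k) = (((N : ℝ) ^ k : ℝ) : ℂ) * (N : ℂ) ^ s := by
  rw [cpow_add _ _ (by exact_mod_cast Nat.one_le_iff_ne_zero.1 hN), ofReal_cpow N.cast_nonneg,
    ofReal_natCast, mul_comm]

theorem integral_mainPart_mul_mainPart (ha : 0 < a) {N : ℕ} (hN : 1 ≤ N) :
    ∫ x in (0 : ℝ)..N, mainPart a x * mainPart a (N - x)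
      = Gamma a ^ 2 * (((N : ℝ) ^ (2 * a - 1) : ℝ) : ℂ) *
        ((N : ℂ) ^ 2 / Gamma (((2 * a - 1 : ℝ) : ℂ) + 3)) := by
  have ha0 : (a : ℂ) ≠ 0 := ofReal_ne_zero.2 ha.ne'
  have hre1 : 0 < ((a : ℂ) + 1).re := by rw [add_re, one_re, ofReal_re]; positivity
  have h := (hasSum_convolution_powSum (ι := Unit) (κ := Unit) (g := fun _ => 1 / (a : ℂ))
    (w := fun _ => (a : ℂ)) (h := fun _ => 1 / (a : ℂ)) (v := fun _ => (a : ℂ)) (A := a) (X := N)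
    .of_finite (fun _ => ha) (fun _ => le_rfl) .of_finite (fun _ => ha) (fun _ => le_rfl)
    (by exact_mod_cast hN)).unique (hasSum_fintype _)
  simp only [Fintype.sum_prod_type, Finset.univ_unique, Finset.sum_singleton] at h
  unfold mainPart
  rw [h, betaIntegral_eq_Gamma_div hre1 hre1, Gamma_add_one _ ha0,
    show (a : ℂ) + a + 1 = (2 : ℕ) + ((2 * a - 1 : ℝ) : ℂ) by push_cast; ring,
    show (a : ℂ) + 1 + (a + 1) = ((2 * a - 1 : ℝ) : ℂ) + 3 by push_cast; ring, ofReal_natCast,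
    natCast_cpow_add_ofReal hN, cpow_natCast]
  field_simp

theorem hasSum_integral_mainPart_mul_zeroPart (ha : 1 < a) {N : ℕ} (hN : 1 ≤ N) :
    HasSum (fun ρ : zetaZeros => Gamma a ^ 2 * (((N : ℝ) ^ (2 * a - 1) : ℝ) : ℂ) *
        singleTerm (2 * a - 1) N ρ)
      (∫ x in (0 : ℝ)..N, mainPart a x * zeroPart a (N - x)) := by
  have := countable_zetaZeros
  have hapos : 0 < a := one_pos.trans ha
  have ha0 : (a : ℂ) ≠ 0 := ofReal_ne_zero.2 hapos.ne'
  have hre1 : 0 < ((a : ℂ) + 1).re := by rw [add_re, one_re, ofReal_re]; positivity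
  have h := hasSum_convolution_powSum (ι := Unit) (g := fun _ => 1 / (a : ℂ))
    (w := fun _ => (a : ℂ)) (h := fun ρ : zetaZeros => zeroCoeff a ρ)
    (v := fun ρ => (ρ : ℂ) + a - 1) (A := a) (X := N)
    .of_finite (fun _ => hapos) (fun _ => le_rfl) (summable_norm_zeroCoeff ha)
    (re_zero_exponent_pos ha.le) re_zero_exponent_le (by exact_mod_cast hN)
  refine ((Equiv.uniqueProd zetaZeros Unit).symm.hasSum_iff.2 h).congr_fun fun ρ => ?_
  have hρa : 0 < ((ρ : ℂ) + a).re := add_pos ρ.2.2.1 hapos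
  have hG := Gamma_ne_zero_of_re_pos hρa
  simp only [Function.comp, Equiv.uniqueProd_symm_apply, singleTerm]
  rw [zeroCoeff, betaIntegral_eq_Gamma_div ρ.2.2.1 hapos, sub_add_cancel,
    betaIntegral_eq_Gamma_div hre1 hρa, Gamma_add_one _ ha0,
    show (a : ℂ) + ((ρ : ℂ) + a - 1) + 1 = ((ρ : ℂ) + 1) + ((2 * a - 1 : ℝ) : ℂ) by
      push_cast; ring,
    show (a : ℂ) + 1 + ((ρ : ℂ) + a) = (ρ : ℂ) + ((2 * a - 1 : ℝ) : ℂ) + 2 by push_cast; ring,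
    ofReal_natCast, natCast_cpow_add_ofReal hN]
  field_simp

theorem hasSum_integral_zeroPart_mul_zeroPart (ha : 1 < a) {N : ℕ} (hN : 1 ≤ N) :
    HasSum (fun p : zetaZeros × zetaZeros => Gamma a ^ 2 * (((N : ℝ) ^ (2 * a - 1) : ℝ) : ℂ) *
        doubleTerm (2 * a - 1) N p.1 p.2)
      (∫ x in (0 : ℝ)..N, zeroPart a x * zeroPart a (N - x)) := by
  have := countable_zetaZeros
  have hapos : 0 < a := one_pos.trans ha
  have h := hasSum_convolution_powSum (g := fun ρ : zetaZeros => zeroCoeff a ρ)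
    (w := fun ρ => (ρ : ℂ) + a - 1) (h := fun ρ : zetaZeros => zeroCoeff a ρ)
    (v := fun ρ => (ρ : ℂ) + a - 1) (A := a) (X := N) (summable_norm_zeroCoeff ha)
    (re_zero_exponent_pos ha.le) re_zero_exponent_le (summable_norm_zeroCoeff ha)
    (re_zero_exponent_pos ha.le) re_zero_exponent_le (by exact_mod_cast hN)
  refine h.congr_fun fun p => ?_
  have hρ : ∀ ρ : zetaZeros, 0 < ((ρ : ℂ) + a).re := fun ρ => add_pos ρ.2.2.1 hapos
  have hG₁ := Gamma_ne_zero_of_re_pos (hρ p.1)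
  have hG₂ := Gamma_ne_zero_of_re_pos (hρ p.2)
  simp only [doubleTerm, zeroCoeff]
  rw [betaIntegral_eq_Gamma_div p.1.2.2.1 hapos, betaIntegral_eq_Gamma_div p.2.2.2.1 hapos,
    sub_add_cancel, sub_add_cancel, betaIntegral_eq_Gamma_div (hρ _) (hρ _),
    show (p.1 : ℂ) + a - 1 + ((p.2 : ℂ) + a - 1) + 1
      = ((p.1 : ℂ) + p.2) + ((2 * a - 1 : ℝ) : ℂ) by push_cast; ring,
    show (p.1 : ℂ) + a + ((p.2 : ℂ) + a) = (p.1 : ℂ) + p.2 + ((2 * a - 1 : ℝ) : ℂ) + 1 by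
      push_cast; ring,
    ofReal_natCast, natCast_cpow_add_ofReal hN]
  field_simp

theorem Gamma_sq_mul_rpow_ne_zero (ha : 0 < a) {N : ℕ} (hN : 1 ≤ N) (c : ℝ) :
    Gamma a ^ 2 * (((N : ℝ) ^ c : ℝ) : ℂ) ≠ 0 := by
  have hN0 : (0 : ℝ) < N := by exact_mod_cast hN
  exact mul_ne_zero (pow_ne_zero _ (Gamma_ne_zero_of_re_pos ha))
    (ofReal_ne_zero.2 (Real.rpow_pos_of_pos hN0 _).ne')

theorem summable_singleTerm (ha : 1 < a) {N : ℕ} (hN : 1 ≤ N) :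
    Summable fun ρ : zetaZeros => singleTerm (2 * a - 1) N ρ :=
  (summable_mul_left_iff (Gamma_sq_mul_rpow_ne_zero (one_pos.trans ha) hN _)).1
    (hasSum_integral_mainPart_mul_zeroPart ha hN).summable

theorem summable_doubleTerm (ha : 1 < a) {N : ℕ} (hN : 1 ≤ N) :
    Summable fun p : zetaZeros × zetaZeros => doubleTerm (2 * a - 1) N p.1 p.2 :=
  (summable_mul_left_iff (Gamma_sq_mul_rpow_ne_zero (one_pos.trans ha) hN _)).1
    (hasSum_integral_zeroPart_mul_zeroPart ha hN).summable

end RieszExpansion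

section Convolution

variable {f g : ℝ → ℂ} {X : ℝ}

theorem integral_mul_comp_sub_comm (f g : ℝ → ℂ) (X : ℝ) :
    ∫ x in (0 : ℝ)..X, f x * g (X - x) = ∫ x in (0 : ℝ)..X, g x * f (X - x) := by
  have h := intervalIntegral.integral_comp_sub_left (a := 0) (b := X) (fun x => g x * f (X - x)) X
  simpa only [sub_sub_cancel, sub_zero, sub_self, mul_comm] using h

theorem intervalIntegrable_mul_comp_sub (hX : 0 ≤ X) (hf : ContinuousOn f (Set.Icc 0 X))
    (hg : ContinuousOn g (Set.Icc 0 X)) :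
    IntervalIntegrable (fun x => f x * g (X - x)) volume 0 X :=
  ContinuousOn.intervalIntegrable_of_Icc hX <| hf.mul <|
    hg.comp (continuous_const.sub continuous_id).continuousOn fun _ => sub_mem_Icc_zero

theorem integral_sub_mul_sub (hX : 0 ≤ X) (hf : ContinuousOn f (Set.Icc 0 X))
    (hg : ContinuousOn g (Set.Icc 0 X)) :
    ∫ x in (0 : ℝ)..X, (f x - g x) * (f (X - x) - g (X - x))
      = (∫ x in (0 : ℝ)..X, f x * f (X - x)) - 2 * (∫ x in (0 : ℝ)..X, f x * g (X - x))
        + ∫ x in (0 : ℝ)..X, g x * g (X - x) := by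
  have hff := intervalIntegrable_mul_comp_sub hX hf hf
  have hfg := intervalIntegrable_mul_comp_sub hX hf hg
  have hgf := intervalIntegrable_mul_comp_sub hX hg hf
  have hgg := intervalIntegrable_mul_comp_sub hX hg hg
  simp only [sub_mul, mul_sub]
  rw [intervalIntegral.integral_sub (hff.sub hgf) (hfg.sub hgg),
    intervalIntegral.integral_sub hff hgf, intervalIntegral.integral_sub hfg hgg,
    integral_mul_comp_sub_comm g f]
  ring

theorem norm_mul_sub_mul_le {p p' q q' : ℂ} {B E : ℝ} (hp : ‖p‖ ≤ B) (hp' : ‖p'‖ ≤ B)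
    (hq : ‖p - q‖ ≤ E) (hq' : ‖p' - q'‖ ≤ E) : ‖p * p' - q * q'‖ ≤ 2 * B * E + E ^ 2 := by
  have hB := (norm_nonneg _).trans hp
  have hE := (norm_nonneg _).trans hq
  calc ‖p * p' - q * q'‖ = ‖p * (p' - q') + (p - q) * p' - (p - q) * (p' - q')‖ := by ring_nf
    _ ≤ ‖p‖ * ‖p' - q'‖ + ‖p - q‖ * ‖p'‖ + ‖p - q‖ * ‖p' - q'‖ := by
        refine (norm_sub_le _ _).trans ?_
        rw [← norm_mul, ← norm_mul, ← norm_mul]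
        exact add_le_add_left (norm_add_le _ _) _
    _ ≤ B * E + E * B + E * E := by gcongr
    _ = _ := by ring

theorem norm_integral_mul_comp_sub_sub_le {B E : ℝ} (hX : 0 ≤ X)
    (hf : ContinuousOn f (Set.Icc 0 X)) (hg : ContinuousOn g (Set.Icc 0 X))
    (hB : ∀ x ∈ Set.Icc 0 X, ‖f x‖ ≤ B) (hE : ∀ x ∈ Set.Icc 0 X, ‖f x - g x‖ ≤ E) :
    ‖(∫ x in (0 : ℝ)..X, f x * f (X - x)) - ∫ x in (0 : ℝ)..X, g x * g (X - x)‖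
      ≤ (2 * B * E + E ^ 2) * X := by
  rw [← intervalIntegral.integral_sub (intervalIntegrable_mul_comp_sub hX hf hf)
    (intervalIntegrable_mul_comp_sub hX hg hg)]
  refine (intervalIntegral.norm_integral_le_of_norm_le_const fun x hx => ?_).trans_eq
    (by rw [sub_zero, abs_of_nonneg hX])
  have hx : x ∈ Set.Icc 0 X := Set.Ioc_subset_Icc_self (Set.uIoc_of_le hX ▸ hx)
  have hx' := sub_mem_Icc_zero hx
  exact norm_mul_sub_mul_le (hB x hx) (hB _ hx') (hE x hx) (hE _ hx')

end Convolution

section GoldbachExpansion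

variable {a : ℝ}

theorem continuousOn_mainPart (ha : 0 < a) {X : ℝ} (hX : 1 ≤ X) :
    ContinuousOn (mainPart a) (Set.Icc 0 X) :=
  continuousOn_powSum (A := a) .of_finite (fun _ => ha) (fun _ => le_rfl) hX

theorem continuousOn_zeroPart (ha : 1 < a) {X : ℝ} (hX : 1 ≤ X) :
    ContinuousOn (zeroPart a) (Set.Icc 0 X) :=
  continuousOn_powSum (summable_norm_zeroCoeff ha) (re_zero_exponent_pos ha.le)
    re_zero_exponent_le hX

theorem integral_rieszExpansion_mul_rieszExpansion (ha : 1 < a) {N : ℕ} (hN : 1 ≤ N) :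
    ∫ x in (0 : ℝ)..N, rieszExpansion a x * rieszExpansion a (N - x)
      = Gamma a ^ 2 * (((N : ℝ) ^ (2 * a - 1) : ℝ) : ℂ) * goldbachExpansion (2 * a - 1) N := by
  have hN1 : (1 : ℝ) ≤ N := by exact_mod_cast hN
  have hapos : 0 < a := one_pos.trans ha
  unfold rieszExpansion
  rw [integral_sub_mul_sub N.cast_nonneg (continuousOn_mainPart hapos hN1)
      (continuousOn_zeroPart ha hN1), integral_mainPart_mul_mainPart hapos hN,
    ← (hasSum_integral_mainPart_mul_zeroPart ha hN).tsum_eq,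
    ← (hasSum_integral_zeroPart_mul_zeroPart ha hN).tsum_eq, tsum_mul_left, tsum_mul_left,
    (summable_doubleTerm ha hN).tsum_prod, goldbachExpansion]
  ring

theorem sum_goldbachR_mul_rpow {k : ℝ} (hk : -1 < k) (N : ℕ) :
    ∑ n ∈ Finset.Icc 1 N, goldbachR n * ((N : ℝ) - n) ^ k
      = (N : ℝ) ^ k * goldbachCesaro k N * Real.Gamma (k + 1) := by
  have hG := (Real.Gamma_pos_of_pos (neg_lt_iff_pos_add.1 hk)).ne'
  rw [goldbachCesaro, Finset.mul_sum, Finset.sum_mul]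
  refine Finset.sum_congr rfl fun n hn => ?_
  obtain ⟨hn1, hnN⟩ := Finset.mem_Icc.1 hn
  have hN0 : (0 : ℝ) < N := by exact_mod_cast hn1.trans hnN
  have hnN : (n : ℝ) ≤ N := by exact_mod_cast hnN
  rw [show (N : ℝ) - n = N * (1 - n / N) by field_simp,
    Real.mul_rpow hN0.le (sub_nonneg.2 ((div_le_one hN0).2 hnN))]
  field_simp

theorem integral_rieszSum_eq_goldbachCesaro (ha : 1 < a) (N : ℕ) :
    ∫ x in (0 : ℝ)..N, (rieszSum a N x : ℂ) * (rieszSum a N (N - x) : ℂ)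
      = Gamma a ^ 2 * (((N : ℝ) ^ (2 * a - 1) : ℝ) : ℂ) * (goldbachCesaro (2 * a - 1) N : ℂ) := by
  have hapos : 0 < (a : ℂ).re := one_pos.trans ha
  have hG : (Real.Gamma (2 * a - 1 + 1) : ℂ) ≠ 0 :=
    ofReal_ne_zero.2 (Real.Gamma_pos_of_pos (by linarith)).ne'
  rw [integral_rieszSum_mul_rieszSum ha, betaIntegral_eq_Gamma_div hapos hapos,
    show (a : ℂ) + a = ((2 * a - 1 + 1 : ℝ) : ℂ) by push_cast; ring, Gamma_ofReal (2 * a - 1 + 1),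
    sum_goldbachR_mul_rpow (by linarith), ofReal_mul, ofReal_mul]
  field_simp

theorem exists_norm_integral_rieszSum_sub_le (ha : 1 < a) :
    ∃ C : ℝ, ∀ N : ℕ, 1 ≤ N →
      ‖(∫ x in (0 : ℝ)..N, (rieszSum a N x : ℂ) * (rieszSum a N (N - x) : ℂ))
          - ∫ x in (0 : ℝ)..N, rieszExpansion a x * rieszExpansion a (N - x)‖
        ≤ C * (N : ℝ) ^ (2 * a - 1) * N := by
  obtain ⟨C, hC⟩ := exists_norm_rieszSum_sub_rieszExpansion_le ha
  refine ⟨2 * (Real.log 4 + 4) * C + C ^ 2, fun N hN => ?_⟩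
  have hN1 : (1 : ℝ) ≤ N := by exact_mod_cast hN
  have hN0 : (0 : ℝ) < N := one_pos.trans_le hN1
  refine (norm_integral_mul_comp_sub_sub_le hN0.le
    (continuous_ofReal.comp (continuous_rieszSum ha.le N)).continuousOn
    ((continuousOn_mainPart (one_pos.trans ha) hN1).sub (continuousOn_zeroPart ha hN1))
    (fun x hx => norm_rieszSum_le ha.le hx.2) (hC N)).trans ?_
  gcongr ?_ * _
  have hpow : (N : ℝ) ^ (2 * a - 1) = (N : ℝ) ^ (a - 1) * (N : ℝ) ^ (a - 1) * N := by
    rw [← Real.rpow_add hN0, ← Real.rpow_add_one hN0.ne']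
    ring_nf
  have herr : 0 ≤ C ^ 2 * ((N : ℝ) ^ (a - 1) * (N : ℝ) ^ (a - 1)) := by positivity
  rw [hpow]
  nlinarith [mul_le_mul_of_nonneg_left hN1 herr]

theorem exists_norm_goldbachCesaro_sub_goldbachExpansion_le (ha : 1 < a) :
    ∃ C : ℝ, ∀ N : ℕ, 1 ≤ N →
      ‖(goldbachCesaro (2 * a - 1) N : ℂ) - goldbachExpansion (2 * a - 1) N‖ ≤ C * N := by
  obtain ⟨C, hC⟩ := exists_norm_integral_rieszSum_sub_le ha
  refine ⟨C / ‖Gamma (a : ℂ) ^ 2‖, fun N hN => ?_⟩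
  have hN0 : (0 : ℝ) < N := by exact_mod_cast hN
  have hp : 0 < (N : ℝ) ^ (2 * a - 1) := Real.rpow_pos_of_pos hN0 _
  have hΓ : 0 < ‖Gamma (a : ℂ) ^ 2‖ :=
    norm_pos_iff.2 (pow_ne_zero _ (Gamma_ne_zero_of_re_pos (one_pos.trans ha)))
  have h := hC N hN
  rw [integral_rieszSum_eq_goldbachCesaro ha, integral_rieszExpansion_mul_rieszExpansion ha hN,
    ← mul_sub, norm_mul, norm_mul, norm_real, Real.norm_of_nonneg hp.le] at h
  rw [div_mul_eq_mul_div, le_div_iff₀ hΓ]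
  exact le_of_mul_le_mul_right (by linarith) hp

end GoldbachExpansion

theorem theorem2 :
    ∃ N₀ : ℕ, ∀ k : ℝ, 1 < k → ∃ C : ℝ, ∀ N : ℕ, N₀ ≤ N →
      Summable (fun ρ : zetaZeros => singleTerm k N ρ) ∧
      Summable (fun p : zetaZeros × zetaZeros => doubleTerm k N p.1 p.2) ∧
      ‖(goldbachCesaro k N : ℂ) -
          ((N : ℂ) ^ 2 / Complex.Gamma ((k : ℂ) + 3)
            - 2 * ∑' ρ : zetaZeros, singleTerm k N ρ
            + ∑' ρ₁ : zetaZeros, ∑' ρ₂ : zetaZeros, doubleTerm k N ρ₁ ρ₂)‖ ≤ C * (N : ℝ) := by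
  refine ⟨1, fun k hk => ?_⟩
  obtain ⟨a, rfl⟩ : ∃ a : ℝ, k = 2 * a - 1 := ⟨(k + 1) / 2, by ring⟩
  have ha : 1 < a := by linarith
  obtain ⟨C, hC⟩ := exists_norm_goldbachCesaro_sub_goldbachExpansion_le ha
  exact ⟨C, fun N hN => ⟨summable_singleTerm ha hN, summable_doubleTerm ha hN, hC N hN⟩⟩
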